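/- **Setting.** Let $q,t\in[0,1)$, $N\ge 1$, $a_1,\dots,a_N>0$. Let $\mathbb{GT}_k$ be the set of signatures $\lambda=(\lambda_1\ge\dots\ge\lambda_k)\in\mathbb Z^k$, write $\mu\prec\lambda$ for $\mu\in\mathbb{GT}_{k-1}$, $\lambda\in\mathbb{GT}_k$ with $\lambda_{i+1}\le\mu_i\le\lambda_i$ for all $i$, and let $\mathbb{GT}(N)$ be the set of interlacing arrays $\boldsymbol\lambda=(\lambda^{(1)}\prec\dots\prec\lambda^{(N)})$. For Macdonald polynomials with parameters $(q,t)$ let $\psi_{\lambda/\mu}$ be the coefficient in $P_{\lambda/\mu}(x)=\psi_{\lambda/\mu}x^{|\lambda|-|\mu|}$ (zero unless $\mu\prec\lambda$), and let $\psi'_{\lambda+\mathrm e_j/\lambda}$ be the coefficients in the Pieri rule $(x_1+x_2+\cdots)P_\lambda=\sum_j\psi'_{\lambda+\mathrm e_j/\lambda}P_{\lambda+\mathrm e_j}$ (zero if $\lambda+\mathrm e_j$ is not a signature); all are extended to signatures with negative parts by translation. Put $$\Lambda^k_{k-1}(\lambda,\mu)=\frac{P_\mu(a_1,\dots,a_{k-1})}{P_\lambda(a_1,\dots,a_k)}P_{\lambda/\mu}(a_k),\qquad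 Q_k(\lambda,\nu)=\frac{P_\nu(a_1,\dots,a_k)}{P_\lambda(a_1,\dots,a_k)}\psi'_{\nu/\lambda}\ \text{ if }\nu=\lambda+\mathrm e_j\text{ for some }j,$$ $Q_k(\lambda,\nu)=0$ for the other $\nu\ne\lambda$, and $Q_k(\lambda,\lambda)=-\sum_{\nu\neq\lambda}Q_k(\lambda,\nu)$. **`Dynamics'.** A multivariate `dynamics' of depth $N$ is given by real functions $W_k(\lambda,\nu\,|\,\bar\lambda)$ (rates of independent jumps $\lambda\to\nu$ at level $k$) and $V_k(\lambda,\nu\,|\,\bar\lambda,\bar\nu)$ (probabilities that a move $\bar\lambda\to\bar\nu$ at level $k-1$ triggers $\lambda\to\nu$ at level $k$), $\lambda,\nu\in\mathbb{GT}_k$, $\bar\lambda,\bar\nu\in\mathbb{GT}_{k-1}$, $\bar\lambda\prec\lambda$, where $\bar\nu=\bar\lambda$ or $\bar\nu=\bar\lambda+\bar{\mathrm e}_i$ for some $i$. No nonnegativity is assumed. It is required that $W_k(\lambda,\nu\,|\,\bar\lambda)$ vanishes unless $\nu\in\{\lambda\}\cup\{\lambda+\mathrm e_m\}_m$ and $\bar\lambda\prec\nu$;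 that $V_k(\lambda,\nu\,|\,\bar\lambda,\bar\nu)$ vanishes unless $\nu\in\{\lambda\}\cup\{\lambda+\mathrm e_m\}_m$ and $\bar\nu\prec\nu$; that $\sum_\nu V_k(\lambda,\nu\,|\,\bar\lambda,\bar\nu)=1$, $V_k(\lambda,\nu\,|\,\bar\lambda,\bar\lambda)=1_{\lambda=\nu}$, $\sum_{\nu\ne\lambda}W_k(\lambda,\nu\,|\,\bar\lambda)=-W_k(\lambda,\lambda\,|\,\bar\lambda)$; and that for all $k$, $\lambda,\nu\in\mathbb{GT}_k$ and $\bar\nu\prec\nu$ $$\sum_{\bar\lambda}V_k(\lambda,\nu\,|\,\bar\lambda,\bar\nu)\Lambda^k_{k-1}(\lambda,\bar\lambda)Q_{k-1}(\bar\lambda,\bar\nu)+W_k(\lambda,\nu\,|\,\bar\nu)\Lambda^k_{k-1}(\lambda,\bar\nu)=Q_k(\lambda,\nu)\Lambda^k_{k-1}(\nu,\bar\nu).$$ Its generator is the matrix on $\mathbb{GT}(N)$ with off-diagonal entries $\mathbf Q^{(N)}(\boldsymbol\lambda,\boldsymbol\nu)=W_k(\lambda^{(k)},\nu^{(k)}|\lambda^{(k-1)})\prod_{i=k+1}^N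 V_i(\lambda^{(i)},\nu^{(i)}|\lambda^{(i-1)},\nu^{(i-1)})$, $k$ being the first level at which $\boldsymbol\lambda$ and $\boldsymbol\nu$ differ, and with zero row sums. For $\bar\nu\prec\lambda$ call $j\in\{1,\dots,k\}$ *free* if $j=1$ or $\lambda_j<\bar\nu_{j-1}$, and let $\xi(i)$ be the largest free $j\le i$. The `dynamics' is *nearest neighbour* if, for all $k\ge2$, $\bar\nu\prec\lambda$ and $j$ with $j+1$ free, $V_k(\lambda,\lambda+\mathrm e_m\,|\,\bar\nu-\bar{\mathrm e}_j,\bar\nu)=0$ unless $m=j+1$ or $m=\xi(j)$. At the pair $(\bar\nu,\lambda)$ put $$l_j=V_k(\lambda,\lambda+\mathrm e_{j+1}|\bar\nu-\bar{\mathrm e}_j,\bar\nu),\quad r_j=V_k(\lambda,\lambda+\mathrm e_{\xi(j)}|\bar\nu-\bar{\mathrm e}_j,\bar\nu)\quad(j+1\text{ free}),\qquad w_m=a_k^{-1}W_k(\lambda,\lambda+\mathrm e_m|\bar\nu)\quad(m\text{ free}).$$ These parameters determine a nearest neighbour `dynamics', since a move $\bar\nu-\bar{\mathrm e}_j\to\bar\nu$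 with $\bar\nu\not\prec\lambda$ forces $\lambda\to\lambda+\mathrm e_j$ with probability one. **Fundamental `dynamics'.** With $T_i=\frac{\psi_{\lambda/\bar\nu-\bar{\mathrm e}_i}}{\psi_{\lambda/\bar\nu}}\psi'_{\bar\nu/\bar\nu-\bar{\mathrm e}_i}$ and $S_j=\frac{\psi_{\lambda+\mathrm e_j/\bar\nu}}{\psi_{\lambda/\bar\nu}}\psi'_{\lambda+\mathrm e_j/\lambda}$, consider on the slice formed by the levels $k-1,k$: * $\mathsf{PB}$: $l_j=r_j=0$, $w_m=S_m$; * $\mathsf{RSK}(h)$, $1\le h\le k$: $r_j=T_j^{-1}\big(\sum_{i\le j}S_i-\sum_{i<j}T_i-1_{h\le j}\big)$, $l_j=1-r_j$, $w_m=1_{m=\xi(h)}$; * $\mathsf R(h)$, $1\le h\le k-1$: $r_j=1_{j=h}$, $l_j=0$, $w_m=S_m-1_{m=\xi(h)}T_h$; * $\mathsf L(h)$, $1\le h\le k-1$: $r_j=0$, $l_j=1_{j=h}$, $w_m=S_m-1_{m=h+1}T_h$. The fundamental `dynamics' of depth $N$ are: the push-block dynamics ($\mathsf{PB}$ on every slice);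 the $N!$ RSK-type ones $\mathsf{RSK}[\boldsymbol h]$, $\boldsymbol h=(h^{(1)},\dots,h^{(N)})$, $1\le h^{(j)}\le j$ ($\mathsf{RSK}(h^{(k)})$ at level $k$); the $(N-1)!$ right-pushing ones $\mathsf R[\boldsymbol h]$ and the $(N-1)!$ left-pulling ones $\mathsf L[\boldsymbol h]$, $\boldsymbol h=(h^{(1)},\dots,h^{(N-1)})$, $1\le h^{(j)}\le j$ ($\mathsf R(h^{(k-1)})$, resp. $\mathsf L(h^{(k-1)})$, at level $k\ge2$). At level $1$ all of them have $W_1(\lambda,\lambda+\mathrm e_1)=a_1$. **Mixing.** The mixing of finitely many `dynamics' $(W^f_k,V^f_k)_k$, $f\in F$, with coefficients $\theta^{(k)}_f(\bar\nu,\lambda)\in\mathbb R$, $\sum_f\theta_f^{(k)}(\bar\nu,\lambda)=1$, is given by $$\tilde W_k(\lambda,\nu|\bar\nu)=\sum_f\theta^{(k)}_f(\bar\nu,\lambda)W^f_k(\lambda,\nu|\bar\nu),\qquad \tilde V_k(\lambda,\nu|\bar\lambda,\bar\nu)=\sum_f\theta^{(k)}_f(\bar\nu,\lambda)V^f_k(\lambda,\nu|\bar\lambda,\bar\nu).$$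 **Theorem.** The fundamental `dynamics' are nearest neighbour multivariate `dynamics', and every nearest neighbour multivariate `dynamics' of depth $N$ is a mixing of fundamental ones (its rates $W_k$, its probabilities $V_k$ and its generator coincide with those of the mixing). Moreover, each of the following three families suffices: all RSK-type and all right-pushing `dynamics' together with the push-block dynamics; all RSK-type and all left-pulling `dynamics' together with the push-block dynamics; all right-pushing and all left-pulling `dynamics' together with the push-block dynamics. -/

import Mathlib

noncomputable section

namespace MacdonaldArrays

/-! ### Signatures and interlacing arrays

Rows, particles and levels are numbered from `0` in the code: the index `i : Fin k` of a signature of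
length `k` stands for the particle number `i + 1`, and the slice number `k` consists of the rows
of lengths `k` (lower row) and `k + 1` (upper row). -/

/-- Signatures of length `k`: nonincreasing `k`-tuples of integers. -/
def Sig (k : ℕ) : Type := {l : Fin k → ℤ // Antitone l}

instance (k : ℕ) : CoeFun (Sig k) (fun _ => Fin k → ℤ) := ⟨Subtype.val⟩

/-- `mu ≺ lam`: `lam_{i+1} ≤ mu_i ≤ lam_i` for all `i`. -/
def Interlaces {k : ℕ} (mu : Fin k → ℤ) (lam : Fin (k + 1) → ℤ) : Prop :=
  ∀ i : Fin k, lam i.succ ≤ mu i ∧ mu i ≤ lam i.castSucc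

/-- `nu = lam + e_j`. -/
def AddBox {k : ℕ} (lam nu : Sig k) (j : Fin k) : Prop :=
  (nu : Fin k → ℤ) = (lam : Fin k → ℤ) + Pi.single j 1

/-- Interlacing arrays (Gelfand-Tsetlin schemes) of depth `N`; the row number `0` is the empty
signature. -/
structure GTArray (N : ℕ) where
  row : (k : Fin (N + 1)) → Sig k
  interlaces : ∀ k : Fin N, Interlaces (row k.castSucc) (row k.succ)

/-! ### Macdonald polynomials, stochastic links and univariate dynamics -/

/-- The infinite `q`-Pochhammer symbol `(x; q)_∞`. -/
def qPoch (q x : ℝ) : ℝ := ∏' i : ℕ, (1 - x * q ^ i)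

/-- `f(u) = (t u; q)_∞ / (q u; q)_∞`. -/
def macF (q t u : ℝ) : ℝ := qPoch q (t * u) / qPoch q (q * u)

open Classical in
/-- The branching coefficient `ψ_{nu/kap}(q, t)` of Macdonald polynomials; it vanishes unless
`kap ≺ nu`. -/
def psi (q t : ℝ) {k : ℕ} (nu : Fin (k + 1) → ℤ) (kap : Fin k → ℤ) : ℝ :=
  if Interlaces kap nu then
    ∏ i : Fin k, ∏ j ∈ Finset.Ici i,
      (macF q t (q ^ (kap i - kap j) * t ^ ((j : ℕ) - (i : ℕ))) *
        macF q t (q ^ (nu i.castSucc - nu j.succ) * t ^ ((j : ℕ) - (i : ℕ)))) /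
      (macF q t (q ^ (nu i.castSucc - kap j) * t ^ ((j : ℕ) - (i : ℕ))) *
        macF q t (q ^ (kap i - nu j.succ) * t ^ ((j : ℕ) - (i : ℕ))))
  else 0

/-- The Pieri coefficient `ψ'_{mu + e_j / mu}(q, t)`. It vanishes if `mu_{j-1} = mu_j`, that is, if
`mu + e_j` is not a signature. -/
def psiPrime (q t : ℝ) {k : ℕ} (mu : Fin k → ℤ) (j : Fin k) : ℝ :=
  ∏ i ∈ Finset.Iio j,
    ((1 - q ^ (mu i - mu j) * t ^ ((j : ℕ) - (i : ℕ) - 1)) *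
      (1 - q ^ (mu i - (mu j + 1)) * t ^ ((j : ℕ) - (i : ℕ) + 1))) /
    ((1 - q ^ (mu i - mu j) * t ^ ((j : ℕ) - (i : ℕ))) *
      (1 - q ^ (mu i - (mu j + 1)) * t ^ ((j : ℕ) - (i : ℕ))))

/-- The skew Macdonald (Laurent) polynomial in one variable,
`P_{lam/mu}(x) = ψ_{lam/mu} x^{|lam| - |mu|}`. -/
def skewP (q t : ℝ) {k : ℕ} (x : ℝ) (lam : Sig (k + 1)) (mu : Sig k) : ℝ :=
  psi q t lam mu * x ^ ((∑ i, lam i) - ∑ i, mu i)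

/-- The Macdonald (Laurent) polynomial `P_lam(a_1, …, a_k; q, t)` of a signature `lam` of length `k`,
through the combinatorial formula: the sum of `∏ ψ_{lam^(i)/lam^(i-1)} a_i^{|lam^(i)| - |lam^(i-1)|}` over
all interlacing arrays with top row `lam`, written out row by row. Here `a i` stands for
`a_{i+1}`. -/
def macP (q t : ℝ) (a : ℕ → ℝ) : (k : ℕ) → Sig k → ℝ
  | 0, _ => 1
  | k + 1, lam => ∑ᶠ mu : Sig k, macP q t a k mu * skewP q t (a k) lam mu

/-- The stochastic link with Macdonald parameters from signatures of length `k + 1` to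
signatures of length `k`. -/
def link (q t : ℝ) (a : ℕ → ℝ) (k : ℕ) (lam : Sig (k + 1)) (mu : Sig k) : ℝ :=
  macP q t a k mu / macP q t a (k + 1) lam * skewP q t (a k) lam mu

open Classical in
/-- Jump rates of the univariate dynamics: `P_nu / P_lam · ψ'_{nu/lam}` if `nu = lam + e_j` for some `j`,
and `0` otherwise. -/
def univJump (q t : ℝ) (a : ℕ → ℝ) (k : ℕ) (lam nu : Sig k) : ℝ :=
  ∑ j : Fin k, if AddBox lam nu j then
    macP q t a k nu / macP q t a k lam * psiPrime q t lam j else 0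

open Classical in
/-- The generator `Q_k` of the univariate dynamics on signatures of length `k`. -/
def univQ (q t : ℝ) (a : ℕ → ℝ) (k : ℕ) (lam nu : Sig k) : ℝ :=
  if nu = lam then - ∑ᶠ kap : Sig k, univJump q t a k lam kap else univJump q t a k lam nu

/-! ### Multivariate `dynamics'

No nonnegativity of rates and probabilities is imposed anywhere. -/

/-- Rates of independent jumps and probabilities of triggered moves on one slice:
`W lam nu lamb` is `W(lam, nu | lamb)`, the rate of an independent jump `lam → nu` of the upper row when
the lower row is `lamb`, and `V lam nu lamb nub` is `V(lam, nu | lamb, nub)`, the probability that the move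
`lamb → nub` of the lower row triggers the move `lam → nu` of the upper row. -/
structure SliceData (k : ℕ) where
  W : Sig (k + 1) → Sig (k + 1) → Sig k → ℝ
  V : Sig (k + 1) → Sig (k + 1) → Sig k → Sig k → ℝ

/-- Rates and probabilities on all slices of arrays of depth `N`. -/
abbrev DynData (N : ℕ) : Type := (k : Fin N) → SliceData k

/-- `lamb → nub` is a possible move or the trivial move: `nub = lamb`, or `nub = lamb + e_i` for
some `i`. -/
def Step {k : ℕ} (lamb nub : Sig k) : Prop := nub = lamb ∨ ∃ i, AddBox lamb nub i

/-- Conditions on one slice of a sequential update `dynamics' whose univariate projections are the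
generators `Q_k`. At most one particle of a row moves, by one to the right, and the upper row keeps
interlacing with the lower one. Values of `W` and `V` outside of these situations never
enter the dynamics and are not restricted. -/
structure IsSliceDynamics (q t : ℝ) (a : ℕ → ℝ) (k : ℕ) (D : SliceData k) : Prop where
  support_W : ∀ (lam nu : Sig (k + 1)) (lamb : Sig k), Interlaces lamb lam →
    D.W lam nu lamb ≠ 0 → Step lam nu ∧ Interlaces lamb nu
  support_V : ∀ (lam nu : Sig (k + 1)) (lamb nub : Sig k), Interlaces lamb lam → Step lamb nub →
    D.V lam nu lamb nub ≠ 0 → Step lam nu ∧ Interlaces nub nu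
  sum_V : ∀ (lam : Sig (k + 1)) (lamb nub : Sig k), Interlaces lamb lam → Step lamb nub →
    (∑ᶠ nu : Sig (k + 1), D.V lam nu lamb nub) = 1
  trivial_V : ∀ (lam nu : Sig (k + 1)) (lamb : Sig k), Interlaces lamb lam →
    (nu = lam → D.V lam nu lamb lamb = 1) ∧ (nu ≠ lam → D.V lam nu lamb lamb = 0)
  sum_W : ∀ (lam : Sig (k + 1)) (lamb : Sig k), Interlaces lamb lam →
    (∑ᶠ (nu : Sig (k + 1)) (_ : nu ≠ lam), D.W lam nu lamb) = - D.W lam lam lamb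
  intertwining : ∀ (lam nu : Sig (k + 1)) (nub : Sig k), Interlaces nub nu →
    (∑ᶠ lamb : Sig k, D.V lam nu lamb nub * link q t a k lam lamb * univQ q t a k lamb nub)
        + D.W lam nu nub * link q t a k lam nub
      = univQ q t a (k + 1) lam nu * link q t a k nu nub

/-- Multivariate `dynamics' on interlacing arrays of depth `N` with Macdonald parameters. -/
def IsDynamics (q t : ℝ) (a : ℕ → ℝ) {N : ℕ} (D : DynData N) : Prop :=
  ∀ k : Fin N, IsSliceDynamics q t a k (D k)

open Classical in
/-- Off-diagonal matrix elements of the generator: if the rows of `X` and `Y` coincide strictly below the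
upper row of the slice `k` and differ in that row, then the rate is
`W_k(x_k, y_k | x_{k-1}) ∏_{i > k} V_i(x_i, y_i | x_{i-1}, y_{i-1})`. (The sum over `k` has at most one
nonzero term, and it has none for `X = Y`.) -/
def offDiagRate {N : ℕ} (D : DynData N) (X Y : GTArray N) : ℝ :=
  ∑ k : Fin N,
    if (∀ j : Fin (N + 1), j ≤ k.castSucc → X.row j = Y.row j) ∧ X.row k.succ ≠ Y.row k.succ then
      (D k).W (X.row k.succ) (Y.row k.succ) (X.row k.castSucc) *
        ∏ i ∈ Finset.Ioi k,
          (D i).V (X.row i.succ) (Y.row i.succ) (X.row i.castSucc) (Y.row i.castSucc)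
    else 0

open Classical in
/-- The generator (matrix of jump rates) on arrays of depth `N`. -/
def generator {N : ℕ} (D : DynData N) (X Y : GTArray N) : ℝ :=
  if X = Y then - ∑ᶠ Z : GTArray N, offDiagRate D X Z else offDiagRate D X Y

/-! ### Nearest neighbour `dynamics' -/

/-- The particle `lam_j` of the upper row is free: it is the first one, or `lam_j < nub_{j-1}`. -/
def Free {k : ℕ} (nub : Fin k → ℤ) (lam : Fin (k + 1) → ℤ) (j : Fin (k + 1)) : Prop :=
  ∀ i : Fin k, i.succ = j → lam j < nub i

theorem free_zero {k : ℕ} (nub : Fin k → ℤ) (lam : Fin (k + 1) → ℤ) : Free nub lam 0 :=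
  fun i hi => absurd hi (Fin.succ_ne_zero i)

open Classical in
/-- `ξ(i) = max {j ≤ i : lam_j is free}`. -/
def xi {k : ℕ} (nub : Fin k → ℤ) (lam : Fin (k + 1) → ℤ) (i : Fin (k + 1)) : Fin (k + 1) :=
  (Finset.univ.filter (fun j : Fin (k + 1) => j ≤ i ∧ Free nub lam j)).max'
    ⟨0, Finset.mem_filter.2 ⟨Finset.mem_univ _, Fin.zero_le _, free_zero nub lam⟩⟩

/-- A particle `j` that has moved in the lower row triggers only moves of its left neighbour
`j + 1` or of its first free right neighbour `ξ(j)`, unless the interlacing was broken. -/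
def IsNearestNeighbor {N : ℕ} (D : DynData N) : Prop :=
  ∀ (k : Fin N) (lam nu : Sig (k + 1)) (lamb nub : Sig k) (j : Fin k) (m : Fin (k + 1)),
    Interlaces nub lam → Free nub lam j.succ → AddBox lamb nub j → AddBox lam nu m →
    (D k).V lam nu lamb nub ≠ 0 → m = j.succ ∨ m = xi nub lam j.castSucc

/-- Nearest neighbour multivariate `dynamics' on interlacing arrays of depth `N`. -/
def IsNNDynamics (q t : ℝ) (a : ℕ → ℝ) {N : ℕ} (D : DynData N) : Prop :=
  IsDynamics q t a D ∧ IsNearestNeighbor D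

/-! ### Fundamental `dynamics' -/

/-- `T_i = ψ_{lam/nub - e_i} / ψ_{lam/nub} · ψ'_{nub/nub - e_i}`. -/
def coefT (q t : ℝ) {k : ℕ} (nub : Fin k → ℤ) (lam : Fin (k + 1) → ℤ) (i : Fin k) : ℝ :=
  psi q t lam (nub - Pi.single i 1) / psi q t lam nub * psiPrime q t (nub - Pi.single i 1) i

/-- `S_j = ψ_{lam + e_j/nub} / ψ_{lam/nub} · ψ'_{lam + e_j/lam}`. -/
def coefS (q t : ℝ) {k : ℕ} (nub : Fin k → ℤ) (lam : Fin (k + 1) → ℤ) (j : Fin (k + 1)) : ℝ :=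
  psi q t (lam + Pi.single j 1) nub / psi q t lam nub * psiPrime q t lam j

/-- Parameters of a nearest neighbour `dynamics' at one pair `(nub, lam)`: `w m` is the rate of the
independent jump of `lam_m` divided by `a_k`, and `r j`, `l j` are the probabilities that the moved
particle `nub_j` pushes `lam_{ξ(j)}` and pulls `lam_{j+1}`, respectively. -/
structure NNParams (k : ℕ) where
  w : Fin (k + 1) → ℝ
  r : Fin k → ℝ
  l : Fin k → ℝ

open Classical in
/-- The rates and probabilities with given parameters. If the move `nub - e_j → nub` of the lower row
breaks the interlacing, then `lam_j` moves with probability one (short-range pushing). -/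
def sliceOfParams {k : ℕ} (x : ℝ) (p : Sig k → Sig (k + 1) → NNParams k) : SliceData k where
  W := fun lam nu nub =>
    if nu = lam then - ∑ m : Fin (k + 1), (if Free nub lam m then x * (p nub lam).w m else 0)
    else ∑ m : Fin (k + 1), (if AddBox lam nu m ∧ Free nub lam m then x * (p nub lam).w m else 0)
  V := fun lam nu lamb nub =>
    if nub = lamb then (if nu = lam then 1 else 0)
    else ∑ j : Fin k,
      if AddBox lamb nub j then
        if Interlaces nub lam then
          (if AddBox lam nu (xi nub lam j.castSucc) then (p nub lam).r j else 0)
            + (if AddBox lam nu j.succ then (p nub lam).l j else 0)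
            + (if nu = lam then 1 - (p nub lam).r j - (p nub lam).l j else 0)
        else (if AddBox lam nu j.castSucc then 1 else 0)
      else 0

/-- Push-block parameters: no long-range interaction. -/
def pbParams (q t : ℝ) {k : ℕ} (nub : Sig k) (lam : Sig (k + 1)) : NNParams k where
  w := fun m => coefS q t nub lam m
  r := fun _ => 0
  l := fun _ => 0

/-- RSK-type parameters: only `lam_h` jumps independently, at rate `a_k`, and donates its
jump to `lam_{ξ(h)}` if it is blocked; every move propagates. Here
`r_j = T_j⁻¹ (S_1 + … + S_j - T_1 - … - T_{j-1} - 1_{h ≤ j})`. -/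
def rskParams (q t : ℝ) {k : ℕ} (h : Fin (k + 1)) (nub : Sig k) (lam : Sig (k + 1)) :
    NNParams k where
  w := fun m => if xi nub lam h = m then 1 else 0
  r := fun j => (coefT q t nub lam j)⁻¹ *
    ((∑ i ∈ Finset.Iic j, coefS q t nub lam i.castSucc) - (∑ i ∈ Finset.Iio j, coefT q t nub lam i)
      - (if h ≤ j.castSucc then 1 else 0))
  l := fun j => 1 - (coefT q t nub lam j)⁻¹ *
    ((∑ i ∈ Finset.Iic j, coefS q t nub lam i.castSucc) - (∑ i ∈ Finset.Iio j, coefT q t nub lam i)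
      - (if h ≤ j.castSucc then 1 else 0))

/-- Right-pushing parameters: only `nub_h` pushes, with probability one, and nobody pulls. -/
def rightParams (q t : ℝ) {k : ℕ} (h : Fin k) (nub : Sig k) (lam : Sig (k + 1)) :
    NNParams k where
  w := fun m => coefS q t nub lam m - (if xi nub lam h.castSucc = m then coefT q t nub lam h else 0)
  r := fun j => if j = h then 1 else 0
  l := fun _ => 0

/-- Left-pulling parameters: only `nub_h` pulls, with probability one, and nobody pushes. -/
def leftParams (q t : ℝ) {k : ℕ} (h : Fin k) (nub : Sig k) (lam : Sig (k + 1)) :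
    NNParams k where
  w := fun m => coefS q t nub lam m - (if h.succ = m then coefT q t nub lam h else 0)
  r := fun _ => 0
  l := fun j => if j = h then 1 else 0

/-- Sequences `(h^(1), …, h^(N))` with `1 ≤ h^(j) ≤ j`; there are `N!` of them. -/
abbrev RSKIndex (N : ℕ) : Type := (k : Fin N) → Fin (k + 1)

/-- Sequences `(h^(1), …, h^(N-1))` with `1 ≤ h^(j) ≤ j`; there are `(N-1)!` of them. -/
abbrev RLIndex (N : ℕ) : Type := (k : Fin N) → 0 < (k : ℕ) → Fin k

/-- The push-block dynamics. -/
def pushBlock (q t : ℝ) (a : ℕ → ℝ) (N : ℕ) : DynData N :=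
  fun k => sliceOfParams (a k) (pbParams q t)

/-- The RSK-type fundamental `dynamics' with index `h`. -/
def rskDyn (q t : ℝ) (a : ℕ → ℝ) {N : ℕ} (h : RSKIndex N) : DynData N :=
  fun k => sliceOfParams (a k) (rskParams q t (h k))

/-- The right-pushing fundamental `dynamics' with index `h`; at the first level it acts as all the
others do. -/
def rightDyn (q t : ℝ) (a : ℕ → ℝ) {N : ℕ} (h : RLIndex N) : DynData N :=
  fun k => sliceOfParams (a k)
    (if hk : 0 < (k : ℕ) then rightParams q t (h k hk) else pbParams q t)

/-- The left-pulling fundamental `dynamics' with index `h`; at the first level it acts as all the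
others do. -/
def leftDyn (q t : ℝ) (a : ℕ → ℝ) {N : ℕ} (h : RLIndex N) : DynData N :=
  fun k => sliceOfParams (a k)
    (if hk : 0 < (k : ℕ) then leftParams q t (h k hk) else pbParams q t)

/-! ### Mixing -/

/-- The mixing of finitely many `dynamics' with coefficients `θ i k nub lam`, which depend on the new state
`nub` of the lower row and on the old state `lam` of the upper row of the slice `k`. -/
def mix {ι : Type} [Fintype ι] {N : ℕ} (θ : ι → (k : Fin N) → Sig k → Sig (k + 1) → ℝ)
    (F : ι → DynData N) : DynData N :=
  fun k =>
    { W := fun lam nu nub => ∑ i, θ i k nub lam * (F i k).W lam nu nub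
      V := fun lam nu lamb nub => ∑ i, θ i k nub lam * (F i k).V lam nu lamb nub }

/-- Two families of rates and probabilities agree at all states that interlace and all moves of
the lower row. -/
def SameRates {N : ℕ} (D D' : DynData N) : Prop :=
  ∀ (k : Fin N) (lam nu : Sig (k + 1)) (lamb : Sig k), Interlaces lamb lam →
    (D k).W lam nu lamb = (D' k).W lam nu lamb ∧
    ∀ nub : Sig k, Step lamb nub → (D k).V lam nu lamb nub = (D' k).V lam nu lamb nub

/-- `D` is a mixing, with coefficients that sum to one, of the members of the finite family `F`. -/
def IsMixing {ι : Type} [Fintype ι] {N : ℕ} (D : DynData N) (F : ι → DynData N) : Prop :=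
  ∃ θ : ι → (k : Fin N) → Sig k → Sig (k + 1) → ℝ,
    (∀ (k : Fin N) (nub : Sig k) (lam : Sig (k + 1)), ∑ i, θ i k nub lam = 1) ∧
    SameRates D (mix θ F) ∧ generator D = generator (mix θ F)

end MacdonaldArrays

end

open MacdonaldArrays

noncomputable section

namespace MacdonaldArrays

open Finset

variable {q t : ℝ} {k N : ℕ}

/-! ### Infinite `q`-Pochhammer symbols -/

/-! Everything is decided at one pair of rows `nub ≺ lam` of one slice. For a move `lam → lam + e_m`
with `m` free, the intertwining relation, divided by a positive factor common to all terms, is the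
linear equation `w_m + Σ_{ξ(j)=m} T_j r_j + Σ_{j+1=m} T_j l_j = S_m` (`SolvesSystem`). The relation
for `nu = lam` is the sum of these equations, thanks to the identity `Σ S = 1 + Σ T`. If `nub` does
not interlace with `lam`, what remains is an identity between the coefficients of one forced move
(`psi_blocked`). Hence parameters that solve the linear system give a dynamics
(`isSliceDynamics_sliceOfParams`), and the fundamental ones are checked against this system; for the
RSK type the check is a telescoping sum over blocks of non-free particles (`sum_xi_eq`).

Conversely, the triggered moves of a nearest neighbour dynamics are described by `r` and `l`
(`exists_params`), and the independent rates are determined by the triggered ones, because the link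
at an interlacing pair is nonzero (`W_eq_sum`). All conditions are affine, so a mixing reproduces a
given dynamics as soon as its weights sum to one and reproduce `r_j` and `l_j` whenever `j + 1` is
free. In the space of pairs `(r, l)` push-block is the origin and right-pushing and left-pulling
give the unit vectors. The RSK points lie in `r + l = 1`, and their differences sweep out every
direction with `r + l = 0`, since `r_j` depends on `h` only through `-T_j⁻¹ 1_{h ≤ j}` and `T_j >
0`. So push-block with any two of the three other families spans. The weights may be chosen
independently on each slice.

The analytic core is `Σ S = 1 + Σ T` (`sum_coefS_eq`). In the variables `x_i = q^{lam_i} t^{-i}`,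
`w_j = q^{nub_j - 1} t^{-j}`, `s = t / q`, both sums are sums of residues of one rational function
(`sum_residues_eq_one`). This settles generic `(q, t)`, and continuity extends it to the whole
square, including `q = 0` and `t = 0`. The same identity is the one-variable skew Pieri rule
(`skew_pieri`), from which the Pieri rule follows by branching; the latter shows that the total jump
rate of `Q_k` is `a_1 + … + a_k`, as the diagonal relation requires. -/

theorem summable_neg_mul_pow {q : ℝ} (hq : 0 ≤ q) (hq1 : q < 1) (x : ℝ) :
    Summable fun i : ℕ => -(x * q ^ i) :=
  ((summable_geometric_of_lt_one hq hq1).mul_left x).neg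

theorem qPoch_eq_one_sub_mul {q : ℝ} (hq : 0 ≤ q) (hq1 : q < 1) (x : ℝ) :
    qPoch q x = (1 - x) * qPoch q (q * x) := by
  have h : Multipliable fun i : ℕ => 1 - x * q ^ (i + 1) := by
    have h1 : (fun i : ℕ => 1 + -(q * x * q ^ i)) = fun i : ℕ => 1 - x * q ^ (i + 1) :=
      funext fun i => by ring
    rw [← h1]
    exact Real.multipliable_one_add_of_summable (summable_neg_mul_pow hq hq1 (q * x))
  have h2 : qPoch q (q * x) = ∏' i : ℕ, (1 - x * q ^ (i + 1)) :=
    tprod_congr fun i => by ring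
  rw [h2]
  have h3 := tprod_eq_zero_mul' (f := fun i : ℕ => 1 - x * q ^ i) h
  rw [pow_zero, mul_one] at h3
  exact h3

theorem qPoch_pos {q x : ℝ} (hq : 0 ≤ q) (hq1 : q < 1) (hx : 0 ≤ x) (hx1 : x < 1) :
    0 < qPoch q x := by
  have h := summable_neg_mul_pow hq hq1 x
  have hpos : ∀ i : ℕ, 0 < 1 + -(x * q ^ i) := fun i => by
    have h1 : q ^ i ≤ 1 := pow_le_one₀ hq hq1.le
    have h2 : x * q ^ i ≤ x * 1 := mul_le_mul_of_nonneg_left h1 hx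
    linarith
  have := Real.rexp_tsum_eq_tprod hpos (Real.summable_log_one_add_of_summable h)
  unfold qPoch
  simp only [← sub_eq_add_neg] at this
  rw [← this]
  exact Real.exp_pos _

theorem macF_pos {q t u : ℝ} (hq : 0 ≤ q) (hq1 : q < 1) (ht : 0 ≤ t) (ht1 : t < 1)
    (hu : 0 ≤ u) (hu1 : u ≤ 1) : 0 < macF q t u :=
  div_pos
    (qPoch_pos hq hq1 (mul_nonneg ht hu) (by nlinarith))
    (qPoch_pos hq hq1 (mul_nonneg hq hu) (by nlinarith))

/-- Shifting the argument by `q` peels one factor off each Pochhammer symbol. This functional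
equation is what turns every ratio of branching coefficients into a finite rational expression. -/
theorem macF_mul_eq {q t u : ℝ} (hq : 0 ≤ q) (hq1 : q < 1)
    (hu : 0 ≤ u) (hu1 : u ≤ 1) :
    macF q t (q * u) * (1 - t * u) = macF q t u * (1 - q * u) := by
  have h1 := qPoch_eq_one_sub_mul hq hq1 (t * u)
  have h2 := qPoch_eq_one_sub_mul hq hq1 (q * u)
  have h3 : 0 < qPoch q (q * (q * u)) :=
    qPoch_pos hq hq1 (by positivity) (by nlinarith [mul_nonneg hq hu])
  have h4 : 0 < 1 - q * u := by nlinarith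
  unfold macF
  rw [h1, h2, show t * (q * u) = q * (t * u) by ring]
  field_simp

/-! ### Powers with nonnegative exponents -/

theorem zpow_mul_pow_nonneg {q t : ℝ} (hq : 0 ≤ q) (ht : 0 ≤ t) (n : ℤ) (d : ℕ) :
    0 ≤ q ^ n * t ^ d := by positivity

theorem zpow_le_one_of_nonneg {q : ℝ} (hq : 0 ≤ q) (hq1 : q ≤ 1) {n : ℤ} (hn : 0 ≤ n) :
    q ^ n ≤ 1 := by
  lift n to ℕ using hn
  simpa using pow_le_one₀ hq hq1

theorem zpow_mul_pow_le_one {q t : ℝ} (hq : 0 ≤ q) (hq1 : q < 1) (ht : 0 ≤ t) (ht1 : t < 1)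
    {n : ℤ} (hn : 0 ≤ n) (d : ℕ) : q ^ n * t ^ d ≤ 1 :=
  mul_le_one₀ (zpow_le_one_of_nonneg hq hq1.le hn) (by positivity) (pow_le_one₀ ht ht1.le)

theorem zpow_mul_pow_lt_one {q t : ℝ} (hq : 0 ≤ q) (hq1 : q < 1) (ht : 0 ≤ t) (ht1 : t < 1)
    {n : ℤ} {d : ℕ} (hn : 0 ≤ n) (hnd : 0 < n ∨ 0 < d) : q ^ n * t ^ d < 1 := by
  have h2 : t ^ d ≤ 1 := pow_le_one₀ ht ht1.le
  have h1 := zpow_le_one_of_nonneg hq hq1.le hn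
  rcases hnd with h | h
  · lift n to ℕ using hn
    have : q ^ n < 1 := pow_lt_one₀ hq hq1 (by omega)
    rw [zpow_natCast] at *
    nlinarith [pow_nonneg hq n]
  · have : t ^ d < 1 := pow_lt_one₀ ht ht1 (by omega)
    nlinarith [zpow_nonneg hq n, pow_nonneg ht d]

/-- The sign condition matters because `q = 0` is allowed: at `n = -1` the left side is `1` and the
right side is `0`. -/
theorem zpow_add_one_of_nonneg {q : ℝ} {n : ℤ} (hn : 0 ≤ n) : q ^ (n + 1) = q * q ^ n := by
  lift n to ℕ using hn
  rw [show (n : ℤ) + 1 = ((n + 1 : ℕ) : ℤ) by push_cast; rfl, zpow_natCast, zpow_natCast, pow_succ']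

/-- The ratio `f(q^{n+1} t^d) / f(q^n t^d)`. -/
def macE (q t : ℝ) (n : ℤ) (d : ℕ) : ℝ := (1 - q ^ (n + 1) * t ^ d) / (1 - q ^ n * t ^ (d + 1))

/-- The two parameters of Macdonald polynomials lie in `[0, 1)`. -/
structure Admissible (q t : ℝ) : Prop where
  q_nonneg : 0 ≤ q
  q_lt_one : q < 1
  t_nonneg : 0 ≤ t
  t_lt_one : t < 1

theorem Admissible.one_sub_pos (h : Admissible q t) {n : ℤ} {d : ℕ} (hn : 0 ≤ n)
    (hnd : 0 < n ∨ 0 < d) : 0 < 1 - q ^ n * t ^ d :=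
  sub_pos.2 (zpow_mul_pow_lt_one h.q_nonneg h.q_lt_one h.t_nonneg h.t_lt_one hn hnd)

theorem Admissible.macF_pos (h : Admissible q t) {n : ℤ} (hn : 0 ≤ n) (d : ℕ) :
    0 < macF q t (q ^ n * t ^ d) :=
  MacdonaldArrays.macF_pos h.q_nonneg h.q_lt_one h.t_nonneg h.t_lt_one
    (zpow_mul_pow_nonneg h.q_nonneg h.t_nonneg n d)
    (zpow_mul_pow_le_one h.q_nonneg h.q_lt_one h.t_nonneg h.t_lt_one hn d)

theorem Admissible.macE_pos (h : Admissible q t) {n : ℤ} (hn : 0 ≤ n) (d : ℕ) :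
    0 < macE q t n d :=
  div_pos (h.one_sub_pos (by omega) (by omega)) (h.one_sub_pos hn (by omega))

theorem Admissible.macF_succ (h : Admissible q t) {n : ℤ} (hn : 0 ≤ n) (d : ℕ) :
    macF q t (q ^ (n + 1) * t ^ d) = macF q t (q ^ n * t ^ d) * macE q t n d := by
  have h1 := macF_mul_eq (t := t) h.q_nonneg h.q_lt_one
    (zpow_mul_pow_nonneg h.q_nonneg h.t_nonneg n d)
    (zpow_mul_pow_le_one h.q_nonneg h.q_lt_one h.t_nonneg h.t_lt_one hn d)
  have h2 : 0 < 1 - q ^ n * t ^ (d + 1) := h.one_sub_pos hn (by omega)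
  unfold macE
  rw [mul_div_assoc', eq_div_iff h2.ne', zpow_add_one_of_nonneg hn]
  rw [pow_succ, show q ^ n * (t ^ d * t) = t * (q ^ n * t ^ d) by ring, mul_assoc q]
  exact h1

/-! ### Products over pairs of indices in which only one row or one column matters -/

/-- Moving one particle changes the double product defining `psi` only in one row and one column of
index pairs. This lemma and the next collapse such products to single ones; for the last particle of
the upper row there is no row, for the first no column. -/
theorem prod_prod_Ici_ite_castSucc_eq {k : ℕ} (m : Fin (k + 1)) (α : Fin k → ℝ) :
    (∏ i : Fin k, ∏ j ∈ Ici i, if i.castSucc = m then α j else 1)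
      = ∏ j : Fin k, if m ≤ j.castSucc then α j else 1 := by
  induction m using Fin.lastCases with
  | last =>
    rw [prod_eq_one, prod_eq_one]
    · intro j _
      rw [if_neg]
      exact not_le.2 (Fin.castSucc_lt_last j)
    · intro i _
      exact prod_eq_one fun j _ => if_neg (Fin.castSucc_lt_last i).ne
  | cast m =>
    rw [prod_eq_single m]
    · simp only [if_true, Fin.castSucc_le_castSucc_iff]
      rw [← prod_filter]
      congr 1
      ext j
      simp
    · intro i _ hi
      exact prod_eq_one fun j _ => if_neg fun h => hi (Fin.castSucc_injective _ h)
    · simp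

theorem prod_prod_Ici_ite_succ_eq {k : ℕ} (m : Fin (k + 1)) (β : Fin k → ℝ) :
    (∏ i : Fin k, ∏ j ∈ Ici i, if j.succ = m then β i else 1)
      = ∏ i : Fin k, if i.castSucc < m then β i else 1 := by
  refine prod_congr rfl fun i _ => ?_
  induction m using Fin.cases with
  | zero => simp [Fin.succ_ne_zero]
  | succ m =>
    simp only [Fin.succ_inj, Fin.castSucc_lt_succ_iff]
    rw [prod_ite_eq']
    simp

/-! ### Interlacing -/

theorem Interlaces.antitone_upper {mu : Fin k → ℤ} {lam : Fin (k + 1) → ℤ}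
    (h : Interlaces mu lam) : Antitone lam :=
  Fin.antitone_iff_succ_le.2 fun i => (h i).1.trans (h i).2

theorem Interlaces.antitone_lower {mu : Fin k → ℤ} {lam : Fin (k + 1) → ℤ}
    (h : Interlaces mu lam) : Antitone mu := by
  cases k with
  | zero => exact fun i => i.elim0
  | succ k =>
    refine Fin.antitone_iff_succ_le.2 fun i => ?_
    have h1 := (h i.succ).2
    have h2 := (h i.castSucc).1
    rw [Fin.succ_castSucc] at h2
    exact h1.trans h2

theorem Interlaces.le_of_le {mu : Fin k → ℤ} {lam : Fin (k + 1) → ℤ} (h : Interlaces mu lam)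
    {i j : Fin k} (hij : i ≤ j) : mu j ≤ lam i.castSucc :=
  (h.antitone_lower hij).trans (h i).2

theorem Interlaces.ge_of_le {mu : Fin k → ℤ} {lam : Fin (k + 1) → ℤ} (h : Interlaces mu lam)
    {i j : Fin k} (hij : i ≤ j) : lam j.succ ≤ mu i :=
  (h j).1.trans (h.antitone_lower hij)

theorem Interlaces.upper_le_of_le {mu : Fin k → ℤ} {lam : Fin (k + 1) → ℤ} (h : Interlaces mu lam)
    {i j : Fin k} (hij : i ≤ j) : lam j.succ ≤ lam i.castSucc :=
  h.antitone_upper ((Fin.castSucc_lt_succ_iff.2 hij).le)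

theorem Interlaces.lt_of_free {mu : Fin k → ℤ} {lam : Fin (k + 1) → ℤ} (h : Interlaces mu lam)
    {m : Fin (k + 1)} (hm : Free mu lam m) {i : Fin k} (hi : i.castSucc < m) : lam m < mu i := by
  induction m using Fin.cases with
  | zero => exact absurd hi (Fin.not_lt_zero _)
  | succ m =>
    exact (hm m rfl).trans_le (h.antitone_lower (Fin.castSucc_lt_succ_iff.1 hi))

theorem Interlaces.upper_lt_of_free {mu : Fin k → ℤ} {lam : Fin (k + 1) → ℤ}
    (h : Interlaces mu lam) {m : Fin (k + 1)} (hm : Free mu lam m) {i : Fin k}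
    (hi : i.castSucc < m) : lam m < lam i.castSucc :=
  (h.lt_of_free hm hi).trans_le (h i).2

theorem interlaces_add_single_iff {mu : Fin k → ℤ} {lam : Fin (k + 1) → ℤ}
    (h : Interlaces mu lam) (m : Fin (k + 1)) :
    Interlaces mu (lam + Pi.single m 1) ↔ Free mu lam m := by
  constructor
  · rintro h' i rfl
    have := (h' i).1
    simp only [Pi.add_apply, Pi.single_eq_same] at this
    omega
  · intro hm i
    have h1 := h i
    have h2 := hm i
    simp only [Pi.add_apply, Pi.single_apply]
    constructor
    · split_ifs with hi
      · have := h2 hi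
        subst hi
        omega
      · omega
    · split_ifs <;> omega

theorem interlaces_sub_single_iff {mu : Fin k → ℤ} {lam : Fin (k + 1) → ℤ}
    (h : Interlaces mu lam) (j : Fin k) :
    Interlaces (mu - Pi.single j 1) lam ↔ Free mu lam j.succ := by
  constructor
  · intro h' i hi
    obtain rfl := Fin.succ_injective _ hi
    have := (h' i).1
    simp only [Pi.sub_apply, Pi.single_eq_same] at this
    omega
  · intro hj i
    have h1 := h i
    have h2 := hj j rfl
    simp only [Pi.sub_apply, Pi.single_apply]
    split_ifs with hi
    · subst hi
      omega
    · omega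

/-! ### Explicit ratios of branching coefficients -/

theorem psi_of_interlaces {nu : Fin (k + 1) → ℤ} {kap : Fin k → ℤ} (h : Interlaces kap nu) :
    psi q t nu kap = ∏ i : Fin k, ∏ j ∈ Ici i,
      (macF q t (q ^ (kap i - kap j) * t ^ ((j : ℕ) - (i : ℕ))) *
        macF q t (q ^ (nu i.castSucc - nu j.succ) * t ^ ((j : ℕ) - (i : ℕ)))) /
      (macF q t (q ^ (nu i.castSucc - kap j) * t ^ ((j : ℕ) - (i : ℕ))) *
        macF q t (q ^ (kap i - nu j.succ) * t ^ ((j : ℕ) - (i : ℕ)))) := if_pos h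

theorem psi_of_not_interlaces {nu : Fin (k + 1) → ℤ} {kap : Fin k → ℤ} (h : ¬ Interlaces kap nu) :
    psi q t nu kap = 0 := if_neg h

theorem Admissible.psi_pos (hqt : Admissible q t) {nu : Fin (k + 1) → ℤ} {kap : Fin k → ℤ}
    (h : Interlaces kap nu) : 0 < psi q t nu kap := by
  rw [psi_of_interlaces h]
  refine prod_pos fun i _ => prod_pos fun j hj => ?_
  have hij := mem_Ici.1 hj
  have h1 := h.antitone_lower hij
  have h2 := h.upper_le_of_le hij
  have h3 := h.le_of_le hij
  have h4 := h.ge_of_le hij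
  exact div_pos (mul_pos (hqt.macF_pos (by omega) _) (hqt.macF_pos (by omega) _))
    (mul_pos (hqt.macF_pos (by omega) _) (hqt.macF_pos (by omega) _))

theorem Admissible.psi_nonneg (hqt : Admissible q t) (nu : Fin (k + 1) → ℤ) (kap : Fin k → ℤ) :
    0 ≤ psi q t nu kap := by
  by_cases h : Interlaces kap nu
  · exact (hqt.psi_pos h).le
  · exact (psi_of_not_interlaces h).ge

/-- Only factors containing `lam m` change: as `lam i.castSucc` in a row, where exponents grow by
one, or as `lam j.succ` in a column, where they drop by one. Freeness of `m` keeps the lowered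
exponents nonnegative, so that `macF_succ` applies. -/
theorem Admissible.psi_add_single (hqt : Admissible q t) {lam : Fin (k + 1) → ℤ} {nu : Fin k → ℤ}
    (h : Interlaces nu lam) {m : Fin (k + 1)} (hm : Free nu lam m) :
    psi q t (lam + Pi.single m 1) nu = psi q t lam nu *
      ((∏ j : Fin k, if m ≤ j.castSucc then
          macE q t (lam m - lam j.succ) (j - m) / macE q t (lam m - nu j) (j - m) else 1) *
        ∏ i : Fin k, if i.castSucc < m then
          macE q t (nu i - lam m - 1) (m - 1 - i) / macE q t (lam i.castSucc - lam m - 1) (m - 1 - i)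
          else 1) := by
  rw [psi_of_interlaces h, psi_of_interlaces ((interlaces_add_single_iff h m).2 hm),
    ← prod_prod_Ici_ite_castSucc_eq, ← prod_prod_Ici_ite_succ_eq, ← prod_mul_distrib,
    ← prod_mul_distrib]
  refine prod_congr rfl fun i _ => ?_
  rw [← prod_mul_distrib, ← prod_mul_distrib]
  refine prod_congr rfl fun j hj => ?_
  have hij := mem_Ici.1 hj
  have h1 := h.antitone_lower hij
  have h2 := h.upper_le_of_le hij
  have h3 := h.le_of_le hij
  have h4 := h.ge_of_le hij
  by_cases hi : i.castSucc = m
  · have hjm : j.succ ≠ m := by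
      rw [← hi]
      exact (Fin.castSucc_lt_succ_iff.2 hij).ne'
    subst hi
    have e1 := (hqt.macE_pos (n := lam i.castSucc - lam j.succ) (by omega) (j - i)).ne'
    have e2 := (hqt.macE_pos (n := lam i.castSucc - nu j) (by omega) (j - i)).ne'
    have f1 := (hqt.macF_pos (n := lam i.castSucc - nu j) (by omega) (j - i)).ne'
    have f2 := (hqt.macF_pos (n := nu i - lam j.succ) (by omega) (j - i)).ne'
    simp only [Pi.add_apply, Pi.single_eq_same, Pi.single_eq_of_ne hjm, add_zero, if_true,
      if_neg hjm, mul_one, Fin.val_castSucc]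
    rw [show lam i.castSucc + 1 - lam j.succ = lam i.castSucc - lam j.succ + 1 by ring,
      show lam i.castSucc + 1 - nu j = lam i.castSucc - nu j + 1 by ring,
      hqt.macF_succ (by omega), hqt.macF_succ (by omega)]
    field_simp
  · by_cases hjm : j.succ = m
    · subst hjm
      have h5 : lam j.succ < nu i := h.lt_of_free hm (Fin.castSucc_lt_succ_iff.2 hij)
      have h6 := h.upper_lt_of_free hm (Fin.castSucc_lt_succ_iff.2 hij)
      have e1 := (hqt.macE_pos (n := lam i.castSucc - lam j.succ - 1) (by omega) (j - i)).ne'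
      have e2 := (hqt.macE_pos (n := nu i - lam j.succ - 1) (by omega) (j - i)).ne'
      have f1 := (hqt.macF_pos (n := lam i.castSucc - nu j) (by omega) (j - i)).ne'
      have f2 := (hqt.macF_pos (n := nu i - lam j.succ - 1) (by omega) (j - i)).ne'
      simp only [Pi.add_apply, Pi.single_eq_same, Pi.single_eq_of_ne hi, add_zero, if_true,
        if_neg hi, one_mul, Fin.val_succ, Nat.add_sub_cancel]
      rw [show lam i.castSucc - (lam j.succ + 1) = lam i.castSucc - lam j.succ - 1 by ring,
        show nu i - (lam j.succ + 1) = nu i - lam j.succ - 1 by ring]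
      have g1 := hqt.macF_succ (n := lam i.castSucc - lam j.succ - 1) (by omega) (j - i)
      have g2 := hqt.macF_succ (n := nu i - lam j.succ - 1) (by omega) (j - i)
      rw [sub_add_cancel] at g1 g2
      rw [g1, g2]
      field_simp
    · simp [hi, hjm]

/-- The same bookkeeping for a lower particle. The factor with `kap j - kap j` is unaffected by the
shift, which explains the exceptional value `1` on the diagonal. -/
theorem Admissible.psi_lower_add_single (hqt : Admissible q t) {lam : Fin (k + 1) → ℤ}
    {kap : Fin k → ℤ} {j : Fin k} (h : Interlaces kap lam)
    (h' : Interlaces (kap + Pi.single j 1) lam) :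
    psi q t lam (kap + Pi.single j 1) = psi q t lam kap *
      ((∏ l : Fin k, if j.castSucc ≤ l.castSucc then
          (if l = j then 1 else macE q t (kap j - kap l) (l - j)) /
            macE q t (kap j - lam l.succ) (l - j) else 1) *
        ∏ i : Fin k, if i.castSucc < j.succ then
          macE q t (lam i.castSucc - kap j - 1) (j - i) /
            (if i = j then 1 else macE q t (kap i - kap j - 1) (j - i))
          else 1) := by
  rw [psi_of_interlaces h, psi_of_interlaces h',
    ← prod_prod_Ici_ite_castSucc_eq, ← prod_prod_Ici_ite_succ_eq, ← prod_mul_distrib,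
    ← prod_mul_distrib]
  refine prod_congr rfl fun i _ => ?_
  rw [← prod_mul_distrib, ← prod_mul_distrib]
  refine prod_congr rfl fun l hl => ?_
  have hil := mem_Ici.1 hl
  have h1 := h.antitone_lower hil
  have h1' := h'.antitone_lower hil
  have h2 := h.upper_le_of_le hil
  have h3 := h.le_of_le hil
  have h3' := h'.le_of_le hil
  have h4 := h.ge_of_le hil
  simp only [Fin.castSucc_inj, Fin.succ_inj]
  have f1 := (hqt.macF_pos (n := lam i.castSucc - kap l) (by omega) (l - i)).ne'
  have f2 := (hqt.macF_pos (n := kap i - lam l.succ) (by omega) (l - i)).ne'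
  by_cases hi : i = j
  · subst hi
    have e2 := (hqt.macE_pos (n := kap i - lam l.succ) (by omega) (l - i)).ne'
    have g2 := hqt.macF_succ (n := kap i - lam l.succ) (by omega) (l - i)
    rw [show kap i - lam l.succ + 1 = kap i + 1 - lam l.succ by ring] at g2
    by_cases hli : l = i
    · subst hli
      simp only [Pi.add_apply, Pi.single_eq_same] at h3'
      have e1 := (hqt.macE_pos (n := lam l.castSucc - kap l - 1) (by omega) (l - l)).ne'
      have g1 := hqt.macF_succ (n := lam l.castSucc - kap l - 1) (by omega) (l - l)
      rw [sub_add_cancel] at g1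
      have f3 := (hqt.macF_pos (n := lam l.castSucc - kap l - 1) (by omega) (l - l)).ne'
      simp only [Pi.add_apply, Pi.single_eq_same, if_true]
      rw [g2, show lam l.castSucc - (kap l + 1) = lam l.castSucc - kap l - 1 by ring, g1,
        add_sub_add_right_eq_sub]
      field_simp
    · have g3 := hqt.macF_succ (n := kap i - kap l) (by omega) (l - i)
      rw [show kap i - kap l + 1 = kap i + 1 - kap l by ring] at g3
      simp only [Pi.add_apply, Pi.single_eq_same, Pi.single_eq_of_ne hli, add_zero, if_true,
        if_neg hli, mul_one]
      rw [g2, g3]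
      field_simp
  · by_cases hlj : l = j
    · subst hlj
      simp only [Pi.add_apply, Pi.single_eq_same, Pi.single_eq_of_ne hi, add_zero] at h3' h1'
      have e1 := (hqt.macE_pos (n := lam i.castSucc - kap l - 1) (by omega) (l - i)).ne'
      have g1 := hqt.macF_succ (n := lam i.castSucc - kap l - 1) (by omega) (l - i)
      have f3 := (hqt.macF_pos (n := lam i.castSucc - kap l - 1) (by omega) (l - i)).ne'
      have e3 := (hqt.macE_pos (n := kap i - kap l - 1) (by omega) (l - i)).ne'
      have g3 := hqt.macF_succ (n := kap i - kap l - 1) (by omega) (l - i)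
      rw [sub_add_cancel] at g1 g3
      simp only [Pi.add_apply, Pi.single_eq_same, Pi.single_eq_of_ne hi, add_zero, if_true,
        if_neg hi, one_mul]
      rw [show lam i.castSucc - (kap l + 1) = lam i.castSucc - kap l - 1 by ring, g1,
        show kap i - (kap l + 1) = kap i - kap l - 1 by ring, g3]
      field_simp
    · simp [hi, hlj]

/-- The rational function in `q` and `t` that expresses both `S_m` and `T_j`. -/
def ratioX (q t : ℝ) (lam : Fin (k + 1) → ℤ) (kap : Fin k → ℤ) (c : ℤ) (m : Fin (k + 1)) : ℝ :=
  ∏ i : Fin k, if i.castSucc < m then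
    ((1 - q ^ (lam i.castSucc - c - 1) * t ^ ((m : ℕ) - 1 - i + 2)) *
      (1 - q ^ (kap i - c) * t ^ ((m : ℕ) - 1 - i))) /
    ((1 - q ^ (lam i.castSucc - c) * t ^ ((m : ℕ) - 1 - i + 1)) *
      (1 - q ^ (kap i - c - 1) * t ^ ((m : ℕ) - 1 - i + 1)))
  else
    ((1 - q ^ (c - lam i.succ + 1) * t ^ ((i : ℕ) - m)) *
      (1 - q ^ (c - kap i) * t ^ ((i : ℕ) - m + 1))) /
    ((1 - q ^ (c - lam i.succ) * t ^ ((i : ℕ) - m + 1)) *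
      (1 - q ^ (c - kap i + 1) * t ^ ((i : ℕ) - m)))

/-- The position of the particle `m` itself enters only through `c`. This allows the comparison of
`T` after a forced move with `S` before it. -/
theorem ratioX_congr {lam lam' : Fin (k + 1) → ℤ} {kap : Fin k → ℤ} {c : ℤ} {m : Fin (k + 1)}
    (h : ∀ i, i ≠ m → lam i = lam' i) : ratioX q t lam kap c m = ratioX q t lam' kap c m := by
  refine prod_congr rfl fun i _ => ?_
  split_ifs with hi
  · rw [h _ hi.ne]
  · rw [h i.succ (by
      intro h'
      rw [← h'] at hi
      exact hi Fin.castSucc_lt_succ)]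

theorem psiPrime_upper_eq_prod (lam : Fin (k + 1) → ℤ) (m : Fin (k + 1)) :
    psiPrime q t lam m = ∏ i : Fin k, if i.castSucc < m then
      ((1 - q ^ (lam i.castSucc - lam m) * t ^ ((m : ℕ) - 1 - i)) *
        (1 - q ^ (lam i.castSucc - lam m - 1) * t ^ ((m : ℕ) - 1 - i + 2))) /
      ((1 - q ^ (lam i.castSucc - lam m) * t ^ ((m : ℕ) - 1 - i + 1)) *
        (1 - q ^ (lam i.castSucc - lam m - 1) * t ^ ((m : ℕ) - 1 - i + 1))) else 1 := by
  unfold psiPrime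
  rw [← filter_gt_eq_Iio, prod_filter, Fin.prod_univ_castSucc,
    if_neg (not_lt.2 (Fin.le_last m)), mul_one]
  refine prod_congr rfl fun i _ => ?_
  refine ite_congr rfl (fun hi => ?_) fun _ => rfl
  have hi' : (i : ℕ) < m := hi
  rw [Fin.val_castSucc, show (m : ℕ) - i - 1 = m - 1 - i by omega,
    show (m : ℕ) - i = m - 1 - i + 1 by omega, ← sub_sub]

theorem psiPrime_lower_eq_prod (kap : Fin k → ℤ) (j : Fin k) :
    psiPrime q t kap j = ∏ i : Fin k, if i.castSucc < j.castSucc then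
      ((1 - q ^ (kap i - kap j) * t ^ ((j : ℕ) - 1 - i)) *
        (1 - q ^ (kap i - kap j - 1) * t ^ ((j : ℕ) - 1 - i + 2))) /
      ((1 - q ^ (kap i - kap j) * t ^ ((j : ℕ) - 1 - i + 1)) *
        (1 - q ^ (kap i - kap j - 1) * t ^ ((j : ℕ) - 1 - i + 1))) else 1 := by
  unfold psiPrime
  rw [← filter_gt_eq_Iio, prod_filter]
  refine prod_congr rfl fun i _ => ?_
  refine ite_congr rfl (fun hi => ?_) fun _ => rfl
  have hi' : (i : ℕ) < j := hi
  rw [show (j : ℕ) - i - 1 = j - 1 - i by omega,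
    show (j : ℕ) - i = j - 1 - i + 1 by omega, ← sub_sub]

theorem Admissible.psiPrime_pos (hqt : Admissible q t) {kap : Fin k → ℤ} {j : Fin k}
    (h : ∀ i < j, kap j < kap i) : 0 < psiPrime q t kap j := by
  refine prod_pos fun i hi => ?_
  have hi := mem_Iio.1 hi
  have hi' : (i : ℕ) < j := hi
  have := h i hi
  exact div_pos
    (mul_pos (hqt.one_sub_pos (by omega) (by omega)) (hqt.one_sub_pos (by omega) (by omega)))
    (mul_pos (hqt.one_sub_pos (by omega) (by omega)) (hqt.one_sub_pos (by omega) (by omega)))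

theorem Admissible.coefS_of_free (hqt : Admissible q t) {lam : Fin (k + 1) → ℤ} {nu : Fin k → ℤ}
    (h : Interlaces nu lam) {m : Fin (k + 1)} (hm : Free nu lam m) :
    coefS q t nu lam m = ratioX q t lam nu (lam m) m := by
  unfold coefS
  rw [hqt.psi_add_single h hm, mul_div_cancel_left₀ _ (hqt.psi_pos h).ne', psiPrime_upper_eq_prod,
    ← prod_mul_distrib, ← prod_mul_distrib]
  refine prod_congr rfl fun i _ => ?_
  by_cases hi : i.castSucc < m
  · rw [if_neg (not_le.2 hi), if_pos hi, if_pos hi, if_pos hi, one_mul]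
    have h1 := h.lt_of_free hm hi
    have h2 := h.upper_lt_of_free hm hi
    unfold macE
    rw [sub_add_cancel, sub_add_cancel]
    have e1 := (hqt.one_sub_pos (n := lam i.castSucc - lam m) (d := m - 1 - i)
      (by omega) (by omega)).ne'
    have e2 := (hqt.one_sub_pos (n := lam i.castSucc - lam m) (d := m - 1 - i + 1)
      (by omega) (by omega)).ne'
    have e3 := (hqt.one_sub_pos (n := lam i.castSucc - lam m - 1) (d := m - 1 - i + 1)
      (by omega) (by omega)).ne'
    have e4 := (hqt.one_sub_pos (n := nu i - lam m - 1) (d := m - 1 - i + 1)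
      (by omega) (by omega)).ne'
    generalize 1 - q ^ (lam i.castSucc - lam m) * t ^ ((m : ℕ) - 1 - i) = u1 at *
    generalize 1 - q ^ (lam i.castSucc - lam m) * t ^ ((m : ℕ) - 1 - i + 1) = u2 at *
    generalize 1 - q ^ (lam i.castSucc - lam m - 1) * t ^ ((m : ℕ) - 1 - i + 1) = u3 at *
    generalize 1 - q ^ (nu i - lam m - 1) * t ^ ((m : ℕ) - 1 - i + 1) = u4 at *
    field_simp
  · rw [if_pos (not_lt.1 hi), if_neg hi, if_neg hi, if_neg hi, mul_one, mul_one]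
    unfold macE
    rw [div_div_div_eq]

/-- `T_j` is the same rational function evaluated at the position of the lower particle `j` before
its move. The function omits the upper particle `j`, whose factor is restored by the denominator of
the correction; the numerator of the correction cancels the factor of the lower particle `j` with
itself. -/
theorem Admissible.coefT_of_free (hqt : Admissible q t) {lam : Fin (k + 1) → ℤ} {nu : Fin k → ℤ}
    (h : Interlaces nu lam) {j : Fin k} (hj : Free nu lam j.succ) :
    coefT q t nu lam j = ratioX q t lam (nu - Pi.single j 1) (nu j - 1) j.castSucc *
      (macE q t 0 0 / macE q t (lam j.castSucc - nu j) 0) := by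
  unfold coefT
  have h' := (interlaces_sub_single_iff h j).2 hj
  obtain ⟨kap, rfl⟩ : ∃ kap : Fin k → ℤ, nu = kap + Pi.single j 1 := ⟨nu - Pi.single j 1, by simp⟩
  rw [add_sub_cancel_right] at *
  rw [hqt.psi_lower_add_single h' h, ← prod_mul_distrib, div_mul_eq_div_div,
    div_self (hqt.psi_pos h').ne', psiPrime_lower_eq_prod, one_div, ← prod_inv_distrib,
    ← prod_mul_distrib]
  have hprod : macE q t 0 0 / macE q t (lam j.castSucc - (kap + Pi.single j 1 : Fin k → ℤ) j) 0 =
      ∏ i : Fin k, if i = j then macE q t 0 0 / macE q t (lam j.castSucc - kap j - 1) 0 else 1 := by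
    rw [prod_ite_eq', if_pos (mem_univ _)]
    simp [sub_sub]
  rw [hprod]
  unfold ratioX
  rw [← prod_mul_distrib]
  simp only [Pi.add_apply, Pi.single_eq_same, add_sub_cancel_right]
  refine prod_congr rfl fun i _ => ?_
  simp only [Fin.castSucc_lt_castSucc_iff, Fin.castSucc_le_castSucc_iff, Fin.castSucc_lt_succ_iff,
    Fin.val_castSucc]
  have hjj := (h j).2
  simp only [Pi.add_apply, Pi.single_eq_same] at hjj
  rcases lt_trichotomy i j with hij | rfl | hij
  · rw [if_neg (not_le.2 hij), if_pos hij.le, if_pos hij, if_pos hij, if_neg hij.ne, if_neg hij.ne]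
    have h1 := h.le_of_le hij.le
    have h2 := h.antitone_lower hij.le
    simp only [Pi.add_apply, Pi.single_eq_same, Pi.single_eq_of_ne hij.ne, add_zero] at h1 h2
    have hd : (j : ℕ) - i = j - 1 - i + 1 := by
      have : (i : ℕ) < j := hij
      omega
    unfold macE
    rw [hd, sub_add_cancel, sub_add_cancel]
    have e1 := (hqt.one_sub_pos (n := lam i.castSucc - kap j) (d := j - 1 - i + 1)
      (by omega) (by omega)).ne'
    have e2 := (hqt.one_sub_pos (n := lam i.castSucc - kap j - 1) (d := j - 1 - i + 1 + 1)
      (by omega) (by omega)).ne'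
    have e3 := (hqt.one_sub_pos (n := kap i - kap j) (d := j - 1 - i + 1)
      (by omega) (by omega)).ne'
    have e4 := (hqt.one_sub_pos (n := kap i - kap j - 1) (d := j - 1 - i + 1 + 1)
      (by omega) (by omega)).ne'
    have e5 := (hqt.one_sub_pos (n := kap i - kap j - 1) (d := j - 1 - i + 1)
      (by omega) (by omega)).ne'
    have e6 : j - 1 - (i : ℕ) + 2 = j - 1 - i + 1 + 1 := rfl
    rw [e6]
    generalize 1 - q ^ (lam i.castSucc - kap j) * t ^ ((j : ℕ) - 1 - i + 1) = u1 at *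
    generalize 1 - q ^ (lam i.castSucc - kap j - 1) * t ^ ((j : ℕ) - 1 - i + 1 + 1) = u2 at *
    generalize 1 - q ^ (kap i - kap j) * t ^ ((j : ℕ) - 1 - i + 1) = u3 at *
    generalize 1 - q ^ (kap i - kap j - 1) * t ^ ((j : ℕ) - 1 - i + 1 + 1) = u4 at *
    generalize 1 - q ^ (kap i - kap j - 1) * t ^ ((j : ℕ) - 1 - i + 1) = u5 at *
    field_simp
  · rw [if_pos le_rfl, if_pos le_rfl, if_neg (lt_irrefl _), if_neg (lt_irrefl _), if_pos rfl,
      if_pos rfl, if_pos rfl]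
    have h1 := (h' i).1
    simp only [Nat.sub_self, sub_self]
    have e1 := (hqt.macE_pos (n := 0) le_rfl 0).ne'
    have e2 := (hqt.macE_pos (n := kap i - lam i.succ) (by omega) 0).ne'
    have e3 := (hqt.macE_pos (n := lam i.castSucc - kap i - 1) (by omega) 0).ne'
    rw [mul_div_mul_comm, ← macE, ← inv_div (1 - q ^ ((0 : ℤ) + 1) * t ^ 0), ← macE]
    field_simp
  · rw [if_pos hij.le, if_neg (not_le.2 hij), if_neg (not_lt.2 hij.le), if_neg (not_lt.2 hij.le),
      if_neg hij.ne']
    simp only [if_neg hij.ne', mul_one]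
    unfold macE
    rw [inv_div, div_div_div_eq]

theorem coefS_of_not_free {lam : Fin (k + 1) → ℤ} {nu : Fin k → ℤ}
    (h : Interlaces nu lam) {m : Fin (k + 1)} (hm : ¬ Free nu lam m) : coefS q t nu lam m = 0 := by
  unfold coefS
  rw [psi_of_not_interlaces ((interlaces_add_single_iff h m).not.2 hm), zero_div, zero_mul]

theorem coefT_of_not_free {lam : Fin (k + 1) → ℤ} {nu : Fin k → ℤ}
    (h : Interlaces nu lam) {j : Fin k} (hj : ¬ Free nu lam j.succ) : coefT q t nu lam j = 0 := by
  unfold coefT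
  rw [psi_of_not_interlaces ((interlaces_sub_single_iff h j).not.2 hj), zero_div, zero_mul]

theorem Admissible.coefT_pos (hqt : Admissible q t) {lam : Fin (k + 1) → ℤ} {nu : Fin k → ℤ}
    (h : Interlaces nu lam) {j : Fin k} (hj : Free nu lam j.succ) : 0 < coefT q t nu lam j := by
  refine mul_pos (div_pos (hqt.psi_pos ((interlaces_sub_single_iff h j).2 hj)) (hqt.psi_pos h))
    (hqt.psiPrime_pos fun i hi => ?_)
  have := h.antitone_lower hi.le
  simp only [Pi.sub_apply, Pi.single_eq_same, Pi.single_eq_of_ne hi.ne]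
  omega

/-- The rates of the move `lam → lam + e_m` that is forced by `kap → kap + e_m`. -/
theorem Admissible.psi_mul_psiPrime_of_eq (hqt : Admissible q t) {lam : Fin (k + 1) → ℤ}
    {kap : Fin k → ℤ} (h : Interlaces kap lam) {m : Fin k} (hm : kap m = lam m.castSucc)
    (h' : Interlaces (kap + Pi.single m 1) (lam + Pi.single m.castSucc 1)) :
    psi q t lam kap * psiPrime q t kap m =
      psiPrime q t lam m.castSucc *
        psi q t (lam + Pi.single m.castSucc 1) (kap + Pi.single m 1) := by
  have hfree : Free kap lam m.castSucc := by
    intro i hi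
    have h1 := (h' i).1
    have h2 : i ≠ m := by
      rintro rfl
      exact absurd hi Fin.castSucc_lt_succ.ne'
    rw [hi] at h1
    simp only [Pi.add_apply, Pi.single_eq_same, Pi.single_eq_of_ne h2] at h1
    omega
  have h1 : Interlaces kap (lam + Pi.single m.castSucc 1) :=
    (interlaces_add_single_iff h _).2 hfree
  have hfree' : Free (kap + Pi.single m 1) (lam + Pi.single m.castSucc 1) m.succ :=
    (interlaces_sub_single_iff h' m).1 (by rwa [add_sub_cancel_right])
  have e1 := hqt.coefT_of_free h' hfree'
  have e2 := hqt.coefS_of_free h hfree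
  -- Since `kap m = lam m`, the correction factor in `T` after the move is `1`, and the remaining
  -- function is that of `S` before the move.
  have e3 : ratioX q t (lam + Pi.single m.castSucc 1) kap (kap m) m.castSucc
      = ratioX q t lam kap (lam m.castSucc) m.castSucc := by
    rw [hm]
    exact ratioX_congr fun i hi => by simp [hi]
  have e4 := (hqt.macE_pos (n := 0) le_rfl 0).ne'
  simp only [add_sub_cancel_right, Pi.add_apply, Pi.single_eq_same, hm, sub_self,
    div_self e4, mul_one] at e1
  rw [← hm, e3, ← e2] at e1
  unfold coefT coefS at e1
  rw [add_sub_cancel_right] at e1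
  have p1 := (hqt.psi_pos h).ne'
  have p2 := (hqt.psi_pos h1).ne'
  have p3 := (hqt.psi_pos h').ne'
  field_simp at e1
  linear_combination e1

section Identity

open Filter Topology

/-! ### A partial fractions identity -/

theorem prod_univ_erase_eq_ite {ι : Type*} [Fintype ι] [DecidableEq ι] (i : ι) (f : ι → ℝ) :
    ∏ j ∈ univ.erase i, f j = ∏ j, if j = i then 1 else f j := by
  rw [← mul_prod_erase univ _ (mem_univ i), if_pos rfl, one_mul]
  exact prod_congr rfl fun j hj => (if_neg (ne_of_mem_erase hj)).symm

/-- The residues of `z⁻¹ ∏ (z - s x_i) / (z - x_i) ∏ (z - s⁻¹ w_j) / (z - w_j)` sum to one. -/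
theorem sum_residues_eq_one {s : ℝ} (hs : s ≠ 0) {x : Fin (k + 1) → ℝ} {w : Fin k → ℝ}
    (hx0 : ∀ i, x i ≠ 0) (hw0 : ∀ j, w j ≠ 0) (hx : Function.Injective x)
    (hw : Function.Injective w) (hxw : ∀ i j, x i ≠ w j) :
    (1 - s) * (∑ m, (∏ i : Fin k, (x m - s * x (m.succAbove i)) / (x m - x (m.succAbove i))) *
        ∏ j, (x m - s⁻¹ * w j) / (x m - w j)) +
      (1 - s⁻¹) * (∑ j, (∏ i, (w j - s * x i) / (w j - x i)) *
        ∏ l ∈ univ.erase j, (w j - s⁻¹ * w l) / (w j - w l)) + s = 1 := by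
  classical
  -- The nodes are the poles: `none` is the pole at `0`. The numerator `P` is monic of degree `2k +
  -- 1` and there are `2k + 2` distinct nodes, so the Lagrange formula for the leading coefficient
  -- is the residue theorem.
  let v : Option (Fin (k + 1) ⊕ Fin k) → ℝ := fun o => o.elim 0 (Sum.elim x w)
  have hv : Set.InjOn v (univ : Finset (Option (Fin (k + 1) ⊕ Fin k))) := by
    rintro (_ | i | i) _ (_ | j | j) _ h
    · rfl
    · exact absurd h.symm (hx0 j)
    · exact absurd h.symm (hw0 j)
    · exact absurd h (hx0 i)
    · rw [hx h]
    · exact absurd h (hxw i j)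
    · exact absurd h (hw0 i)
    · exact absurd h.symm (hxw j i)
    · rw [hw h]
  let P : Polynomial ℝ := (∏ i, (Polynomial.X - Polynomial.C (s * x i))) *
    ∏ j, (Polynomial.X - Polynomial.C (s⁻¹ * w j))
  have hm1 : (∏ i, (Polynomial.X - Polynomial.C (s * x i))).Monic :=
    Polynomial.monic_prod_of_monic _ _ fun i _ => Polynomial.monic_X_sub_C _
  have hm2 : (∏ j, (Polynomial.X - Polynomial.C (s⁻¹ * w j))).Monic :=
    Polynomial.monic_prod_of_monic _ _ fun i _ => Polynomial.monic_X_sub_C _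
  have hP : P.Monic := hm1.mul hm2
  have hdeg : P.natDegree = k + 1 + k := by
    rw [hm1.natDegree_mul hm2, Polynomial.natDegree_prod_of_monic _ _ fun i _ =>
      Polynomial.monic_X_sub_C _, Polynomial.natDegree_prod_of_monic _ _ fun i _ =>
      Polynomial.monic_X_sub_C _]
    simp only [Polynomial.natDegree_X_sub_C, sum_const, card_univ, Fintype.card_fin, smul_eq_mul,
      mul_one]
  have hcard : ((#(univ : Finset (Option (Fin (k + 1) ⊕ Fin k))) : ℕ) : WithBot ℕ)
      = P.degree + 1 := by
    rw [Polynomial.degree_eq_natDegree hP.ne_zero, hdeg]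
    simp
  have key := Lagrange.leadingCoeff_eq_sum hv hcard
  have heval : ∀ z, P.eval z = (∏ i, (z - s * x i)) * ∏ j, (z - s⁻¹ * w j) := fun z => by
    simp [P, Polynomial.eval_prod]
  rw [hP.leadingCoeff, Fintype.sum_option, Fintype.sum_sum_type] at key
  simp only [heval, prod_univ_erase_eq_ite, Fintype.prod_option, Fintype.prod_sum_type, v,
    Option.elim, Sum.elim_inl, Sum.elim_inr, reduceCtorEq, if_true, if_false, one_mul,
    Option.some.injEq, Sum.inl.injEq, Sum.inr.injEq, sub_zero, zero_sub] at key
  refine Eq.trans ?_ key.symm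
  rw [add_comm, mul_sum, mul_sum]
  -- The residue at `0` is `s^(k+1) · s^(-k)`, as there is one more `x` than `w`.
  have h0 : (∏ i, -(s * x i)) * (∏ j, -(s⁻¹ * w j)) / ((∏ i, -x i) * ∏ j, -w j) = s := by
    simp only [← mul_neg]
    rw [prod_mul_distrib, prod_mul_distrib, prod_const, prod_const]
    have p1 : (∏ i, -x i) ≠ 0 := prod_ne_zero_iff.2 fun i _ => neg_ne_zero.2 (hx0 i)
    have p2 : (∏ i, -w i) ≠ 0 := prod_ne_zero_iff.2 fun i _ => neg_ne_zero.2 (hw0 i)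
    simp only [card_univ, Fintype.card_fin]
    rw [inv_pow, pow_succ]
    field_simp
  rw [h0]
  congr 1
  congr 1
  · refine sum_congr rfl fun m _ => ?_
    have h1 : ∀ i : Fin k, m.succAbove i ≠ m := fun i => Fin.succAbove_ne m i
    rw [Fin.prod_univ_succAbove (fun i => x m - s * x i) m,
      Fin.prod_univ_succAbove (fun i => if i = m then 1 else x m - x i) m]
    simp only [h1, if_true, if_false, one_mul]
    rw [prod_div_distrib, prod_div_distrib]
    have p1 : ∏ i, (x m - x (m.succAbove i)) ≠ 0 :=
      prod_ne_zero_iff.2 fun i _ => sub_ne_zero.2 fun h => h1 i (hx h).symm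
    have p2 : ∏ j, (x m - w j) ≠ 0 :=
      prod_ne_zero_iff.2 fun i _ => sub_ne_zero.2 (hxw m i)
    have p3 := hx0 m
    field_simp
  · refine sum_congr rfl fun j _ => ?_
    rw [← prod_univ_erase_eq_ite, prod_div_distrib, prod_div_distrib,
      ← mul_prod_erase univ (fun l => w j - s⁻¹ * w l) (mem_univ j)]
    have p1 : ∏ l ∈ univ.erase j, (w j - w l) ≠ 0 :=
      prod_ne_zero_iff.2 fun i hi => sub_ne_zero.2 fun h => ne_of_mem_erase hi (hw h).symm
    have p2 : ∏ i, (w j - x i) ≠ 0 :=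
      prod_ne_zero_iff.2 fun i _ => sub_ne_zero.2 (hxw i j).symm
    have p3 := hw0 j
    field_simp

/-! ### The identity `∑ S = 1 + ∑ T` for generic parameters -/

theorem one_sub_div_one_sub_eq {a b u v z : ℝ} (hz : z ≠ 0) (ha : a * z = u) (hb : b * z = v) :
    (1 - a) / (1 - b) = (z - u) / (z - v) := by
  rw [← ha, ← hb, ← mul_div_mul_right (1 - a) (1 - b) hz]
  ring

/-- Multiplying numerators and denominators by suitable monomials makes each factor a difference of
points. For `i ≥ m` this leaves prefactors `q / t` and `t / q`, one from the upper and one from the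
lower particle, which cancel. -/
theorem ratioX_eq_prod (hq : 0 < q) (ht : 0 < t) (lam : Fin (k + 1) → ℤ) (kap : Fin k → ℤ) (c : ℤ)
    (m : Fin (k + 1)) {z : ℝ} (hz : z = q ^ c * (t ^ (m : ℕ))⁻¹) :
    ratioX q t lam kap c m = (∏ i : Fin k,
      (z - t / q * (q ^ lam (m.succAbove i) * (t ^ (m.succAbove i : ℕ))⁻¹)) /
        (z - q ^ lam (m.succAbove i) * (t ^ (m.succAbove i : ℕ))⁻¹)) *
      ∏ i : Fin k, (z - (t / q)⁻¹ * (q ^ (kap i - 1) * (t ^ (i : ℕ))⁻¹)) /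
        (z - q ^ (kap i - 1) * (t ^ (i : ℕ))⁻¹) := by
  have hz0 : z ≠ 0 := by rw [hz]; positivity
  unfold ratioX
  rw [← prod_mul_distrib]
  refine prod_congr rfl fun i _ => ?_
  split_ifs with hi
  · have hi' : (i : ℕ) < m := hi
    obtain ⟨d, hd⟩ : ∃ d, (m : ℕ) = i + d + 1 := ⟨m - i - 1, by omega⟩
    have hd' : (m : ℕ) - 1 - i = d := by omega
    rw [Fin.succAbove_of_castSucc_lt _ _ hi, mul_div_mul_comm]
    rw [hd'] at *
    rw [hd] at hz
    simp only [Fin.val_castSucc]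
    congr 1
    · apply one_sub_div_one_sub_eq hz0
      · rw [hz, zpow_sub_one₀ hq.ne', zpow_sub₀ hq.ne']
        field_simp
        ring
      · rw [hz, zpow_sub₀ hq.ne']
        field_simp
        ring
    · apply one_sub_div_one_sub_eq hz0
      · rw [hz, zpow_sub₀ hq.ne', zpow_sub_one₀ hq.ne']
        field_simp
        ring
      · rw [hz, zpow_sub_one₀ hq.ne', zpow_sub₀ hq.ne', zpow_sub_one₀ hq.ne']
        field_simp
        ring
  · have hi' : (m : ℕ) ≤ i := not_lt.1 hi
    obtain ⟨d, hd⟩ : ∃ d, (i : ℕ) = m + d := ⟨i - m, by omega⟩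
    have hd' : (i : ℕ) - m = d := by omega
    rw [Fin.succAbove_of_le_castSucc _ _ (not_lt.1 hi), mul_div_mul_comm]
    have h1 : (1 - q ^ (c - lam i.succ + 1) * t ^ ((i : ℕ) - m)) /
        (1 - q ^ (c - lam i.succ) * t ^ ((i : ℕ) - m + 1)) = q / t *
        ((z - t / q * (q ^ lam i.succ * (t ^ (i.succ : ℕ))⁻¹)) /
          (z - q ^ lam i.succ * (t ^ (i.succ : ℕ))⁻¹)) := by
      rw [mul_div_assoc', hd', Fin.val_succ, hd]
      rw [← mul_div_mul_left _ _ (neg_ne_zero.2 (show q ^ lam i.succ * (t ^ ((m : ℕ) + d + 1))⁻¹ ≠ 0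
        by positivity))]
      congr 1
      · rw [hz, zpow_add_one₀ hq.ne', zpow_sub₀ hq.ne']
        field_simp
        ring
      · rw [hz, zpow_sub₀ hq.ne']
        field_simp
        ring
    have h2 : (1 - q ^ (c - kap i) * t ^ ((i : ℕ) - m + 1)) /
        (1 - q ^ (c - kap i + 1) * t ^ ((i : ℕ) - m)) = t / q *
        ((z - (t / q)⁻¹ * (q ^ (kap i - 1) * (t ^ (i : ℕ))⁻¹)) /
          (z - q ^ (kap i - 1) * (t ^ (i : ℕ))⁻¹)) := by
      rw [mul_div_assoc', hd', hd]
      rw [← mul_div_mul_left _ _ (neg_ne_zero.2 (show q ^ (kap i - 1) * (t ^ ((m : ℕ) + d))⁻¹ ≠ 0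
        by positivity))]
      congr 1
      · rw [hz, zpow_sub_one₀ hq.ne', zpow_sub₀ hq.ne']
        field_simp
        ring
      · rw [hz, zpow_sub_one₀ hq.ne', zpow_add_one₀ hq.ne', zpow_sub₀ hq.ne']
        field_simp
        ring
    rw [h1, h2]
    field_simp

theorem zpow_mul_inv_pow_ne {q t : ℝ} (hq : 0 < q) (hq1 : q < 1) (ht : 0 < t) (ht1 : t < 1)
    {n n' : ℤ} {i j : ℕ} (hn : n' ≤ n) (hij : i < j) :
    q ^ n * (t ^ i)⁻¹ ≠ q ^ n' * (t ^ j)⁻¹ := by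
  intro h
  have h1 : q ^ (n - n') * t ^ (j - i) = 1 := by
    rw [zpow_sub₀ hq.ne', pow_sub₀ _ ht.ne' hij.le]
    field_simp at h ⊢
    linarith
  exact (zpow_mul_pow_lt_one hq.le hq1 ht.le ht1 (by omega) (by omega)).ne h1

/-- The sum over the free particles of the explicit expressions for `S_m`. -/
def sumS (lam : Fin (k + 1) → ℤ) (nu : Fin k → ℤ) (p : ℝ × ℝ) : ℝ :=
  open Classical in
  ∑ m, if Free nu lam m then ratioX p.1 p.2 lam nu (lam m) m else 0

/-- The sum over the particles with free left neighbours of the explicit expressions for `T_j`. -/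
def sumT (lam : Fin (k + 1) → ℤ) (nu : Fin k → ℤ) (p : ℝ × ℝ) : ℝ :=
  open Classical in
  ∑ j : Fin k, if Free nu lam j.succ then
    ratioX p.1 p.2 lam (nu - Pi.single j 1) (nu j - 1) j.castSucc *
      (macE p.1 p.2 0 0 / macE p.1 p.2 (lam j.castSucc - nu j) 0) else 0

theorem eq_of_not_free {nu : Fin k → ℤ} {lam : Fin (k + 1) → ℤ} (h : Interlaces nu lam)
    {m : Fin (k + 1)} (hm : ¬ Free nu lam m) : ∃ j : Fin k, j.succ = m ∧ nu j = lam m := by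
  unfold Free at hm
  push Not at hm
  obtain ⟨j, rfl, hj⟩ := hm
  exact ⟨j, rfl, le_antisymm hj (h j).1⟩

/-- The condition `q ≠ t ^ d` rules out `s = 1` (at `d = 1`) and coincidences of the poles `x_i` and
`w_j` when `lam_i = nu_j` with `i > j`. If `j + 1` is not free, then `x_{j+1} = s⁻¹ w_j`, and this
one relation kills the residues at both `x_{j+1}` and `w_j`; hence the sums over free indices equal
the full residue sums. -/
theorem sumS_eq_of_generic (hq : 0 < q) (hq1 : q < 1) (ht : 0 < t) (ht1 : t < 1)
    (hqt : ∀ d : ℕ, q ≠ t ^ d) {lam : Fin (k + 1) → ℤ} {nu : Fin k → ℤ} (h : Interlaces nu lam) :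
    sumS lam nu (q, t) = 1 + sumT lam nu (q, t) := by
  classical
  set s := t / q with hs
  have hs0 : s ≠ 0 := by positivity
  have hs1 : 1 - s ≠ 0 := by
    intro h0
    have : s = 1 := by linarith
    rw [hs, div_eq_one_iff_eq hq.ne'] at this
    exact hqt 1 (by rw [pow_one, this])
  let x : Fin (k + 1) → ℝ := fun i => q ^ lam i * (t ^ (i : ℕ))⁻¹
  let w : Fin k → ℝ := fun j => q ^ (nu j - 1) * (t ^ (j : ℕ))⁻¹
  have hx0 : ∀ i, x i ≠ 0 := fun i => by positivity
  have hw0 : ∀ i, w i ≠ 0 := fun i => by positivity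
  have hx : Function.Injective x := by
    refine Function.Injective.of_lt_imp_ne fun i j hij => ?_
    exact zpow_mul_inv_pow_ne hq hq1 ht ht1 (h.antitone_upper hij.le) hij
  have hw : Function.Injective w := by
    refine Function.Injective.of_lt_imp_ne fun i j hij => ?_
    have := h.antitone_lower hij.le
    exact zpow_mul_inv_pow_ne hq hq1 ht ht1 (by omega) hij
  have hxw : ∀ i j, x i ≠ w j := by
    intro i j
    by_cases hij : i ≤ j.castSucc
    · intro he
      have h1 : nu j ≤ lam i := (h j).2.trans (h.antitone_upper hij)
      have h2 : q ^ (lam i - nu j + 1) * t ^ ((j : ℕ) - i) = 1 := by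
        simp only [x, w] at he
        have : (i : ℕ) ≤ j := hij
        rw [zpow_sub_one₀ hq.ne'] at he
        rw [zpow_add_one₀ hq.ne', zpow_sub₀ hq.ne', pow_sub₀ _ ht.ne' this]
        field_simp at he ⊢
        linarith
      exact (zpow_mul_pow_lt_one hq.le hq1 ht.le ht1 (by omega) (by omega)).ne h2
    · have hij' : j.castSucc < i := not_le.1 hij
      have h1 : lam i ≤ nu j := (h.antitone_upper (Fin.castSucc_lt_iff_succ_le.1 hij')).trans (h j).1
      have h0 : (j : ℕ) < i := hij'
      rcases h1.eq_or_lt with h1 | h1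
      · intro he
        refine hqt (i - j) ?_
        simp only [x, w] at he
        rw [h1, zpow_sub_one₀ hq.ne'] at he
        rw [pow_sub₀ _ ht.ne' h0.le]
        field_simp at he ⊢
        linarith
      · exact (zpow_mul_inv_pow_ne hq hq1 ht ht1 (by omega) h0).symm
  have key := sum_residues_eq_one hs0 hx0 hw0 hx hw hxw
  have hcoinc : ∀ j : Fin k, nu j = lam j.succ → x j.succ - s⁻¹ * w j = 0 := by
    intro j hj
    simp only [x, w, hs, hj]
    rw [zpow_sub_one₀ hq.ne', Fin.val_succ]
    field_simp
    ring
  have hS : sumS lam nu (q, t) = ∑ m, (∏ i : Fin k,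
      (x m - s * x (m.succAbove i)) / (x m - x (m.succAbove i))) *
        ∏ j, (x m - s⁻¹ * w j) / (x m - w j) := by
    refine sum_congr rfl fun m _ => ?_
    split_ifs with hm
    · exact ratioX_eq_prod hq ht lam nu (lam m) m rfl
    · obtain ⟨j, rfl, hj⟩ := eq_of_not_free h hm
      rw [prod_eq_zero (mem_univ j) (f := fun l => (x j.succ - s⁻¹ * w l) / (x j.succ - w l)),
        mul_zero]
      rw [hcoinc j hj, zero_div]
  have hT : sumT lam nu (q, t) = s⁻¹ * ∑ j, (∏ i, (w j - s * x i) / (w j - x i)) *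
        ∏ l ∈ univ.erase j, (w j - s⁻¹ * w l) / (w j - w l) := by
    rw [mul_sum]
    refine sum_congr rfl fun j _ => ?_
    split_ifs with hj
    · have e2 : (∏ i : Fin k,
          (w j - (t / q)⁻¹ * (q ^ ((nu - Pi.single j 1 : Fin k → ℤ) i - 1) * (t ^ (i : ℕ))⁻¹)) /
          (w j - q ^ ((nu - Pi.single j 1 : Fin k → ℤ) i - 1) * (t ^ (i : ℕ))⁻¹)) =
          (w j - s⁻¹ * (w j / q)) / (w j - w j / q) *
            ∏ l ∈ univ.erase j, (w j - s⁻¹ * w l) / (w j - w l) := by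
        rw [← mul_prod_erase univ _ (mem_univ j)]
        congr 1
        · simp only [Pi.sub_apply, Pi.single_eq_same, w]
          rw [show q ^ (nu j - 1 - 1) * (t ^ (j : ℕ))⁻¹ = q ^ (nu j - 1) * (t ^ (j : ℕ))⁻¹ / q by
            rw [zpow_sub_one₀ hq.ne' (nu j - 1)]; ring]
        · refine prod_congr rfl fun l hl => ?_
          have hl := ne_of_mem_erase hl
          simp only [Pi.sub_apply, Pi.single_eq_of_ne hl, sub_zero]
          rfl
      have e1 : ratioX q t lam (nu - Pi.single j 1) (nu j - 1) j.castSucc = (∏ i : Fin k,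
          (w j - s * x (j.castSucc.succAbove i)) / (w j - x (j.castSucc.succAbove i))) *
          ((w j - s⁻¹ * (w j / q)) / (w j - w j / q) *
            ∏ l ∈ univ.erase j, (w j - s⁻¹ * w l) / (w j - w l)) := by
        rw [← e2]
        exact ratioX_eq_prod hq ht lam (nu - Pi.single j 1) (nu j - 1) j.castSucc (z := w j) rfl
      have e3 : macE q t (lam j.castSucc - nu j) 0 =
          ((w j - s * x j.castSucc) / (w j - x j.castSucc))⁻¹ := by
        rw [inv_div]
        apply one_sub_div_one_sub_eq (hw0 j)
        · simp only [x, w, Fin.val_castSucc]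
          rw [zpow_add_one₀ hq.ne', zpow_sub₀ hq.ne', zpow_sub_one₀ hq.ne']
          field_simp
        · simp only [x, w, Fin.val_castSucc]
          rw [hs, zpow_sub₀ hq.ne', zpow_sub_one₀ hq.ne']
          field_simp
          ring
      -- The self-interaction of the lower particle `j`, at `w j / q` after the shift, combines with
      -- the correction factor to the constant `s⁻¹`.
      have e4 : (w j - s⁻¹ * (w j / q)) / (w j - w j / q) * macE q t 0 0 = s⁻¹ := by
        have h1 := hw0 j
        have h2 : 1 - q ≠ 0 := by linarith
        have h3 : 1 - t ≠ 0 := by linarith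
        have h4 : q - 1 ≠ 0 := by linarith
        unfold macE
        rw [hs]
        simp only [zero_add, zpow_one, pow_zero, mul_one, zpow_zero, pow_one, one_mul]
        have h5 : w j - w j / q = w j * (q - 1) / q := by field_simp
        have h6 : w j - (t / q)⁻¹ * (w j / q) = w j * (t - 1) / t := by field_simp
        rw [h5, h6]
        field_simp
        ring
      change ratioX q t lam (nu - Pi.single j 1) (nu j - 1) j.castSucc *
        (macE q t 0 0 / macE q t (lam j.castSucc - nu j) 0) = _
      rw [e1, e3, div_inv_eq_mul, Fin.prod_univ_succAbove _ j.castSucc]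
      generalize (∏ i : Fin k,
        (w j - s * x (j.castSucc.succAbove i)) / (w j - x (j.castSucc.succAbove i))) = A
      generalize (∏ l ∈ univ.erase j, (w j - s⁻¹ * w l) / (w j - w l)) = C
      generalize (w j - s * x j.castSucc) / (w j - x j.castSucc) = D
      linear_combination (A * C * D) * e4
    · obtain ⟨j', hj', hj⟩ := eq_of_not_free h hj
      obtain rfl := Fin.succ_injective _ hj'
      rw [prod_eq_zero (mem_univ j'.succ) (f := fun i => (w j' - s * x i) / (w j' - x i)),
        zero_mul, mul_zero]
      have := hcoinc j' hj
      rw [show w j' - s * x j'.succ = -s * (x j'.succ - s⁻¹ * w j') by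
        field_simp
        ring, this, mul_zero, zero_div]
  rw [← hS] at key
  have h5 : (1 - s) * (sumS lam nu (q, t) - 1 - sumT lam nu (q, t)) = 0 := by
    rw [hT]
    -- Both residue sums now carry the factor `1 - s`, which is cancelled.
    have h6 : 1 - s⁻¹ = -(1 - s) * s⁻¹ := by field_simp; ring
    rw [h6] at key
    linear_combination key
  have := (mul_eq_zero.1 h5).resolve_left hs1
  linarith

/-! ### Continuity in the parameters -/

theorem continuousAt_one_sub_zpow_mul_pow {p : ℝ × ℝ} {n : ℤ} (hn : 0 ≤ n) (d : ℕ) :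
    ContinuousAt (fun p : ℝ × ℝ => 1 - p.1 ^ n * p.2 ^ d) p :=
  continuousAt_const.sub ((continuousAt_fst.zpow₀ n (Or.inr hn)).mul (continuousAt_snd.pow d))

theorem Admissible.continuousAt_macE (hqt : Admissible q t) {n : ℤ} (hn : 0 ≤ n) (d : ℕ) :
    ContinuousAt (fun p : ℝ × ℝ => macE p.1 p.2 n d) (q, t) :=
  (continuousAt_one_sub_zpow_mul_pow (by omega) d).div (continuousAt_one_sub_zpow_mul_pow hn _)
    (hqt.one_sub_pos hn (by omega)).ne'

/-- The ordering hypotheses make all exponents nonnegative, hence the powers continuous even at `0`,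
and keep every denominator positive. -/
theorem Admissible.continuousAt_ratioX (hqt : Admissible q t) {lam : Fin (k + 1) → ℤ}
    {kap : Fin k → ℤ} {c : ℤ} {m : Fin (k + 1)}
    (h1 : ∀ i : Fin k, i.castSucc < m → c < lam i.castSucc ∧ c < kap i)
    (h2 : ∀ i : Fin k, m ≤ i.castSucc → lam i.succ ≤ c ∧ kap i ≤ c) :
    ContinuousAt (fun p : ℝ × ℝ => ratioX p.1 p.2 lam kap c m) (q, t) := by
  unfold ratioX
  refine tendsto_finsetProd _ fun i _ => ?_
  by_cases hi : i.castSucc < m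
  · simp only [if_pos hi]
    obtain ⟨h3, h4⟩ := h1 i hi
    refine ContinuousAt.div ?_ ?_ ?_
    · exact (continuousAt_one_sub_zpow_mul_pow (by omega) _).mul
        (continuousAt_one_sub_zpow_mul_pow (by omega) _)
    · exact (continuousAt_one_sub_zpow_mul_pow (by omega) _).mul
        (continuousAt_one_sub_zpow_mul_pow (by omega) _)
    · exact (mul_pos (hqt.one_sub_pos (by omega) (by omega))
        (hqt.one_sub_pos (by omega) (by omega))).ne'
  · simp only [if_neg hi]
    obtain ⟨h3, h4⟩ := h2 i (not_lt.1 hi)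
    refine ContinuousAt.div ?_ ?_ ?_
    · exact (continuousAt_one_sub_zpow_mul_pow (by omega) _).mul
        (continuousAt_one_sub_zpow_mul_pow (by omega) _)
    · exact (continuousAt_one_sub_zpow_mul_pow (by omega) _).mul
        (continuousAt_one_sub_zpow_mul_pow (by omega) _)
    · exact (mul_pos (hqt.one_sub_pos (by omega) (by omega))
        (hqt.one_sub_pos (by omega) (by omega))).ne'

theorem Admissible.continuousAt_sumS (hqt : Admissible q t) {lam : Fin (k + 1) → ℤ}
    {nu : Fin k → ℤ} (h : Interlaces nu lam) : ContinuousAt (sumS lam nu) (q, t) := by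
  unfold sumS
  refine tendsto_finsetSum _ fun m _ => ?_
  split_ifs with hm
  · refine hqt.continuousAt_ratioX (fun i hi => ⟨h.upper_lt_of_free hm hi, h.lt_of_free hm hi⟩)
      fun i hi => ?_
    exact ⟨h.antitone_upper (hi.trans Fin.castSucc_lt_succ.le),
      (h i).2.trans (h.antitone_upper hi)⟩
  · exact tendsto_const_nhds

theorem Admissible.continuousAt_sumT (hqt : Admissible q t) {lam : Fin (k + 1) → ℤ}
    {nu : Fin k → ℤ} (h : Interlaces nu lam) : ContinuousAt (sumT lam nu) (q, t) := by
  unfold sumT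
  refine tendsto_finsetSum _ fun j _ => ?_
  split_ifs with hj
  · have h0 := (h j).2
    have hj' := hj j rfl
    refine ContinuousAt.mul (hqt.continuousAt_ratioX (fun i hi => ?_) fun i hi => ?_)
      ((hqt.continuousAt_macE le_rfl 0).div (hqt.continuousAt_macE (by omega) 0)
        (hqt.macE_pos (by omega) 0).ne')
    · have hij : i < j := hi
      have h1 := h.antitone_lower hij.le
      have h2 := (h i).2
      simp only [Pi.sub_apply, Pi.single_eq_of_ne hij.ne, sub_zero]
      omega
    · have hij : j ≤ i := hi
      have h1 := h.antitone_upper (Fin.succ_le_succ_iff.2 hij)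
      rcases hij.eq_or_lt with rfl | hij
      · simp only [Pi.sub_apply, Pi.single_eq_same]
        omega
      · have h2 : nu i ≤ lam j.succ :=
          (h i).2.trans (h.antitone_upper (Fin.succ_le_castSucc_iff.2 hij))
        simp only [Pi.sub_apply, Pi.single_eq_of_ne hij.ne']
        omega
  · exact tendsto_const_nhds

/-- Since either parameter may be `0`, the point is approached from above: first `t'` is increased
slightly, then `q'` is chosen outside the countable set of powers of `t'`. -/
theorem Admissible.frequently_generic (hqt : Admissible q t) : ∃ᶠ p : ℝ × ℝ in 𝓝 (q, t),
    (0 < p.1 ∧ p.1 < 1) ∧ (0 < p.2 ∧ p.2 < 1) ∧ ∀ d : ℕ, p.1 ≠ p.2 ^ d := by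
  rw [Metric.nhds_basis_ball.frequently_iff]
  intro ε hε
  obtain ⟨t', h1, h2⟩ := exists_between (lt_min hqt.t_lt_one (lt_add_of_pos_right t hε))
  obtain ⟨q', h3, h4, h5⟩ := ((Set.countable_range fun d : ℕ => t' ^ d).dense_compl ℝ).exists_between
    (lt_min hqt.q_lt_one (lt_add_of_pos_right q hε))
  rw [lt_min_iff] at h2 h5
  refine ⟨(q', t'), ?_, ⟨hqt.q_nonneg.trans_lt h4, h5.1⟩, ⟨hqt.t_nonneg.trans_lt h1, h2.1⟩,
    fun d hd => h3 ⟨d, hd.symm⟩⟩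
  rw [Metric.mem_ball, Prod.dist_eq, max_lt_iff, Real.dist_eq, Real.dist_eq,
    abs_lt, abs_lt]
  constructor <;> constructor <;> simp only <;> linarith [h5.2, h2.2]

/-- Both sides are given by functions continuous at `(q, t)` that agree at generic points
arbitrarily close to it. -/
theorem Admissible.sum_coefS_eq (hqt : Admissible q t) {lam : Fin (k + 1) → ℤ}
    {nu : Fin k → ℤ} (h : Interlaces nu lam) :
    ∑ m, coefS q t nu lam m = 1 + ∑ j, coefT q t nu lam j := by
  have hS : ∑ m, coefS q t nu lam m = sumS lam nu (q, t) := by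
    refine sum_congr rfl fun m _ => ?_
    split_ifs with hm
    · exact hqt.coefS_of_free h hm
    · exact coefS_of_not_free h hm
  have hT : ∑ j, coefT q t nu lam j = sumT lam nu (q, t) := by
    refine sum_congr rfl fun j _ => ?_
    split_ifs with hj
    · exact hqt.coefT_of_free h hj
    · exact coefT_of_not_free h hj
  rw [hS, hT]
  refine tendsto_nhds_unique_of_frequently_eq (hqt.continuousAt_sumS h)
    ((hqt.continuousAt_sumT h).const_add 1) (hqt.frequently_generic.mono fun p hp => ?_)
  exact sumS_eq_of_generic hp.1.1 hp.1.2 hp.2.1.1 hp.2.1.2 hp.2.2 h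

end Identity

/-! ### The Pieri rule for skew functions in one variable -/

/-- A single box can repair interlacing only when exactly one inequality `nu_j ≤ lam_j` fails, and
fails by one. The same configuration is then repaired by removing a box from `nu_j`, so the two
sides of the skew Pieri rule are supported together. -/
theorem Interlaces.blocked_of_upper {nu : Fin k → ℤ} {lam : Fin (k + 1) → ℤ} (hlam : Antitone lam)
    (h : ¬ Interlaces nu lam) {m : Fin (k + 1)} (hm : Interlaces nu (lam + Pi.single m 1)) :
    ∃ j : Fin k, j.castSucc = m ∧ nu j = lam j.castSucc + 1 ∧
      Interlaces (nu - Pi.single j 1) lam := by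
  unfold Interlaces at h
  push Not at h
  obtain ⟨i, hi⟩ := h
  have h1 := hm i
  simp only [Pi.add_apply, Pi.single_apply] at h1
  have him : i.castSucc = m := by
    by_contra hne
    rw [if_neg hne] at h1
    have := hi (by split_ifs at h1 <;> omega)
    omega
  have hnu : nu i = lam i.castSucc + 1 := by
    rw [if_pos him] at h1
    have := hi (by split_ifs at h1 <;> omega)
    omega
  refine ⟨i, him, hnu, fun l => ?_⟩
  have h2 := hm l
  have h3 : lam l.succ ≤ lam l.castSucc := hlam Fin.castSucc_lt_succ.le
  simp only [Pi.add_apply, Pi.sub_apply, Pi.single_apply, ← him, Fin.castSucc_inj] at h2 ⊢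
  by_cases hl : l = i
  · subst hl
    simp only [if_true]
    omega
  · simp only [if_neg hl] at h2 ⊢
    split_ifs at h2 <;> omega

theorem Interlaces.blocked_of_lower {nu : Fin k → ℤ} {lam : Fin (k + 1) → ℤ} (hnu : Antitone nu)
    (h : ¬ Interlaces nu lam) {j : Fin k} (hj : Interlaces (nu - Pi.single j 1) lam) :
    nu j = lam j.castSucc + 1 ∧ Interlaces nu (lam + Pi.single j.castSucc 1) := by
  unfold Interlaces at h
  push Not at h
  obtain ⟨i, hi⟩ := h
  have h1 := hj i
  simp only [Pi.sub_apply, Pi.single_apply] at h1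
  have hij : i = j := by
    by_contra hne
    rw [if_neg hne] at h1
    have := hi (by omega)
    omega
  subst hij
  rw [if_pos rfl] at h1
  have hnu' : nu i = lam i.castSucc + 1 := by
    have := hi (by omega)
    omega
  refine ⟨hnu', fun l => ?_⟩
  have h2 := hj l
  simp only [Pi.add_apply, Pi.sub_apply, Pi.single_apply, Fin.castSucc_inj] at h2 ⊢
  by_cases hl : l = i
  · subst hl
    simp only [if_true, if_neg (Fin.castSucc_lt_succ (i := l)).ne'] at h2 ⊢
    omega
  · simp only [if_neg hl] at h2 ⊢
    split_ifs with hs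
    · have h3 : nu i ≤ nu l := hnu (by
        have : (l : ℕ) + 1 = i := congrArg Fin.val hs
        exact Fin.le_def.2 (by omega))
      rw [hs]
      omega
    · omega

theorem Interlaces.eq_of_blocked_upper {nu : Fin k → ℤ} {lam : Fin (k + 1) → ℤ} {j : Fin k}
    (hj : nu j = lam j.castSucc + 1) {m : Fin (k + 1)}
    (hm : Interlaces nu (lam + Pi.single m 1)) : m = j.castSucc := by
  by_contra hne
  have := (hm j).2
  simp only [Pi.add_apply, Pi.single_eq_of_ne (Ne.symm hne)] at this
  omega

theorem Interlaces.eq_of_blocked_lower {nu : Fin k → ℤ} {lam : Fin (k + 1) → ℤ} {j : Fin k}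
    (hj : nu j = lam j.castSucc + 1) {i : Fin k}
    (hi : Interlaces (nu - Pi.single i 1) lam) : i = j := by
  by_contra hne
  have := (hi j).2
  simp only [Pi.sub_apply, Pi.single_eq_of_ne (Ne.symm hne)] at this
  omega

theorem Admissible.psi_blocked (hqt : Admissible q t) {nu : Fin k → ℤ} {lam : Fin (k + 1) → ℤ}
    {j : Fin k} (hj : nu j = lam j.castSucc + 1) (h1 : Interlaces (nu - Pi.single j 1) lam)
    (h2 : Interlaces nu (lam + Pi.single j.castSucc 1)) :
    psi q t lam (nu - Pi.single j 1) * psiPrime q t (nu - Pi.single j 1) j =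
      psiPrime q t lam j.castSucc * psi q t (lam + Pi.single j.castSucc 1) nu := by
  have := hqt.psi_mul_psiPrime_of_eq h1 (m := j) (by simp [hj]) (by simpa using h2)
  simpa using this

/-- For an interlacing pair this is `Σ S = 1 + Σ T` multiplied by `psi`. Otherwise each side has at
most one nonzero term, and the two terms agree by `psi_blocked`. -/
theorem Admissible.skew_pieri (hqt : Admissible q t) {lam : Fin (k + 1) → ℤ} {nu : Fin k → ℤ}
    (hlam : Antitone lam) (hnu : Antitone nu) :
    ∑ m, psiPrime q t lam m * psi q t (lam + Pi.single m 1) nu = psi q t lam nu +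
      ∑ j, psiPrime q t (nu - Pi.single j 1) j * psi q t lam (nu - Pi.single j 1) := by
  by_cases h : Interlaces nu lam
  · have key := hqt.sum_coefS_eq h
    have hpos := (hqt.psi_pos h).ne'
    have e1 : ∑ m, psiPrime q t lam m * psi q t (lam + Pi.single m 1) nu =
        psi q t lam nu * ∑ m, coefS q t nu lam m := by
      rw [mul_sum]
      refine sum_congr rfl fun m _ => ?_
      unfold coefS
      field_simp
    have e2 : ∑ j, psiPrime q t (nu - Pi.single j 1) j * psi q t lam (nu - Pi.single j 1) =
        psi q t lam nu * ∑ j, coefT q t nu lam j := by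
      rw [mul_sum]
      refine sum_congr rfl fun m _ => ?_
      unfold coefT
      field_simp
    rw [e1, e2, key]
    ring
  · rw [psi_of_not_interlaces h, zero_add]
    by_cases hj : ∃ j : Fin k, nu j = lam j.castSucc + 1 ∧ Interlaces (nu - Pi.single j 1) lam ∧
      Interlaces nu (lam + Pi.single j.castSucc 1)
    · obtain ⟨j, hj, h1, h2⟩ := hj
      rw [sum_eq_single j.castSucc, sum_eq_single j]
      · rw [mul_comm (psiPrime q t (nu - Pi.single j 1) j)]
        exact (hqt.psi_blocked hj h1 h2).symm
      · intro i _ hi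
        rw [psi_of_not_interlaces fun h' => hi (Interlaces.eq_of_blocked_lower hj h'), mul_zero]
      · simp
      · intro i _ hi
        rw [psi_of_not_interlaces fun h' => hi (Interlaces.eq_of_blocked_upper hj h'), mul_zero]
      · simp
    · rw [sum_eq_zero, sum_eq_zero]
      · intro i _
        rw [psi_of_not_interlaces, mul_zero]
        intro h'
        obtain ⟨h1, h2⟩ := Interlaces.blocked_of_lower hnu h h'
        exact hj ⟨i, h1, h', h2⟩
      · intro m _
        rw [psi_of_not_interlaces, mul_zero]
        intro h'
        obtain ⟨j, rfl, h1, h2⟩ := Interlaces.blocked_of_upper hlam h h'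
        exact hj ⟨j, h1, h2, h'⟩

/-! ### Macdonald polynomials as functions of arbitrary integer vectors -/

open Classical in
/-- The Macdonald polynomial of an integer vector, zero unless the vector is a signature. -/
def extP (q t : ℝ) (a : ℕ → ℝ) (k : ℕ) (f : Fin k → ℤ) : ℝ :=
  if h : Antitone f then macP q t a k ⟨f, h⟩ else 0

theorem extP_coe (a : ℕ → ℝ) (lam : Sig k) : extP q t a k lam = macP q t a k lam :=
  dif_pos lam.2

theorem extP_of_antitone {a : ℕ → ℝ} {f : Fin k → ℤ} (h : Antitone f) :
    extP q t a k f = macP q t a k ⟨f, h⟩ := dif_pos h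

theorem finite_setOf_interlaces (lam : Fin (k + 1) → ℤ) :
    {f : Fin k → ℤ | Interlaces f lam}.Finite :=
  (Set.finite_Icc (fun i => lam i.succ) fun i => lam i.castSucc).subset fun _ hf =>
    ⟨fun i => (hf i).1, fun i => (hf i).2⟩

theorem finite_support_of_psi (lam : Fin (k + 1) → ℤ) {F : (Fin k → ℤ) → ℝ}
    (hF : ∀ f, ¬ Interlaces f lam → F f = 0) : (Function.support F).Finite :=
  (finite_setOf_interlaces lam).subset fun _ hf => not_not.1 fun h => hf (hF _ h)

/-- Sums over all integer vectors can be reindexed by `f ↦ f + e_j`, which does not preserve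
signatures; this is the reason for passing to `extP`. -/
theorem finsum_sig (F : (Fin k → ℤ) → ℝ) (hF : ∀ f, ¬ Antitone f → F f = 0) :
    ∑ᶠ mu : Sig k, F mu = ∑ᶠ f, F f := by
  have h := finsum_subtype_eq_finsum_cond (f := F) (fun f : Fin k → ℤ => Antitone f)
  refine h.trans (finsum_congr fun f => ?_)
  by_cases hf : Antitone f
  · simp [hf]
  · simp [hf, hF f hf]

theorem extP_succ (a : ℕ → ℝ) (lam : Fin (k + 1) → ℤ) :
    extP q t a (k + 1) lam = ∑ᶠ f : Fin k → ℤ,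
      extP q t a k f * (psi q t lam f * a k ^ ((∑ i, lam i) - ∑ i, f i)) := by
  by_cases h : Antitone lam
  · have hrec : macP q t a (k + 1) ⟨lam, h⟩ =
        ∑ᶠ mu : Sig k, macP q t a k mu * skewP q t (a k) ⟨lam, h⟩ mu := rfl
    rw [extP_of_antitone h, hrec,
      ← finsum_sig (fun f : Fin k → ℤ =>
        extP q t a k f * (psi q t lam f * a k ^ ((∑ i, lam i) - ∑ i, f i)))]
    · refine finsum_congr fun mu => ?_
      rw [extP_coe]
      rfl
    · intro f hf
      rw [psi_of_not_interlaces fun h' => hf h'.antitone_lower]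
      ring
  · rw [extP, dif_neg h]
    have : ∀ f : Fin k → ℤ,
        extP q t a k f * (psi q t lam f * a k ^ ((∑ i, lam i) - ∑ i, f i)) = 0 := fun f => by
      rw [psi_of_not_interlaces fun h' => h h'.antitone_upper]
      ring
    simp [this]

theorem Admissible.macP_pos (hqt : Admissible q t) {a : ℕ → ℝ} :
    ∀ {k : ℕ}, (∀ i < k, 0 < a i) → ∀ lam : Sig k, 0 < macP q t a k lam
  | 0, _, _ => one_pos
  | k + 1, ha, lam => by
    have ih := hqt.macP_pos (k := k) fun i hi => ha i (by omega)
    have hk := ha k (by omega)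
    have hext : ∀ f, 0 ≤ extP q t a k f := fun f => by
      unfold extP
      split_ifs with h
      · exact (ih _).le
      · exact le_rfl
    rw [← extP_coe, extP_succ]
    -- Dropping the last part gives an interlacing row, so the sum has a strictly positive term.
    let mu : Fin k → ℤ := fun i => lam i.castSucc
    have hmu : Interlaces mu lam := fun i => ⟨lam.2 Fin.castSucc_lt_succ.le, le_rfl⟩
    refine finsum_pos (fun f => ?_) ⟨mu, ?_⟩ (finite_support_of_psi lam fun f hf => ?_)
    · have := hqt.psi_nonneg lam f
      have := hext f
      positivity
    · rw [extP_of_antitone hmu.antitone_lower]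
      exact mul_pos (ih _) (mul_pos (hqt.psi_pos hmu) (zpow_pos hk _))
    · rw [psi_of_not_interlaces hf]
      ring

theorem sum_add_single (f : Fin k → ℤ) (j : Fin k) :
    ∑ i, (f + Pi.single j 1 : Fin k → ℤ) i = ∑ i, f i + 1 := by
  simp [sum_add_distrib]

/-- The Pieri rule for multiplication by `x_1 + … + x_k`. -/
theorem Admissible.pieri (hqt : Admissible q t) {a : ℕ → ℝ} :
    ∀ {k : ℕ}, (∀ i < k, 0 < a i) → ∀ lam : Fin k → ℤ, Antitone lam →
      ∑ j, psiPrime q t lam j * extP q t a k (lam + Pi.single j 1) =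
        (∑ i ∈ range k, a i) * extP q t a k lam
  | 0, _, _, _ => by simp
  | k + 1, ha, lam, hlam => by
    have ih := hqt.pieri (k := k) fun i hi => ha i (by omega)
    have hk : a k ≠ 0 := (ha k (by omega)).ne'
    have hL : ∑ j, psiPrime q t lam j * extP q t a (k + 1) (lam + Pi.single j 1) =
        ∑ᶠ f : Fin k → ℤ, ∑ j, psiPrime q t lam j * (extP q t a k f *
          (psi q t (lam + Pi.single j 1) f * a k ^ ((∑ i, lam i) + 1 - ∑ i, f i))) := by
      rw [finsum_sum_comm]
      · refine sum_congr rfl fun j _ => ?_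
        rw [extP_succ, mul_finsum', sum_add_single]
        refine finite_support_of_psi (lam + Pi.single j 1) fun f hf => ?_
        rw [psi_of_not_interlaces hf]
        ring
      · intro j _
        refine finite_support_of_psi (lam + Pi.single j 1) fun f hf => ?_
        rw [psi_of_not_interlaces hf]
        ring
    have hfin : ∀ j : Fin k, (Function.support fun f : Fin k → ℤ => psiPrime q t f j *
        (extP q t a k (f + Pi.single j 1) *
          (psi q t lam f * a k ^ ((∑ i, lam i) - ∑ i, f i)))).Finite := fun j =>
      finite_support_of_psi lam fun f hf => by
        rw [psi_of_not_interlaces hf]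
        ring
    have hshift : ∀ (j : Fin k) (f : Fin k → ℤ),
        psiPrime q t (f + Pi.single j 1 - Pi.single j 1) j * (extP q t a k (f + Pi.single j 1) *
        (psi q t lam (f + Pi.single j 1 - Pi.single j 1) *
          a k ^ ((∑ i, lam i) + 1 - ∑ i, (f + Pi.single j 1 : Fin k → ℤ) i))) =
        psiPrime q t f j * (extP q t a k (f + Pi.single j 1) *
          (psi q t lam f * a k ^ ((∑ i, lam i) - ∑ i, f i))) := fun j f => by
      rw [add_sub_cancel_right, sum_add_single, add_sub_add_right_eq_sub]
    have hsupp : ∀ j : Fin k, (Function.support fun f : Fin k → ℤ =>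
        psiPrime q t (f - Pi.single j 1) j * (extP q t a k f *
          (psi q t lam (f - Pi.single j 1) * a k ^ ((∑ i, lam i) + 1 - ∑ i, f i)))).Finite := by
      intro j
      refine ((hfin j).image (Equiv.addRight (Pi.single j 1 : Fin k → ℤ))).subset ?_
      intro f hf
      refine ⟨f - Pi.single j 1, ?_, sub_add_cancel f _⟩
      rw [Function.mem_support, ← hshift, sub_add_cancel]
      exact hf
    -- The induction hypothesis moves the first `k` variables under the branching sum; the shift by
    -- `e_j` then gives the terms of the skew Pieri rule in which the lower row has lost a box.
    have hR1 : (∑ i ∈ range k, a i) * extP q t a (k + 1) lam =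
        ∑ᶠ f : Fin k → ℤ, ∑ j, psiPrime q t (f - Pi.single j 1) j * (extP q t a k f *
          (psi q t lam (f - Pi.single j 1) * a k ^ ((∑ i, lam i) + 1 - ∑ i, f i))) := by
      rw [extP_succ, mul_finsum', finsum_sum_comm]
      · have : ∀ j : Fin k, ∑ᶠ f : Fin k → ℤ, psiPrime q t (f - Pi.single j 1) j *
            (extP q t a k f * (psi q t lam (f - Pi.single j 1) *
              a k ^ ((∑ i, lam i) + 1 - ∑ i, f i))) = ∑ᶠ f : Fin k → ℤ, psiPrime q t f j *
            (extP q t a k (f + Pi.single j 1) *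
              (psi q t lam f * a k ^ ((∑ i, lam i) - ∑ i, f i))) := fun j => by
          rw [← finsum_comp_equiv (Equiv.addRight (Pi.single j 1 : Fin k → ℤ))]
          exact finsum_congr (hshift j)
        rw [sum_congr rfl fun j _ => this j, ← finsum_sum_comm _ _ fun j _ => hfin j]
        refine finsum_congr fun f => ?_
        by_cases hf : Antitone f
        · rw [← mul_assoc, ← ih f hf, sum_mul]
          exact sum_congr rfl fun j _ => by ring
        · rw [psi_of_not_interlaces fun h' => hf h'.antitone_lower]
          simp
      · exact fun j _ => hsupp j
      · refine finite_support_of_psi lam fun f hf => ?_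
        rw [psi_of_not_interlaces hf]
        ring
    -- The last variable raises the exponent by one and gives the remaining term `psi q t lam f`.
    have hR2 : a k * extP q t a (k + 1) lam = ∑ᶠ f : Fin k → ℤ, extP q t a k f *
        (psi q t lam f * a k ^ ((∑ i, lam i) + 1 - ∑ i, f i)) := by
      rw [extP_succ, mul_finsum']
      · refine finsum_congr fun f => ?_
        rw [add_sub_right_comm, zpow_add_one₀ hk]
        ring
      · refine finite_support_of_psi lam fun f hf => ?_
        rw [psi_of_not_interlaces hf]
        ring
    rw [sum_range_succ, add_mul, hL, hR1, hR2, ← finsum_add_distrib]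
    · refine finsum_congr fun f => ?_
      by_cases hf : Antitone f
      · have := hqt.skew_pieri hlam hf
        have h1 : ∀ c : ℝ, ∀ g : Fin (k + 1) → ℝ, ∑ j, psiPrime q t lam j * (extP q t a k f *
            (g j * c)) = extP q t a k f * c * ∑ j, psiPrime q t lam j * g j := fun c g => by
          rw [mul_sum]
          exact sum_congr rfl fun j _ => by ring
        have h2 : ∀ c : ℝ, ∀ g h : Fin k → ℝ, ∑ j, h j * (extP q t a k f *
            (g j * c)) = extP q t a k f * c * ∑ j, h j * g j := fun c g h => by
          rw [mul_sum]
          exact sum_congr rfl fun j _ => by ring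
        rw [h1, h2, this]
        ring
      · simp [extP, hf]
    · refine (Set.Finite.biUnion (s := ((univ : Finset (Fin k)) : Set (Fin k)))
        (Set.toFinite _) fun j _ => hsupp j).subset ?_
      exact Finset.support_sum _ _
    · refine finite_support_of_psi lam fun f hf => ?_
      rw [psi_of_not_interlaces hf]
      ring

/-! ### Adding a box -/

theorem AddBox.coe_eq {lam nu : Sig k} {j : Fin k} (h : AddBox lam nu j) :
    (nu : Fin k → ℤ) = (lam : Fin k → ℤ) + Pi.single j 1 := h

theorem AddBox.ne {lam nu : Sig k} {j : Fin k} (h : AddBox lam nu j) : nu ≠ lam := by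
  rintro rfl
  have := congrFun h j
  simp at this

theorem not_addBox_self (lam : Sig k) (j : Fin k) : ¬ AddBox lam lam j := fun h => h.ne rfl

theorem AddBox.index_unique {lam nu : Sig k} {i j : Fin k} (h : AddBox lam nu i)
    (h' : AddBox lam nu j) : i = j := by
  by_contra hne
  have h1 := congrFun (h.symm.trans h') i
  simp [hne] at h1

theorem AddBox.upper_unique {lam nu nu' : Sig k} {j : Fin k} (h : AddBox lam nu j)
    (h' : AddBox lam nu' j) : nu = nu' := Subtype.ext (h.trans h'.symm)

theorem AddBox.lower_unique {lam lam' nu : Sig k} {j : Fin k} (h : AddBox lam nu j)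
    (h' : AddBox lam' nu j) : lam = lam' := by
  have h1 : (lam : Fin k → ℤ) + Pi.single j 1 = (lam' : Fin k → ℤ) + Pi.single j 1 := h.symm.trans h'
  exact Subtype.ext (add_right_cancel h1)

theorem AddBox.sub_eq {lam nu : Sig k} {j : Fin k} (h : AddBox lam nu j) :
    (nu : Fin k → ℤ) - Pi.single j 1 = (lam : Fin k → ℤ) := by
  rw [h.coe_eq, add_sub_cancel_right]

theorem AddBox.sum_eq {lam nu : Sig k} {j : Fin k} (h : AddBox lam nu j) :
    ∑ i, nu i = ∑ i, lam i + 1 := by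
  rw [h.coe_eq, sum_add_single]

theorem addBox_mk {lam : Sig k} {j : Fin k}
    (h : Antitone ((lam : Fin k → ℤ) + Pi.single j 1 : Fin k → ℤ)) :
    AddBox lam ⟨_, h⟩ j := rfl

open Classical in
theorem finsum_addBox_upper {lam nu : Sig k} {j : Fin k} (h : AddBox lam nu j) (g : Sig k → ℝ) :
    ∑ᶠ mu : Sig k, (if AddBox lam mu j then g mu else 0) = g nu := by
  rw [finsum_eq_single _ nu, if_pos h]
  exact fun mu hmu => if_neg fun h' => hmu (h'.upper_unique h)

open Classical in
theorem finite_support_addBox_upper (lam : Sig k) (j : Fin k) (g : Sig k → ℝ) :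
    (Function.support fun mu : Sig k => if AddBox lam mu j then g mu else 0).Finite := by
  refine Set.Subsingleton.finite fun mu hmu mu' hmu' => ?_
  simp only [Function.mem_support, ne_eq, ite_eq_right_iff, not_forall] at hmu hmu'
  exact hmu.1.upper_unique hmu'.1

open Classical in
theorem finite_support_addBox_lower (nu : Sig k) (j : Fin k) (g : Sig k → ℝ) :
    (Function.support fun mu : Sig k => if AddBox mu nu j then g mu else 0).Finite := by
  refine Set.Subsingleton.finite fun mu hmu mu' hmu' => ?_
  simp only [Function.mem_support, ne_eq, ite_eq_right_iff, not_forall] at hmu hmu'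
  exact hmu.1.lower_unique hmu'.1

/-! ### The univariate generators -/

theorem univJump_of_addBox (a : ℕ → ℝ) {lam nu : Sig k} {j : Fin k} (h : AddBox lam nu j) :
    univJump q t a k lam nu = macP q t a k nu / macP q t a k lam * psiPrime q t lam j := by
  unfold univJump
  rw [sum_eq_single j, if_pos h]
  · exact fun i _ hi => if_neg fun h' => hi (h'.index_unique h)
  · simp

theorem univQ_of_addBox (a : ℕ → ℝ) {lam nu : Sig k} {j : Fin k} (h : AddBox lam nu j) :
    univQ q t a k lam nu = macP q t a k nu / macP q t a k lam * psiPrime q t lam j := by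
  rw [univQ, if_neg h.ne, univJump_of_addBox a h]

theorem univQ_of_not_step (a : ℕ → ℝ) {lam nu : Sig k} (h : ¬ Step lam nu) :
    univQ q t a k lam nu = 0 := by
  rw [univQ, if_neg fun h' => h (Or.inl h')]
  exact sum_eq_zero fun j _ => if_neg fun h' => h (Or.inr ⟨j, h'⟩)

/-- By the Pieri rule the total jump rate does not depend on the state. -/
theorem Admissible.univQ_self (hqt : Admissible q t) {a : ℕ → ℝ} (ha : ∀ i < k, 0 < a i)
    (lam : Sig k) : univQ q t a k lam lam = - ∑ i ∈ range k, a i := by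
  classical
  rw [univQ, if_pos rfl]
  congr 1
  unfold univJump
  rw [finsum_sum_comm _ _ fun j _ => finite_support_addBox_upper lam j _]
  have hpos := (hqt.macP_pos ha lam).ne'
  have h1 := hqt.pieri ha lam lam.2
  rw [extP_coe] at h1
  rw [← mul_div_cancel_right₀ (∑ i ∈ range k, a i) hpos, ← h1, sum_div]
  refine sum_congr rfl fun j _ => ?_
  by_cases h : Antitone ((lam : Fin k → ℤ) + Pi.single j 1 : Fin k → ℤ)
  · rw [finsum_addBox_upper (addBox_mk h), extP_of_antitone h]
    ring
  · rw [extP, dif_neg h, mul_zero, zero_div]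
    refine finsum_eq_zero_of_forall_eq_zero fun nu => if_neg fun h' => h ?_
    rw [← h'.coe_eq]
    exact nu.2

/-- The factor `P_mu / P_lam · x^{|lam| - |mu|}` of the stochastic link. -/
def linkFactor (q t : ℝ) (a : ℕ → ℝ) (k : ℕ) (lam : Sig (k + 1)) (mu : Sig k) : ℝ :=
  macP q t a k mu / macP q t a (k + 1) lam * a k ^ ((∑ i, lam i) - ∑ i, mu i)

theorem link_eq (a : ℕ → ℝ) (lam : Sig (k + 1)) (mu : Sig k) :
    link q t a k lam mu = linkFactor q t a k lam mu * psi q t lam mu := by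
  unfold link linkFactor skewP
  ring

theorem Admissible.linkFactor_pos (hqt : Admissible q t) {a : ℕ → ℝ} (ha : ∀ i < k + 1, 0 < a i)
    (lam : Sig (k + 1)) (mu : Sig k) : 0 < linkFactor q t a k lam mu :=
  mul_pos (div_pos (hqt.macP_pos (fun i hi => ha i (by omega)) mu) (hqt.macP_pos ha lam))
    (zpow_pos (ha k (by omega)) _)

/-- The Macdonald polynomials of the intermediate state cancel, and the extra box contributes `a k`.
With the next lemma, both kinds of terms of the intertwining relation acquire the same prefactor,
and only `psi` and `psiPrime` remain to be compared. -/
theorem Admissible.univQ_mul_link (hqt : Admissible q t) {a : ℕ → ℝ} (ha : ∀ i < k + 1, 0 < a i)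
    {lam nu : Sig (k + 1)} {m : Fin (k + 1)} (h : AddBox lam nu m) (nub : Sig k) :
    univQ q t a (k + 1) lam nu * link q t a k nu nub =
      linkFactor q t a k lam nub * (a k * (psiPrime q t lam m * psi q t nu nub)) := by
  have h1 := (hqt.macP_pos ha nu).ne'
  have h2 := (ha k (by omega)).ne'
  rw [univQ_of_addBox a h, link_eq, linkFactor, linkFactor, h.sum_eq, add_sub_right_comm,
    zpow_add_one₀ h2]
  field_simp

theorem Admissible.link_mul_univQ (hqt : Admissible q t) {a : ℕ → ℝ} (ha : ∀ i < k + 1, 0 < a i)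
    (lam : Sig (k + 1)) {lamb nub : Sig k} {j : Fin k} (h : AddBox lamb nub j) :
    link q t a k lam lamb * univQ q t a k lamb nub =
      linkFactor q t a k lam nub * (a k * (psi q t lam lamb * psiPrime q t lamb j)) := by
  have h1 := (hqt.macP_pos (fun i hi => ha i (by omega)) lamb).ne'
  have h2 := (ha k (by omega)).ne'
  have h3 : (∑ i, lam i) - ∑ i, lamb i = (∑ i, lam i) - ∑ i, nub i + 1 := by
    rw [h.sum_eq]
    ring
  rw [univQ_of_addBox a h, link_eq, linkFactor, linkFactor, h3, zpow_add_one₀ h2]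
  field_simp

/-- The sum over the old state of the lower row in the intertwining relation. -/
theorem Admissible.finsum_link_mul_univQ (hqt : Admissible q t) {a : ℕ → ℝ}
    (ha : ∀ i < k + 1, 0 < a i) (lam : Sig (k + 1)) (nub : Sig k) (V : Sig k → ℝ) (v : Fin k → ℝ)
    (hv : ∀ lamb j, AddBox lamb nub j → Interlaces lamb lam → V lamb = v j) :
    ∑ᶠ lamb : Sig k, V lamb * link q t a k lam lamb * univQ q t a k lamb nub =
      linkFactor q t a k lam nub * (a k * (∑ j, v j * (psi q t lam ((nub : Fin k → ℤ) - Pi.single j 1) *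
        psiPrime q t ((nub : Fin k → ℤ) - Pi.single j 1) j)) -
          (∑ i ∈ range k, a i) * (V nub * psi q t lam nub)) := by
  classical
  have hterm : ∀ lamb : Sig k, V lamb * link q t a k lam lamb * univQ q t a k lamb nub =
      (if lamb = nub then -(∑ i ∈ range k, a i) * (V nub * link q t a k lam nub) else 0) +
        ∑ j, if AddBox lamb nub j then
          V lamb * link q t a k lam lamb * univQ q t a k lamb nub else 0 := by
    intro lamb
    by_cases h : Step lamb nub
    · rcases h with rfl | ⟨j, hj⟩
      · rw [if_pos rfl, hqt.univQ_self (fun i hi => ha i (by omega)), sum_eq_zero fun j _ => if_neg (not_addBox_self nub j)]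
        ring
      · rw [if_neg hj.ne.symm, zero_add, sum_eq_single j, if_pos hj]
        · exact fun i _ hi => if_neg fun h' => hi (h'.index_unique hj)
        · simp
    · rw [univQ_of_not_step a h, if_neg fun h' => h (Or.inl h'.symm), zero_add, mul_zero]
      exact (sum_eq_zero fun j _ => if_neg fun h' => h (Or.inr ⟨j, h'⟩)).symm
  rw [finsum_congr hterm, finsum_add_distrib, finsum_eq_single _ nub, if_pos rfl, finsum_sum_comm]
  · have hj : ∀ j : Fin k, (∑ᶠ lamb : Sig k, if AddBox lamb nub j then
        V lamb * link q t a k lam lamb * univQ q t a k lamb nub else 0) =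
        linkFactor q t a k lam nub * (a k * (v j * (psi q t lam ((nub : Fin k → ℤ) - Pi.single j 1) *
        psiPrime q t ((nub : Fin k → ℤ) - Pi.single j 1) j))) := by
      intro j
      by_cases h : Antitone ((nub : Fin k → ℤ) - Pi.single j 1 : Fin k → ℤ)
      · obtain ⟨mu, hmu⟩ : ∃ mu : Sig k, AddBox mu nub j := ⟨⟨_, h⟩, (sub_add_cancel _ _).symm⟩
        rw [hmu.sub_eq, finsum_eq_single _ mu, if_pos hmu, mul_assoc,
          hqt.link_mul_univQ ha lam hmu]
        · by_cases hi : Interlaces mu lam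
          · rw [hv mu j hmu hi]
            ring
          · rw [psi_of_not_interlaces hi]
            ring
        · exact fun mu' hmu' => if_neg fun h' => hmu' (h'.lower_unique hmu)
      · rw [psi_of_not_interlaces fun h' => h h'.antitone_lower]
        rw [finsum_eq_zero_of_forall_eq_zero]
        · ring
        · intro mu
          refine if_neg fun h' => h ?_
          rw [h'.sub_eq]
          exact mu.2
    rw [sum_congr rfl fun j _ => hj j, ← mul_sum, ← mul_sum, link_eq]
    ring
  · exact fun j _ => finite_support_addBox_lower nub j _
  · exact fun mu hmu => if_neg hmu
  · refine (Set.finite_singleton nub).subset fun mu hmu => ?_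
    by_contra h
    exact hmu (if_neg h)
  · refine (Set.Finite.biUnion (s := ((univ : Finset (Fin k)) : Set (Fin k)))
      (Set.toFinite _) fun j _ => finite_support_addBox_lower nub j
        (fun lamb => V lamb * link q t a k lam lamb * univQ q t a k lamb nub)).subset ?_
    exact Finset.support_sum _ _

/-! ### The first free right neighbour -/

theorem xi_mem (nub : Fin k → ℤ) (lam : Fin (k + 1) → ℤ) (i : Fin (k + 1)) :
    xi nub lam i ≤ i ∧ Free nub lam (xi nub lam i) := by
  classical
  have := max'_mem (univ.filter fun j : Fin (k + 1) => j ≤ i ∧ Free nub lam j)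
    ⟨0, mem_filter.2 ⟨mem_univ _, Fin.zero_le _, free_zero nub lam⟩⟩
  simp only [mem_filter, mem_univ, true_and] at this
  convert this using 1 <;> (unfold xi; congr!)

theorem xi_le (nub : Fin k → ℤ) (lam : Fin (k + 1) → ℤ) (i : Fin (k + 1)) : xi nub lam i ≤ i :=
  (xi_mem nub lam i).1

theorem xi_free (nub : Fin k → ℤ) (lam : Fin (k + 1) → ℤ) (i : Fin (k + 1)) :
    Free nub lam (xi nub lam i) := (xi_mem nub lam i).2

open Classical in
theorem le_xi {nub : Fin k → ℤ} {lam : Fin (k + 1) → ℤ} {i m : Fin (k + 1)} (hmi : m ≤ i)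
    (hm : Free nub lam m) : m ≤ xi nub lam i :=
  le_max' _ _ (mem_filter.2 ⟨mem_univ _, hmi, hm⟩)

theorem xi_castSucc_ne_succ (nub : Fin k → ℤ) (lam : Fin (k + 1) → ℤ) (j : Fin k) :
    xi nub lam j.castSucc ≠ j.succ :=
  ((xi_le nub lam j.castSucc).trans_lt Fin.castSucc_lt_succ).ne

/-! ### Interlacing of rows that differ by a box -/

theorem Interlaces.free_of_addBox {nub : Sig k} {lam nu : Sig (k + 1)} (h : Interlaces nub lam)
    {m : Fin (k + 1)} (hm : AddBox lam nu m) : Interlaces nub nu ↔ Free nub lam m := by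
  rw [hm.coe_eq]
  exact interlaces_add_single_iff h m

theorem Interlaces.free_of_lower_addBox {lamb nub : Sig k} {lam : Sig (k + 1)}
    (h : Interlaces nub lam) {j : Fin k} (hj : AddBox lamb nub j) :
    Interlaces lamb lam ↔ Free nub lam j.succ := by
  rw [← hj.sub_eq]
  exact interlaces_sub_single_iff h j

theorem Interlaces.exists_addBox {nub : Sig k} {lam : Sig (k + 1)} (h : Interlaces nub lam)
    {m : Fin (k + 1)} (hm : Free nub lam m) : ∃ nu : Sig (k + 1), AddBox lam nu m :=
  ⟨⟨_, ((interlaces_add_single_iff h m).2 hm).antitone_upper⟩, rfl⟩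

theorem Interlaces.exists_lower_addBox {nub : Sig k} {lam : Sig (k + 1)} (h : Interlaces nub lam)
    {j : Fin k} (hj : Free nub lam j.succ) : ∃ lamb : Sig k, AddBox lamb nub j :=
  ⟨⟨_, ((interlaces_sub_single_iff h j).2 hj).antitone_lower⟩, (sub_add_cancel _ _).symm⟩

/-- If a move of the lower row breaks the interlacing, then the upper row has to follow. -/
theorem Interlaces.blocked_of_addBox {lamb nub : Sig k} {lam : Sig (k + 1)}
    (h : Interlaces lamb lam) {j : Fin k} (hj : AddBox lamb nub j) (hn : ¬ Interlaces nub lam) :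
    nub j = lam j.castSucc + 1 ∧
      Interlaces nub ((lam : Fin (k + 1) → ℤ) + Pi.single j.castSucc 1) := by
  rw [← hj.sub_eq] at h
  exact Interlaces.blocked_of_lower nub.2 hn h

theorem Interlaces.exists_addBox_of_blocked {lamb nub : Sig k} {lam : Sig (k + 1)}
    (h : Interlaces lamb lam) {j : Fin k} (hj : AddBox lamb nub j) (hn : ¬ Interlaces nub lam) :
    ∃ nu : Sig (k + 1), AddBox lam nu j.castSucc ∧ Interlaces nub nu := by
  have h1 := (h.blocked_of_addBox hj hn).2
  exact ⟨⟨_, h1.antitone_upper⟩, rfl, h1⟩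

/-! ### Values of rates and probabilities with given parameters -/

section Values

variable {x : ℝ} {p : Sig k → Sig (k + 1) → NNParams k} {lam nu : Sig (k + 1)} {lamb nub : Sig k}

open Classical in
theorem sliceOfParams_W_self : (sliceOfParams x p).W lam lam nub =
    - ∑ m : Fin (k + 1), (if Free nub lam m then x * (p nub lam).w m else 0) := if_pos rfl

open Classical in
theorem sliceOfParams_W_of_ne (h : nu ≠ lam) : (sliceOfParams x p).W lam nu nub =
    ∑ m : Fin (k + 1), (if AddBox lam nu m ∧ Free nub lam m then x * (p nub lam).w m else 0) :=
  if_neg h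

open Classical in
theorem sliceOfParams_W_of_addBox {m : Fin (k + 1)} (h : AddBox lam nu m) :
    (sliceOfParams x p).W lam nu nub = if Free nub lam m then x * (p nub lam).w m else 0 := by
  rw [sliceOfParams_W_of_ne h.ne, sum_eq_single m]
  · exact if_congr (and_iff_right h) rfl rfl
  · exact fun i _ hi => if_neg fun h' => hi (h'.1.index_unique h)
  · simp

open Classical in
theorem sliceOfParams_V_self :
    (sliceOfParams x p).V lam nu lamb lamb = if nu = lam then 1 else 0 := if_pos rfl

open Classical in
theorem sliceOfParams_V_of_addBox {j : Fin k} (h : AddBox lamb nub j) (hi : Interlaces nub lam) :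
    (sliceOfParams x p).V lam nu lamb nub =
      (if AddBox lam nu (xi nub lam j.castSucc) then (p nub lam).r j else 0)
        + (if AddBox lam nu j.succ then (p nub lam).l j else 0)
        + (if nu = lam then 1 - (p nub lam).r j - (p nub lam).l j else 0) := by
  unfold sliceOfParams
  simp only
  rw [if_neg h.ne, sum_eq_single j, if_pos h, if_pos hi]
  · exact fun i _ hi => if_neg fun h' => hi (h'.index_unique h)
  · simp

open Classical in
theorem sliceOfParams_V_of_blocked {j : Fin k} (h : AddBox lamb nub j)
    (hi : ¬ Interlaces nub lam) : (sliceOfParams x p).V lam nu lamb nub =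
      if AddBox lam nu j.castSucc then 1 else 0 := by
  unfold sliceOfParams
  simp only
  rw [if_neg h.ne, sum_eq_single j, if_pos h, if_neg hi]
  · exact fun i _ hi => if_neg fun h' => hi (h'.index_unique h)
  · simp

theorem sliceOfParams_W_support (hi : Interlaces nub lam) (h : (sliceOfParams x p).W lam nu nub ≠ 0) :
    Step lam nu ∧ Interlaces nub nu := by
  classical
  by_cases hne : nu = lam
  · subst hne
    exact ⟨Or.inl rfl, hi⟩
  · rw [sliceOfParams_W_of_ne hne] at h
    obtain ⟨m, -, hm⟩ := exists_ne_zero_of_sum_ne_zero h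
    obtain ⟨h1, h2⟩ := (ite_ne_right_iff.1 hm).1
    exact ⟨Or.inr ⟨m, h1⟩, (hi.free_of_addBox h1).2 h2⟩

theorem sliceOfParams_V_support (hi : Interlaces lamb lam) (hs : Step lamb nub)
    (h : (sliceOfParams x p).V lam nu lamb nub ≠ 0) : Step lam nu ∧ Interlaces nub nu := by
  classical
  rcases hs with rfl | ⟨j, hj⟩
  · rw [sliceOfParams_V_self] at h
    obtain rfl := (ite_ne_right_iff.1 h).1
    exact ⟨Or.inl rfl, hi⟩
  · by_cases hn : Interlaces nub lam
    · rw [sliceOfParams_V_of_addBox hj hn] at h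
      by_cases h1 : AddBox lam nu (xi nub lam j.castSucc)
      · exact ⟨Or.inr ⟨_, h1⟩, (hn.free_of_addBox h1).2 (xi_free _ _ _)⟩
      by_cases h2 : AddBox lam nu j.succ
      · exact ⟨Or.inr ⟨_, h2⟩, (hn.free_of_addBox h2).2 ((hn.free_of_lower_addBox hj).1 hi)⟩
      by_cases h3 : nu = lam
      · subst h3
        exact ⟨Or.inl rfl, hn⟩
      · simp [h1, h2, h3] at h
    · rw [sliceOfParams_V_of_blocked hj hn] at h
      have h1 := (ite_ne_right_iff.1 h).1
      refine ⟨Or.inr ⟨_, h1⟩, ?_⟩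
      rw [h1.coe_eq]
      exact (hi.blocked_of_addBox hj hn).2

theorem sliceOfParams_sum_V (hi : Interlaces lamb lam) (hs : Step lamb nub) :
    ∑ᶠ nu : Sig (k + 1), (sliceOfParams x p).V lam nu lamb nub = 1 := by
  classical
  have hsing : ∀ c : ℝ, (∑ᶠ nu : Sig (k + 1), if nu = lam then c else 0) = c := fun c => by
    rw [finsum_eq_single _ lam fun mu hmu => if_neg hmu, if_pos rfl]
  have hfin : ∀ c : ℝ, (Function.support fun nu : Sig (k + 1) => if nu = lam then c else 0).Finite :=
    fun c => (Set.finite_singleton lam).subset fun mu hmu => by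
      by_contra h
      exact hmu (if_neg h)
  rcases hs with rfl | ⟨j, hj⟩
  · simp only [sliceOfParams_V_self]
    exact hsing 1
  · by_cases hn : Interlaces nub lam
    · simp only [sliceOfParams_V_of_addBox hj hn]
      obtain ⟨nu1, h1⟩ := hn.exists_addBox (xi_free nub lam j.castSucc)
      obtain ⟨nu2, h2⟩ := hn.exists_addBox ((hn.free_of_lower_addBox hj).1 hi)
      have f1 := finite_support_addBox_upper lam (xi nub lam j.castSucc) fun _ => (p nub lam).r j
      have f2 := finite_support_addBox_upper lam j.succ fun _ => (p nub lam).l j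
      rw [finsum_add_distrib ((f1.union f2).subset (Function.support_add _ _)) (hfin _),
        finsum_add_distrib f1 f2, hsing, finsum_addBox_upper h1 fun _ => (p nub lam).r j,
        finsum_addBox_upper h2 fun _ => (p nub lam).l j]
      ring
    · simp only [sliceOfParams_V_of_blocked hj hn]
      obtain ⟨nu, h1, -⟩ := hi.exists_addBox_of_blocked hj hn
      exact finsum_addBox_upper h1 fun _ => 1

theorem sliceOfParams_sum_W (hi : Interlaces nub lam) :
    (∑ᶠ (nu : Sig (k + 1)) (_ : nu ≠ lam), (sliceOfParams x p).W lam nu nub) =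
      - (sliceOfParams x p).W lam lam nub := by
  classical
  rw [sliceOfParams_W_self, neg_neg]
  have h1 : ∀ nu : Sig (k + 1), (∑ᶠ (_ : nu ≠ lam), (sliceOfParams x p).W lam nu nub) =
      ∑ m : Fin (k + 1), if AddBox lam nu m then
        (if Free nub lam m then x * (p nub lam).w m else 0) else 0 := by
    intro nu
    by_cases h : nu = lam
    · subst h
      simp [not_addBox_self]
    · rw [finsum_eq_if, if_pos h, sliceOfParams_W_of_ne h]
      exact sum_congr rfl fun m _ => ite_and _ _ _ _
  rw [finsum_congr h1, finsum_sum_comm _ _ fun m _ => finite_support_addBox_upper lam m _]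
  refine sum_congr rfl fun m _ => ?_
  by_cases hm : Free nub lam m
  · obtain ⟨nu, hnu⟩ := hi.exists_addBox hm
    exact finsum_addBox_upper hnu fun _ => _
  · simp [hm]

end Values

/-! ### A criterion for the intertwining relation -/

/-- The linear system that characterizes parameters of nearest neighbour `dynamics'` at a pair. -/
def SolvesSystem (q t : ℝ) (nub : Fin k → ℤ) (lam : Fin (k + 1) → ℤ) (p : NNParams k) : Prop :=
  ∀ m, Free nub lam m → p.w m +
    (∑ j : Fin k, if xi nub lam j.castSucc = m then coefT q t nub lam j * p.r j else 0) +
    (∑ j : Fin k, if j.succ = m then coefT q t nub lam j * p.l j else 0) = coefS q t nub lam m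

/-- In the sum of the system over free `m`, each `j` with `j + 1` free is counted once through
`ξ(j)` and once through `j + 1`; the remaining `j` have `T_j = 0`. With `Σ S = 1 + Σ T` this becomes
the relation for `nu = lam`. -/
theorem SolvesSystem.sum_eq (hqt : Admissible q t) {nub : Fin k → ℤ} {lam : Fin (k + 1) → ℤ}
    (h : Interlaces nub lam) {p : NNParams k} (hp : SolvesSystem q t nub lam p) :
    open Classical in
    (∑ m, if Free nub lam m then p.w m else 0) =
      1 + ∑ j, coefT q t nub lam j * (1 - p.r j - p.l j) := by
  classical
  have h1 : ∀ m, (if Free nub lam m then p.w m else 0) = coefS q t nub lam m -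
      (∑ j : Fin k, if xi nub lam j.castSucc = m then coefT q t nub lam j * p.r j else 0) -
      (∑ j : Fin k, if j.succ = m then coefT q t nub lam j * p.l j else 0) := by
    intro m
    split_ifs with hm
    · rw [← hp m hm]
      ring
    · rw [coefS_of_not_free h hm, sum_eq_zero, sum_eq_zero]
      · ring
      · intro j _
        split_ifs with hj
        · rw [coefT_of_not_free h (by rwa [hj]), zero_mul]
        · rfl
      · intro j _
        refine if_neg ?_
        rintro rfl
        exact hm (xi_free _ _ _)
  rw [sum_congr rfl fun m _ => h1 m, sum_sub_distrib, sum_sub_distrib, hqt.sum_coefS_eq h,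
    sum_comm, sum_comm (s := univ) (t := univ) (f := fun m j =>
      if Fin.succ j = m then coefT q t nub lam j * p.l j else 0)]
  simp only [sum_ite_eq, mem_univ, if_true]
  rw [add_sub_assoc, add_sub_assoc, ← sum_sub_distrib, ← sum_sub_distrib]
  congr 1
  exact sum_congr rfl fun j _ => by ring

theorem Admissible.isSliceDynamics_sliceOfParams (hqt : Admissible q t) {a : ℕ → ℝ}
    (ha : ∀ i < k + 1, 0 < a i) {p : Sig k → Sig (k + 1) → NNParams k}
    (hp : ∀ (nub : Sig k) (lam : Sig (k + 1)), Interlaces nub lam → SolvesSystem q t nub lam (p nub lam)) :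
    IsSliceDynamics q t a k (sliceOfParams (a k) p) where
  support_W _ _ _ hi h := sliceOfParams_W_support hi h
  support_V _ _ _ _ hi hs h := sliceOfParams_V_support hi hs h
  sum_V _ _ _ hi hs := sliceOfParams_sum_V hi hs
  trivial_V _ _ _ _ := ⟨fun h => by rw [sliceOfParams_V_self, if_pos h],
    fun h => by rw [sliceOfParams_V_self, if_neg h]⟩
  sum_W _ _ hi := sliceOfParams_sum_W hi
  intertwining lam nu nub hnu := by
    classical
    by_cases hstep : Step lam nu
    swap
    · rw [univQ_of_not_step a hstep, zero_mul]
      have h1 : (sliceOfParams (a k) p).W lam nu nub * link q t a k lam nub = 0 := by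
        by_cases hi : Interlaces nub lam
        · rw [not_not.1 fun h => hstep (sliceOfParams_W_support hi h).1, zero_mul]
        · rw [link_eq, psi_of_not_interlaces hi, mul_zero, mul_zero]
      rw [h1, add_zero]
      refine finsum_eq_zero_of_forall_eq_zero fun lamb => ?_
      by_cases hi : Interlaces lamb lam
      · by_cases hs : Step lamb nub
        · rw [not_not.1 fun h => hstep (sliceOfParams_V_support hi hs h).1, zero_mul, zero_mul]
        · rw [univQ_of_not_step a hs, mul_zero]
      · rw [link_eq, psi_of_not_interlaces hi, mul_zero, mul_zero, zero_mul]
    rcases hstep with rfl | ⟨m, hm⟩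
    -- The upper row stays put: each lower move contributes its probability `1 - r_j - l_j` of
    -- triggering nothing. The diagonal rates `a_1 + … + a_{k+1}` and `a_1 + … + a_k` differ by the
    -- variable of this slice.
    · rw [hqt.finsum_link_mul_univQ ha nu nub (fun lamb => (sliceOfParams (a k) p).V nu nu lamb nub)
        (fun j => 1 - (p nub nu).r j - (p nub nu).l j)]
      · rw [sliceOfParams_V_self, if_pos rfl, sliceOfParams_W_self, hqt.univQ_self ha,
          sum_range_succ, link_eq]
        have hsum := (hp nub nu hnu).sum_eq hqt hnu
        have hpos := (hqt.psi_pos hnu).ne'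
        have e1 : ∑ j, (1 - (p nub nu).r j - (p nub nu).l j) *
            (psi q t nu ((nub : Fin k → ℤ) - Pi.single j 1) *
              psiPrime q t ((nub : Fin k → ℤ) - Pi.single j 1) j) =
            psi q t nu nub * ∑ j, coefT q t nub nu j *
              (1 - (p nub nu).r j - (p nub nu).l j) := by
          rw [mul_sum]
          refine sum_congr rfl fun j _ => ?_
          unfold coefT
          field_simp
        have e2 : (∑ m : Fin (k + 1), (if Free nub nu m then a k * (p nub nu).w m else 0)) =
            a k * ∑ m, if Free nub nu m then (p nub nu).w m else 0 := by
          rw [mul_sum]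
          exact sum_congr rfl fun m _ => by split_ifs <;> simp
        rw [e1, e2, hsum]
        ring
      · intro lamb j hj _
        rw [sliceOfParams_V_of_addBox hj hnu, if_neg (not_addBox_self _ _),
          if_neg (not_addBox_self _ _), if_pos rfl]
        ring
    · rw [hqt.univQ_mul_link ha hm, hm.coe_eq, link_eq, sliceOfParams_W_of_addBox hm]
      by_cases hi : Interlaces nub lam
      · have hfree := (hi.free_of_addBox hm).1 hnu
        rw [hqt.finsum_link_mul_univQ ha lam nub (fun lamb => (sliceOfParams (a k) p).V lam nu lamb nub)
          (fun j => (if xi nub lam j.castSucc = m then (p nub lam).r j else 0) +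
            if j.succ = m then (p nub lam).l j else 0)]
        · rw [sliceOfParams_V_self, if_neg hm.ne, if_pos hfree]
          have hpos := (hqt.psi_pos hi).ne'
          have hsys := hp nub lam hi m hfree
          have e1 : ∑ j, ((if xi nub lam j.castSucc = m then (p nub lam).r j else 0) +
              if j.succ = m then (p nub lam).l j else 0) *
              (psi q t lam ((nub : Fin k → ℤ) - Pi.single j 1) *
                psiPrime q t ((nub : Fin k → ℤ) - Pi.single j 1) j) = psi q t lam nub *
              ((∑ j : Fin k, if xi nub lam j.castSucc = m then
                  coefT q t nub lam j * (p nub lam).r j else 0) +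
                ∑ j : Fin k, if j.succ = m then coefT q t nub lam j * (p nub lam).l j else 0) := by
            rw [← sum_add_distrib, mul_sum]
            refine sum_congr rfl fun j _ => ?_
            unfold coefT
            split_ifs <;> field_simp <;> ring
          have e2 : psiPrime q t lam m * psi q t ((lam : Fin (k + 1) → ℤ) + Pi.single m 1) nub =
              psi q t lam nub * coefS q t nub lam m := by
            unfold coefS
            field_simp
          rw [e1, e2, ← hsys]
          ring
        · intro lamb j hj _
          rw [sliceOfParams_V_of_addBox hj hi, if_neg hm.ne, add_zero]
          congr 1
          · exact if_congr ⟨fun h => h.index_unique hm, fun h => h ▸ hm⟩ rfl rfl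
          · exact if_congr ⟨fun h => h.index_unique hm, fun h => h ▸ hm⟩ rfl rfl
      -- The new lower row is incompatible with the old upper row, so there is no independent jump
      -- and only the forced move contributes.
      · rw [psi_of_not_interlaces hi, mul_zero, mul_zero, add_zero]
        rw [hqt.finsum_link_mul_univQ ha lam nub (fun lamb => (sliceOfParams (a k) p).V lam nu lamb nub)
          (fun j => if j.castSucc = m then 1 else 0)]
        · rw [psi_of_not_interlaces hi, mul_zero, mul_zero, sub_zero]
          have hnu' := hnu
          rw [hm.coe_eq] at hnu'
          obtain ⟨j, rfl, h1, h2⟩ := Interlaces.blocked_of_upper lam.2 hi hnu'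
          rw [sum_eq_single j, if_pos rfl, one_mul, hqt.psi_blocked h1 h2 hnu']
          · intro i _ hne
            rw [if_neg fun h => hne (Fin.castSucc_injective _ h), zero_mul]
          · simp
        · intro lamb j hj _
          rw [sliceOfParams_V_of_blocked hj hi]
          exact if_congr ⟨fun h => h.index_unique hm, fun h => h ▸ hm⟩ rfl rfl

theorem sliceOfParams_nearestNeighbor {x : ℝ} {p : Sig k → Sig (k + 1) → NNParams k}
    {lam nu : Sig (k + 1)} {lamb nub : Sig k} {j : Fin k} {m : Fin (k + 1)}
    (hi : Interlaces nub lam) (hj : AddBox lamb nub j) (hm : AddBox lam nu m)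
    (h : (sliceOfParams x p).V lam nu lamb nub ≠ 0) : m = j.succ ∨ m = xi nub lam j.castSucc := by
  by_contra! hne
  apply h
  rw [sliceOfParams_V_of_addBox hj hi, if_neg fun h' => hne.2 (hm.index_unique h'),
    if_neg fun h' => hne.1 (hm.index_unique h'), if_neg hm.ne]
  ring

/-! ### The fundamental parameters solve the linear system -/

theorem solvesSystem_pbParams (nub : Sig k) (lam : Sig (k + 1)) :
    SolvesSystem q t nub lam (pbParams q t nub lam) := fun m _ => by
  simp [pbParams]

theorem solvesSystem_rightParams (h : Fin k) (nub : Sig k) (lam : Sig (k + 1)) :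
    SolvesSystem q t nub lam (rightParams q t h nub lam) := fun m _ => by
  simp only [rightParams, mul_ite, mul_one, mul_zero, ite_self, sum_const_zero, add_zero]
  rw [sum_eq_single h]
  · simp
  · intro j _ hj
    simp [hj]
  · simp

theorem solvesSystem_leftParams (h : Fin k) (nub : Sig k) (lam : Sig (k + 1)) :
    SolvesSystem q t nub lam (leftParams q t h nub lam) := fun m _ => by
  simp only [leftParams, mul_ite, mul_one, mul_zero, ite_self, sum_const_zero, add_zero]
  rw [sum_eq_single h]
  · simp
  · intro j _ hj
    simp [hj]
  · simp

theorem xi_eq_self {nub : Fin k → ℤ} {lam : Fin (k + 1) → ℤ} {m : Fin (k + 1)}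
    (hm : Free nub lam m) : xi nub lam m = m := le_antisymm (xi_le _ _ _) (le_xi le_rfl hm)

theorem xi_mono (nub : Fin k → ℤ) (lam : Fin (k + 1) → ℤ) : Monotone (xi nub lam) :=
  fun i _ hij => le_xi ((xi_le nub lam i).trans hij) (xi_free nub lam i)

theorem xi_succ_of_not_free {nub : Fin k → ℤ} {lam : Fin (k + 1) → ℤ} {j : Fin k}
    (hj : ¬ Free nub lam j.succ) : xi nub lam j.succ = xi nub lam j.castSucc := by
  refine le_antisymm (le_xi ?_ (xi_free _ _ _)) (xi_mono _ _ Fin.castSucc_lt_succ.le)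
  have h1 : xi nub lam j.succ ≠ j.succ := fun h => hj (h ▸ xi_free nub lam j.succ)
  exact Fin.le_castSucc_iff.2 (lt_of_le_of_ne (xi_le _ _ _) h1)

/-- `S_1 + … + S_m - T_1 - … - T_{m-1}`. -/
def cumulative (q t : ℝ) (nub : Fin k → ℤ) (lam : Fin (k + 1) → ℤ) (m : Fin (k + 1)) : ℝ :=
  (∑ i, if i ≤ m then coefS q t nub lam i else 0) -
    ∑ i : Fin k, if i.castSucc < m then coefT q t nub lam i else 0

theorem cumulative_castSucc (nub : Fin k → ℤ) (lam : Fin (k + 1) → ℤ) (j : Fin k) :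
    cumulative q t nub lam j.castSucc =
      (∑ i ∈ Iic j, coefS q t nub lam i.castSucc) - ∑ i ∈ Iio j, coefT q t nub lam i := by
  unfold cumulative
  rw [Fin.sum_univ_castSucc, if_neg (not_le.2 (Fin.castSucc_lt_last j)), add_zero]
  simp only [Fin.castSucc_le_castSucc_iff, Fin.castSucc_lt_castSucc_iff]
  rw [← sum_filter, ← sum_filter]
  congr 2 <;> (ext i; simp)

theorem cumulative_succ (nub : Fin k → ℤ) (lam : Fin (k + 1) → ℤ) (j : Fin k) :
    cumulative q t nub lam j.succ =
      cumulative q t nub lam j.castSucc + coefS q t nub lam j.succ - coefT q t nub lam j := by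
  unfold cumulative
  have h1 : ∀ i, (if i ≤ j.succ then coefS q t nub lam i else 0) =
      (if i ≤ j.castSucc then coefS q t nub lam i else 0) +
        if i = j.succ then coefS q t nub lam i else 0 := fun i => by
    simp only [Fin.le_castSucc_iff]
    by_cases h : i = j.succ
    · simp [h]
    · simp [h, le_iff_lt_or_eq]
  have h2 : ∀ i : Fin k, (if i.castSucc < j.succ then coefT q t nub lam i else 0) =
      (if i.castSucc < j.castSucc then coefT q t nub lam i else 0) +
        if i = j then coefT q t nub lam i else 0 := fun i => by
    simp only [Fin.castSucc_lt_succ_iff, Fin.castSucc_lt_castSucc_iff]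
    by_cases h : i = j
    · simp [h]
    · simp [h, le_iff_lt_or_eq]
  rw [sum_congr rfl fun i _ => h1 i, sum_congr rfl fun i _ => h2 i, sum_add_distrib,
    sum_add_distrib, sum_ite_eq', sum_ite_eq', if_pos (mem_univ _), if_pos (mem_univ _)]
  ring

theorem cumulative_zero (nub : Fin k → ℤ) (lam : Fin (k + 1) → ℤ) :
    cumulative q t nub lam 0 = coefS q t nub lam 0 := by
  simp [cumulative]

theorem Admissible.cumulative_last (hqt : Admissible q t) {nub : Fin k → ℤ}
    {lam : Fin (k + 1) → ℤ} (h : Interlaces nub lam) :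
    cumulative q t nub lam (Fin.last k) = 1 := by
  unfold cumulative
  simp only [Fin.le_last, Fin.castSucc_lt_last, if_true]
  rw [hqt.sum_coefS_eq h]
  ring

/-- No index strictly after `ξ(i)` and up to `i` is free, and at a non-free `j + 1` both `S_{j+1}`
and `T_j` vanish. -/
theorem cumulative_xi {nub : Fin k → ℤ} {lam : Fin (k + 1) → ℤ} (h : Interlaces nub lam)
    (i : Fin (k + 1)) : cumulative q t nub lam (xi nub lam i) = cumulative q t nub lam i := by
  induction i using Fin.induction with
  | zero => rw [xi_eq_self (free_zero nub lam)]
  | succ j ih =>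
    by_cases hj : Free nub lam j.succ
    · rw [xi_eq_self hj]
    · rw [xi_succ_of_not_free hj, ih, cumulative_succ, coefS_of_not_free h hj,
        coefT_of_not_free h hj]
      ring

/-- The rates at which RSK-type `dynamics'` propagate moves to the right. -/
theorem Admissible.sum_xi_eq (hqt : Admissible q t) {nub : Fin k → ℤ} {lam : Fin (k + 1) → ℤ}
    (hi : Interlaces nub lam) (h : Fin (k + 1)) {m : Fin (k + 1)} (hm : Free nub lam m) :
    open Classical in
    (∑ j : Fin k, if xi nub lam j.castSucc = m ∧ Free nub lam j.succ then
      cumulative q t nub lam j.castSucc - (if h ≤ j.castSucc then 1 else 0) else 0) =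
    cumulative q t nub lam m - (if h < m then 1 else 0) - (if xi nub lam h = m then 1 else 0) := by
  classical
  -- The indices with `ξ = m` form a block starting at `m`; `e` plays the role of its last element.
  -- Either `h` lies before the block, in it, or after it.
  have hsum : ∀ e : Fin (k + 1), xi nub lam e = m → (xi nub lam h = m → h ≤ e) →
      ((if h < m then (1 : ℝ) else 0) + if xi nub lam h = m then 1 else 0) =
        if h ≤ e then 1 else 0 := by
    intro e he hhe
    have hme : m ≤ e := he ▸ xi_le nub lam e
    by_cases h1 : h < m
    · rw [if_pos h1, if_neg ((xi_le nub lam h).trans_lt h1).ne, if_pos (h1.le.trans hme), add_zero]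
    · by_cases h2 : h ≤ e
      · have h3 : xi nub lam h = m :=
          le_antisymm (he ▸ xi_mono nub lam h2) (le_xi (not_lt.1 h1) hm)
        rw [if_neg h1, if_pos h3, if_pos h2, zero_add]
      · rw [if_neg h1, if_neg fun h3 => h2 (hhe h3), if_neg h2, zero_add]
  -- A term of the sum comes from a `j` that closes the block of `m`, so there is at most one. If
  -- there is none, the block reaches the last particle, where the cumulative sum is `1` and the
  -- right side vanishes.
  by_cases hex : ∃ j : Fin k, xi nub lam j.castSucc = m ∧ Free nub lam j.succ
  · obtain ⟨j, hj⟩ := hex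
    rw [sum_eq_single j, if_pos hj, sub_sub, hsum j.castSucc hj.1, ← hj.1, cumulative_xi hi]
    · intro hh
      by_contra hlt
      have h1 := le_xi (Fin.castSucc_lt_iff_succ_le.1 (not_le.1 hlt)) hj.2
      rw [hh, ← hj.1] at h1
      exact absurd (h1.trans (xi_le _ _ _)) (not_le.2 Fin.castSucc_lt_succ)
    · intro j' _ hne
      refine if_neg fun hj' => ?_
      have key : ∀ i i' : Fin k, i < i' → Free nub lam i.succ → xi nub lam i.castSucc = m →
          xi nub lam i'.castSucc = m → False := fun i i' hii hfree h1 h2 => by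
        have h3 := le_xi (Fin.succ_le_castSucc_iff.2 hii) hfree
        rw [h2, ← h1] at h3
        exact absurd (h3.trans (xi_le _ _ _)) (not_le.2 Fin.castSucc_lt_succ)
      rcases lt_or_gt_of_ne hne with h1 | h1
      · exact key j' j h1 hj'.2 hj'.1 hj.1
      · exact key j j' h1 hj.2 hj.1 hj'.1
    · simp
  · push Not at hex
    have hxi : ∀ i, m ≤ i → xi nub lam i = m := by
      intro i
      induction i using Fin.induction with
      | zero =>
        intro h0
        rw [Fin.le_zero_iff.1 h0, xi_eq_self (free_zero nub lam)]
      | succ j ih =>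
        intro hmj
        rcases hmj.eq_or_lt with rfl | hmj
        · exact xi_eq_self hm
        · have h1 := ih (Fin.le_castSucc_iff.2 hmj)
          rw [xi_succ_of_not_free (hex j h1), h1]
    have hlast := hxi _ (Fin.le_last m)
    rw [sum_eq_zero fun j _ => if_neg fun h' => hex j h'.1 h'.2, sub_sub,
      hsum _ hlast fun _ => Fin.le_last h, if_pos (Fin.le_last h), ← hlast, cumulative_xi hi,
      hqt.cumulative_last hi, sub_self]

theorem Admissible.coefT_mul_rsk (hqt : Admissible q t) {nub : Sig k} {lam : Sig (k + 1)}
    (hi : Interlaces nub lam) (h : Fin (k + 1)) (j : Fin k) :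
    open Classical in
    coefT q t nub lam j * (rskParams q t h nub lam).r j = if Free nub lam j.succ then
      cumulative q t nub lam j.castSucc - (if h ≤ j.castSucc then 1 else 0) else 0 := by
  classical
  simp only [rskParams, ← cumulative_castSucc]
  by_cases hj : Free nub lam j.succ
  · rw [if_pos hj, mul_inv_cancel_left₀ (hqt.coefT_pos hi hj).ne']
  · rw [if_neg hj, coefT_of_not_free hi hj, zero_mul]

theorem rskParams_l (h : Fin (k + 1)) (nub : Sig k) (lam : Sig (k + 1)) (j : Fin k) :
    (rskParams q t h nub lam).l j = 1 - (rskParams q t h nub lam).r j := rfl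

/-- Let `C_m` be the cumulative sum. The jump rate and the pushes onto `m` add up to `C_m -
1_{h<m}`. As `l = 1 - r`, the pull adds `T_{m-1} - C_{m-1} + 1_{h ≤ m-1}` for `m` not the first
particle. The total telescopes to `S_m`. -/
theorem Admissible.solvesSystem_rskParams (hqt : Admissible q t) (h : Fin (k + 1)) {nub : Sig k}
    {lam : Sig (k + 1)} (hi : Interlaces nub lam) :
    SolvesSystem q t nub lam (rskParams q t h nub lam) := by
  classical
  intro m hm
  simp only [rskParams_l, mul_sub, mul_one, hqt.coefT_mul_rsk hi, ← ite_and]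
  rw [hqt.sum_xi_eq hi h hm]
  have hw : (rskParams q t h nub lam).w m = if xi nub lam h = m then 1 else 0 := rfl
  rw [hw]
  induction m using Fin.cases with
  | zero =>
    simp only [Fin.succ_ne_zero, if_false, sum_const_zero, Fin.not_lt_zero, cumulative_zero]
    ring
  | succ j =>
    simp only [Fin.succ_inj]
    rw [sum_ite_eq', if_pos (mem_univ j), if_pos hm, cumulative_succ]
    simp only [Fin.le_castSucc_iff]
    ring

/-! ### The fundamental objects are nearest neighbour `dynamics'` -/

theorem Admissible.isNNDynamics_of_params (hqt : Admissible q t) {a : ℕ → ℝ}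
    (ha : ∀ k < N, 0 < a k) (p : (k : Fin N) → Sig k → Sig (k + 1) → NNParams k)
    (hp : ∀ (k : Fin N) (nub : Sig k) (lam : Sig (k + 1)), Interlaces nub lam →
      SolvesSystem q t nub lam (p k nub lam)) :
    IsNNDynamics q t a fun k => sliceOfParams (a k) (p k) :=
  ⟨fun k => hqt.isSliceDynamics_sliceOfParams (fun i hi => ha i (by omega)) (hp k),
    fun _ _ _ _ _ _ _ hi _ hj hm h => sliceOfParams_nearestNeighbor hi hj hm h⟩

theorem Admissible.isNNDynamics_pushBlock (hqt : Admissible q t) {a : ℕ → ℝ}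
    (ha : ∀ k < N, 0 < a k) : IsNNDynamics q t a (pushBlock q t a N) :=
  hqt.isNNDynamics_of_params ha _ fun _ nub lam _ => solvesSystem_pbParams nub lam

theorem Admissible.isNNDynamics_rskDyn (hqt : Admissible q t) {a : ℕ → ℝ}
    (ha : ∀ k < N, 0 < a k) (h : RSKIndex N) : IsNNDynamics q t a (rskDyn q t a h) :=
  hqt.isNNDynamics_of_params ha _ fun k _ _ hi => hqt.solvesSystem_rskParams (h k) hi

theorem Admissible.isNNDynamics_rightDyn (hqt : Admissible q t) {a : ℕ → ℝ}
    (ha : ∀ k < N, 0 < a k) (h : RLIndex N) : IsNNDynamics q t a (rightDyn q t a h) := by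
  refine hqt.isNNDynamics_of_params ha _ fun k nub lam _ => ?_
  split_ifs with hk
  · exact solvesSystem_rightParams (h k hk) nub lam
  · exact solvesSystem_pbParams nub lam

theorem Admissible.isNNDynamics_leftDyn (hqt : Admissible q t) {a : ℕ → ℝ}
    (ha : ∀ k < N, 0 < a k) (h : RLIndex N) : IsNNDynamics q t a (leftDyn q t a h) := by
  refine hqt.isNNDynamics_of_params ha _ fun k nub lam _ => ?_
  split_ifs with hk
  · exact solvesSystem_leftParams (h k hk) nub lam
  · exact solvesSystem_pbParams nub lam

/-! ### Probabilities of triggered moves of nearest neighbour `dynamics'` -/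

section Slices

variable {a : ℕ → ℝ} {D : SliceData k}

open Classical in
theorem IsSliceDynamics.V_self (hD : IsSliceDynamics q t a k D) {lam nu : Sig (k + 1)}
    {lamb : Sig k} (hi : Interlaces lamb lam) :
    D.V lam nu lamb lamb = if nu = lam then 1 else 0 := by
  split_ifs with h
  · exact (hD.trivial_V lam nu lamb hi).1 h
  · exact (hD.trivial_V lam nu lamb hi).2 h

open Classical in
-- Only one upper move restores interlacing, so the support condition leaves one target and
-- normalization gives it probability one.
theorem IsSliceDynamics.V_of_blocked (hD : IsSliceDynamics q t a k D) {lam nu : Sig (k + 1)}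
    {lamb nub : Sig k} (hi : Interlaces lamb lam) {j : Fin k} (hj : AddBox lamb nub j)
    (hn : ¬ Interlaces nub lam) :
    D.V lam nu lamb nub = if AddBox lam nu j.castSucc then 1 else 0 := by
  have hstep : Step lamb nub := Or.inr ⟨j, hj⟩
  have hzero : ∀ nu, ¬ AddBox lam nu j.castSucc → D.V lam nu lamb nub = 0 := by
    intro nu hnu
    by_contra h
    obtain ⟨h1, h2⟩ := hD.support_V lam nu lamb nub hi hstep h
    rcases h1 with rfl | ⟨m, hm⟩
    · exact hn h2
    · rw [hm.coe_eq] at h2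
      exact hnu (Interlaces.eq_of_blocked_upper (hi.blocked_of_addBox hj hn).1 h2 ▸ hm)
  obtain ⟨nu0, h0, -⟩ := hi.exists_addBox_of_blocked hj hn
  have hsum := hD.sum_V lam lamb nub hi hstep
  rw [finsum_eq_single _ nu0 fun mu hmu => hzero mu fun h => hmu (h.upper_unique h0)] at hsum
  split_ifs with h
  · rw [h.upper_unique h0, hsum]
  · exact hzero nu h

open Classical in
/-- The pushing and pulling probabilities of a nearest neighbour `dynamics'` at a pair of rows. -/
theorem IsSliceDynamics.exists_params (hD : IsSliceDynamics q t a k D) {nub : Sig k}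
    {lam : Sig (k + 1)} (hn : Interlaces nub lam)
    (hNN : ∀ (nu : Sig (k + 1)) (lamb : Sig k) (j : Fin k) (m : Fin (k + 1)),
      Free nub lam j.succ → AddBox lamb nub j → AddBox lam nu m →
      D.V lam nu lamb nub ≠ 0 → m = j.succ ∨ m = xi nub lam j.castSucc) :
    ∃ r l : Fin k → ℝ, ∀ (j : Fin k) (lamb : Sig k) (nu : Sig (k + 1)), AddBox lamb nub j →
      Interlaces lamb lam → D.V lam nu lamb nub =
        (if AddBox lam nu (xi nub lam j.castSucc) then r j else 0)
        + (if AddBox lam nu j.succ then l j else 0)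
        + (if nu = lam then 1 - r j - l j else 0) := by
  have hex : ∀ j : Fin k, ∃ r l : ℝ, ∀ (lamb : Sig k) (nu : Sig (k + 1)), AddBox lamb nub j →
      Interlaces lamb lam → D.V lam nu lamb nub =
        (if AddBox lam nu (xi nub lam j.castSucc) then r else 0)
        + (if AddBox lam nu j.succ then l else 0) + (if nu = lam then 1 - r - l else 0) := by
    intro j
    by_cases hj : Free nub lam j.succ
    swap
    · exact ⟨0, 0, fun lamb nu h hi => absurd ((hn.free_of_lower_addBox h).1 hi) hj⟩
    obtain ⟨lamb, hlamb⟩ := hn.exists_lower_addBox hj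
    have hi : Interlaces lamb lam := (hn.free_of_lower_addBox hlamb).2 hj
    obtain ⟨nu1, h1⟩ := hn.exists_addBox (xi_free nub lam j.castSucc)
    obtain ⟨nu2, h2⟩ := hn.exists_addBox hj
    -- Pushing and pulling reach different particles, since `ξ(j) ≤ j < j + 1`; the two
    -- probabilities can therefore be read off separately.
    have h12 : nu1 ≠ nu2 := by
      rintro rfl
      exact xi_castSucc_ne_succ nub lam j (h1.index_unique h2)
    have hstep : Step lamb nub := Or.inr ⟨j, hlamb⟩
    have hzero : ∀ nu, nu ≠ lam → nu ≠ nu1 → nu ≠ nu2 → D.V lam nu lamb nub = 0 := by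
      intro nu hne hne1 hne2
      by_contra h
      rcases (hD.support_V lam nu lamb nub hi hstep h).1 with h3 | ⟨m, hm⟩
      · exact hne h3
      · rcases hNN nu lamb j m hj hlamb hm h with rfl | rfl
        · exact hne2 (hm.upper_unique h2)
        · exact hne1 (hm.upper_unique h1)
    have hsum := hD.sum_V lam lamb nub hi hstep
    rw [finsum_eq_sum_of_support_subset (s := {lam, nu1, nu2}) _ ?_] at hsum
    · rw [sum_insert (by simp [h1.ne.symm, h2.ne.symm]), sum_insert (by simp [h12]),
        sum_singleton] at hsum
      refine ⟨D.V lam nu1 lamb nub, D.V lam nu2 lamb nub, fun lamb' nu hlamb' _ => ?_⟩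
      obtain rfl := hlamb'.lower_unique hlamb
      by_cases e0 : nu = lam
      · subst e0
        rw [if_neg (not_addBox_self _ _), if_neg (not_addBox_self _ _), if_pos rfl]
        linarith
      by_cases e1 : nu = nu1
      · subst e1
        rw [if_pos h1, if_neg fun h => xi_castSucc_ne_succ nub lam j (h1.index_unique h), if_neg e0]
        ring
      by_cases e2 : nu = nu2
      · subst e2
        rw [if_pos h2, if_neg fun h => xi_castSucc_ne_succ nub lam j (h.index_unique h2), if_neg e0]
        ring
      rw [hzero nu e0 e1 e2, if_neg fun h => e1 (h.upper_unique h1),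
        if_neg fun h => e2 (h.upper_unique h2), if_neg e0]
      ring
    · intro nu hnu
      by_contra h
      simp only [coe_insert, coe_singleton, Set.mem_insert_iff, Set.mem_singleton_iff,
        not_or] at h
      exact hnu (hzero nu h.1 h.2.1 h.2.2)
  choose r l hrl using hex
  exact ⟨r, l, hrl⟩

theorem finite_setOf_interlaces_sig (lam : Sig (k + 1)) :
    {mu : Sig k | Interlaces mu lam}.Finite :=
  (finite_setOf_interlaces lam).preimage Subtype.val_injective.injOn

/-- The intertwining relation determines the rates of independent jumps. -/
theorem IsSliceDynamics.W_eq_sum {ι : Type*} [Fintype ι] (hqt : Admissible q t)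
    (ha : ∀ i < k + 1, 0 < a i) (hD : IsSliceDynamics q t a k D) {F : ι → SliceData k}
    (hF : ∀ i, IsSliceDynamics q t a k (F i)) {θ : ι → ℝ} (hθ : ∑ i, θ i = 1)
    {lam : Sig (k + 1)} {nub : Sig k} (hn : Interlaces nub lam)
    (hV : ∀ (lamb : Sig k) (nu : Sig (k + 1)), Interlaces lamb lam → Step lamb nub →
      D.V lam nu lamb nub = ∑ i, θ i * (F i).V lam nu lamb nub) (nu : Sig (k + 1)) :
    D.W lam nu nub = ∑ i, θ i * (F i).W lam nu nub := by
  by_cases hnu : Interlaces nub nu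
  swap
  · rw [not_not.1 fun h => hnu (hD.support_W lam nu nub hn h).2]
    refine (sum_eq_zero fun i _ => ?_).symm
    rw [not_not.1 fun h => hnu ((hF i).support_W lam nu nub hn h).2, mul_zero]
  have hlink : link q t a k lam nub ≠ 0 := by
    rw [link_eq]
    exact (mul_pos (hqt.linkFactor_pos ha lam nub) (hqt.psi_pos hn)).ne'
  have hfin : ∀ G : Sig k → ℝ, (Function.support fun lamb =>
      G lamb * link q t a k lam lamb * univQ q t a k lamb nub).Finite := fun G =>
    (finite_setOf_interlaces_sig lam).subset fun mu hmu => by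
      by_contra h
      have h0 : link q t a k lam mu = 0 := by rw [link_eq, psi_of_not_interlaces h, mul_zero]
      exact hmu (by simp only [h0, mul_zero, zero_mul])
  have hterm : ∀ lamb, D.V lam nu lamb nub * link q t a k lam lamb * univQ q t a k lamb nub =
      ∑ i, θ i * ((F i).V lam nu lamb nub * link q t a k lam lamb * univQ q t a k lamb nub) := by
    intro lamb
    by_cases hi : Interlaces lamb lam
    · by_cases hs : Step lamb nub
      · rw [hV lamb nu hi hs, sum_mul, sum_mul]
        exact sum_congr rfl fun i _ => by ring
      · simp [univQ_of_not_step a hs]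
    · simp [link_eq, psi_of_not_interlaces hi]
  have h1 := hD.intertwining lam nu nub hnu
  have h2 : ∀ i, θ i * (∑ᶠ lamb, (F i).V lam nu lamb nub * link q t a k lam lamb *
      univQ q t a k lamb nub) + θ i * (F i).W lam nu nub * link q t a k lam nub =
        θ i * (univQ q t a (k + 1) lam nu * link q t a k nu nub) := fun i => by
    rw [← (hF i).intertwining lam nu nub hnu]
    ring
  have h3 := sum_congr (rfl : (univ : Finset ι) = univ) fun i _ => h2 i
  -- The right side of the intertwining relation is common to all members, so their affine
  -- combination satisfies it too; comparison with the relation for `D` leaves the two `W` terms,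
  -- multiplied by a nonzero link.
  rw [sum_add_distrib, ← sum_mul, ← sum_mul, hθ, one_mul, ← h1, finsum_congr hterm,
    finsum_sum_comm] at h3
  · have h4 : ∀ i, (∑ᶠ lamb, θ i * ((F i).V lam nu lamb nub * link q t a k lam lamb *
        univQ q t a k lamb nub)) = θ i * ∑ᶠ lamb, (F i).V lam nu lamb nub *
          link q t a k lam lamb * univQ q t a k lamb nub := fun i =>
      (mul_finsum' _ _ (hfin _)).symm
    rw [sum_congr rfl fun i _ => h4 i] at h3
    exact (mul_right_cancel₀ hlink (add_left_cancel h3)).symm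
  · exact fun i _ => (hfin fun lamb => (F i).V lam nu lamb nub).subset fun mu hmu h0 =>
      hmu (mul_eq_zero_of_right _ h0)

end Slices

/-! ### Equality of generators -/

/-- Agreement of `V` is known only for lower moves by at most one box. If a row above the first
changed level makes a larger move, the lowest such row is the upper row of a slice whose own factor,
`W` or `V`, vanishes for both families. -/
theorem SameRates.offDiagRate_eq {D D' : DynData N} {a : ℕ → ℝ} (h : SameRates D D')
    (hD : IsDynamics q t a D) (X Y : GTArray N) : offDiagRate D X Y = offDiagRate D' X Y := by
  classical
  unfold offDiagRate
  refine sum_congr rfl fun k _ => ?_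
  split_ifs with hk
  swap
  · rfl
  have hW := (h k (X.row k.succ) (Y.row k.succ) (X.row k.castSucc) (X.interlaces k)).1
  by_cases hall : ∀ i : Fin N, k < i → Step (X.row i.castSucc) (Y.row i.castSucc)
  · rw [hW]
    congr 1
    refine prod_congr rfl fun i hi => ?_
    exact (h i _ _ _ (X.interlaces i)).2 _ (hall i (mem_Ioi.1 hi))
  · have hex : ∃ n : ℕ, ∃ hn : n < N, (k : ℕ) < n ∧
        ¬ Step (X.row (Fin.castSucc ⟨n, hn⟩)) (Y.row (Fin.castSucc ⟨n, hn⟩)) := by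
      push Not at hall
      obtain ⟨i, hi, hs⟩ := hall
      exact ⟨i, i.2, hi, hs⟩
    obtain ⟨hn, hkn, hs⟩ := Nat.find_spec hex
    have hmin := fun m => Nat.find_min hex (m := m)
    generalize Nat.find hex = n at hn hkn hs hmin
    -- The lower row of slice `m + 1` is the upper row of slice `m`, so the support conditions of
    -- slice `m` apply.
    obtain ⟨m, rfl⟩ : ∃ m, n = m + 1 := ⟨n - 1, by omega⟩
    have hm : m < N := by omega
    have hs' : ¬ Step (X.row (Fin.succ ⟨m, hm⟩)) (Y.row (Fin.succ ⟨m, hm⟩)) := hs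
    rcases (Nat.lt_succ_iff.1 hkn).eq_or_lt with hkm | hkm
    · obtain rfl : k = ⟨m, hm⟩ := Fin.ext hkm
      have h0 : (D ⟨m, hm⟩).W (X.row (Fin.succ ⟨m, hm⟩)) (Y.row (Fin.succ ⟨m, hm⟩))
          (X.row (Fin.castSucc ⟨m, hm⟩)) = 0 :=
        not_not.1 fun h' => hs' ((hD _).support_W _ _ _ (X.interlaces _) h').1
      rw [← hW, h0, zero_mul, zero_mul]
    · have hstep : Step (X.row (Fin.castSucc ⟨m, hm⟩)) (Y.row (Fin.castSucc ⟨m, hm⟩)) := by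
        by_contra h'
        exact hmin m (by omega) ⟨hm, hkm, h'⟩
      have h0 : (D ⟨m, hm⟩).V (X.row (Fin.succ ⟨m, hm⟩)) (Y.row (Fin.succ ⟨m, hm⟩))
          (X.row (Fin.castSucc ⟨m, hm⟩)) (Y.row (Fin.castSucc ⟨m, hm⟩)) = 0 :=
        not_not.1 fun h' => hs' ((hD _).support_V _ _ _ _ (X.interlaces _) hstep h').1
      have h0' := h0
      rw [(h ⟨m, hm⟩ _ _ _ (X.interlaces _)).2 _ hstep] at h0'
      have hmem : (⟨m, hm⟩ : Fin N) ∈ Ioi k := mem_Ioi.2 hkm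
      rw [prod_eq_zero hmem h0, prod_eq_zero hmem h0', mul_zero, mul_zero]

theorem SameRates.generator_eq {D D' : DynData N} {a : ℕ → ℝ} (h : SameRates D D')
    (hD : IsDynamics q t a D) : generator D = generator D' := by
  funext X Y
  unfold generator
  simp only [h.offDiagRate_eq hD]

/-! ### Mixing is a local matter -/

/-- Trivial and blocked lower moves have the same probabilities in every dynamics, so any weights of
sum one reproduce them. The rates `W` and the generator are then determined by the `V`. -/
theorem Admissible.isMixing_of_local (hqt : Admissible q t) {a : ℕ → ℝ} (ha : ∀ k < N, 0 < a k)
    {ι : Type} [Fintype ι] [Nonempty ι] {D : DynData N} (hD : IsNNDynamics q t a D)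
    {F : ι → DynData N} (hF : ∀ i, IsNNDynamics q t a (F i))
    (hloc : ∀ (k : Fin N) (nub : Sig k) (lam : Sig (k + 1)), Interlaces nub lam →
      ∃ θ : ι → ℝ, ∑ i, θ i = 1 ∧ ∀ (j : Fin k) (lamb : Sig k) (nu : Sig (k + 1)),
        AddBox lamb nub j → Interlaces lamb lam →
          (D k).V lam nu lamb nub = ∑ i, θ i * (F i k).V lam nu lamb nub) :
    IsMixing D F := by
  classical
  have hex : ∀ (k : Fin N) (nub : Sig k) (lam : Sig (k + 1)), ∃ θ : ι → ℝ, ∑ i, θ i = 1 ∧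
      (Interlaces nub lam → ∀ (j : Fin k) (lamb : Sig k) (nu : Sig (k + 1)),
        AddBox lamb nub j → Interlaces lamb lam →
          (D k).V lam nu lamb nub = ∑ i, θ i * (F i k).V lam nu lamb nub) := by
    intro k nub lam
    by_cases hi : Interlaces nub lam
    · obtain ⟨θ, h1, h2⟩ := hloc k nub lam hi
      exact ⟨θ, h1, fun _ => h2⟩
    -- At pairs that do not interlace only the normalization of the weights matters.
    · exact ⟨Pi.single (Classical.arbitrary ι) 1, by simp, fun h => absurd h hi⟩
  choose θ hθ hV using hex
  have hVall : ∀ (k : Fin N) (lam nu : Sig (k + 1)) (lamb nub : Sig k), Interlaces lamb lam →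
      Step lamb nub →
      (D k).V lam nu lamb nub = ∑ i, θ k nub lam i * (F i k).V lam nu lamb nub := by
    intro k lam nu lamb nub hi hs
    rcases hs with rfl | ⟨j, hj⟩
    · rw [(hD.1 k).V_self hi, sum_congr rfl fun i _ => by rw [((hF i).1 k).V_self hi], ← sum_mul,
        hθ, one_mul]
    · by_cases hn : Interlaces nub lam
      · exact hV k nub lam hn j lamb nu hj hi
      · rw [(hD.1 k).V_of_blocked hi hj hn,
          sum_congr rfl fun i _ => by rw [((hF i).1 k).V_of_blocked hi hj hn], ← sum_mul,
          hθ, one_mul]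
  have hsame : SameRates D (mix (fun i k nub lam => θ k nub lam i) F) := by
    intro k lam nu lamb hi
    refine ⟨?_, fun nub hs => hVall k lam nu lamb nub hi hs⟩
    exact (hD.1 k).W_eq_sum hqt (fun i hi => ha i (by omega)) (fun i => (hF i).1 k)
      (hθ k lamb lam) hi (fun lamb' nu' hi' hs' => hVall k lam nu' lamb' lamb hi' hs') nu
  exact ⟨_, hθ, hsame, hsame.generator_eq hD.1⟩

/-- It suffices to match the pushing and pulling probabilities at every pair of rows. -/
theorem Admissible.isMixing_of_params (hqt : Admissible q t) {a : ℕ → ℝ} (ha : ∀ k < N, 0 < a k)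
    {ι : Type} [Fintype ι] [Nonempty ι] {D : DynData N} (hD : IsNNDynamics q t a D)
    {F : ι → DynData N} (hF : ∀ i, IsNNDynamics q t a (F i)) {κ : ℕ → Type}
    [∀ k, Fintype (κ k)] (G : (k : Fin N) → κ k → ι)
    (p : (k : ℕ) → κ k → Sig k → Sig (k + 1) → NNParams k)
    (hG : ∀ (k : Fin N) (c : κ k), F (G k c) k = sliceOfParams (a k) (p k c))
    (hsolve : ∀ (k : Fin N) (nub : Sig k) (lam : Sig (k + 1)), Interlaces nub lam →
      ∀ r l : Fin k → ℝ, ∃ θ : κ k → ℝ, ∑ c, θ c = 1 ∧ ∀ j : Fin k, Free nub lam j.succ →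
        ∑ c, θ c * (p k c nub lam).r j = r j ∧ ∑ c, θ c * (p k c nub lam).l j = l j) :
    IsMixing D F := by
  classical
  refine hqt.isMixing_of_local ha hD hF fun k nub lam hn => ?_
  obtain ⟨r, l, hrl⟩ := (hD.1 k).exists_params hn fun nu lamb j m hj hlamb hm h =>
    hD.2 k lam nu lamb nub j m hn hj hlamb hm h
  obtain ⟨θ, hθ, hθj⟩ := hsolve k nub lam hn r l
  -- The weights on one slice are pushed forward along `G k` to the index set of the whole family.
  have hpush : ∀ f : ι → ℝ, ∑ i, (∑ c, if G k c = i then θ c else 0) * f i =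
      ∑ c, θ c * f (G k c) := by
    intro f
    simp only [sum_mul, ite_mul, zero_mul]
    rw [sum_comm]
    simp
  refine ⟨fun i => ∑ c, if G k c = i then θ c else 0, ?_, fun j lamb nu hj hi => ?_⟩
  · have := hpush fun _ => 1
    simpa [hθ] using this
  · rw [hpush fun i => (F i k).V lam nu lamb nub, hrl j lamb nu hj hi]
    obtain ⟨h1, h2⟩ := hθj j ((hn.free_of_lower_addBox hj).1 hi)
    rw [sum_congr rfl fun c _ => by rw [hG k c, sliceOfParams_V_of_addBox hj hn]]
    simp only [mul_add, mul_ite, mul_zero, mul_sub, mul_one]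
    rw [sum_add_distrib, sum_add_distrib]
    congr 1
    · congr 1
      · split_ifs <;> simp [h1]
      · split_ifs <;> simp [h2]
    · split_ifs
      · rw [sum_sub_distrib, sum_sub_distrib, hθ, h1, h2]
      · simp

/-! ### Solving for the mixing coefficients -/

/-- Prescribing all partial sums, with total sum zero, is a triangular system solved by successive
differences. -/
theorem exists_sum_le_eq (G : Fin k → ℝ) : ∃ u : Fin (k + 1) → ℝ, ∑ h, u h = 0 ∧
    ∀ j : Fin k, (∑ h, if h ≤ j.castSucc then u h else 0) = G j := by
  induction k with
  | zero => exact ⟨0, by simp, fun j => j.elim0⟩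
  | succ k ih =>
    obtain ⟨u, h1, h2⟩ := ih fun j => G j.castSucc
    refine ⟨Fin.snoc (fun i => u i + if i = Fin.last k then G (Fin.last k) else 0)
      (-G (Fin.last k)), ?_, fun j => ?_⟩
    · rw [Fin.sum_univ_castSucc]
      simp [sum_add_distrib, h1]
    · rw [Fin.sum_univ_castSucc, if_neg (not_le.2 (Fin.castSucc_lt_last j)), add_zero]
      simp only [Fin.snoc_castSucc, Fin.castSucc_le_castSucc_iff]
      induction j using Fin.lastCases with
      | last => simp [Fin.le_last, sum_add_distrib, h1]
      | cast j =>
        rw [← h2 j]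
        refine sum_congr rfl fun i _ => ?_
        by_cases hi : i = Fin.last k
        · subst hi
          simp [not_le.2 (Fin.castSucc_lt_last j)]
        · simp [hi]

/-- RSK-type parameters can be combined, with coefficients summing to zero, to any pulling
probabilities. -/
theorem Admissible.exists_rsk_combination (hqt : Admissible q t) {nub : Sig k}
    {lam : Sig (k + 1)} (hi : Interlaces nub lam) (l : Fin k → ℝ) :
    ∃ u : Fin (k + 1) → ℝ, ∑ h, u h = 0 ∧ ∀ j : Fin k, Free nub lam j.succ →
      ∑ h, u h * (rskParams q t h nub lam).r j = -l j ∧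
        ∑ h, u h * (rskParams q t h nub lam).l j = l j := by
  -- Because `Σ u = 0`, the part of `r_j` independent of `h` drops out; what remains is `-T_j⁻¹`
  -- times a partial sum of `u`.
  obtain ⟨u, h1, h2⟩ := exists_sum_le_eq fun j => coefT q t nub lam j * l j
  refine ⟨u, h1, fun j hj => ?_⟩
  have hT := (hqt.coefT_pos hi hj).ne'
  have hr : ∑ h, u h * (rskParams q t h nub lam).r j = -l j := by
    have h3 : ∀ h, u h * (rskParams q t h nub lam).r j = u h * ((coefT q t nub lam j)⁻¹ *
        cumulative q t nub lam j.castSucc) -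
          (coefT q t nub lam j)⁻¹ * if h ≤ j.castSucc then u h else 0 := fun h => by
      simp only [rskParams, ← cumulative_castSucc]
      split_ifs <;> ring
    rw [sum_congr rfl fun h _ => h3 h, sum_sub_distrib, ← sum_mul, h1, ← mul_sum, h2 j,
      inv_mul_cancel_left₀ hT]
    ring
  refine ⟨hr, ?_⟩
  simp only [rskParams_l, mul_sub, mul_one]
  rw [sum_sub_distrib, h1, hr]
  ring

/-- The weights are the parameters themselves, since right-pushing and left-pulling give unit
vectors; push-block, at the origin, absorbs the missing mass. -/
theorem exists_mixing_right_left (nub : Sig k) (lam : Sig (k + 1)) (r l : Fin k → ℝ) :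
    ∃ θ : Unit ⊕ Fin k ⊕ Fin k → ℝ, ∑ c, θ c = 1 ∧ ∀ j : Fin k, Free nub lam j.succ →
      ∑ c, θ c * ((Sum.elim (fun _ => pbParams q t) (Sum.elim (fun h => rightParams q t h)
        (fun h => leftParams q t h)) :
          Unit ⊕ Fin k ⊕ Fin k → Sig k → Sig (k + 1) → NNParams k) c nub lam).r j = r j ∧
      ∑ c, θ c * ((Sum.elim (fun _ => pbParams q t) (Sum.elim (fun h => rightParams q t h)
        (fun h => leftParams q t h)) :
          Unit ⊕ Fin k ⊕ Fin k → Sig k → Sig (k + 1) → NNParams k) c nub lam).l j = l j := by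
  refine ⟨Sum.elim (fun _ => 1 - ∑ j, r j - ∑ j, l j) (Sum.elim r l), ?_, fun j _ => ?_⟩
  · simp
  · simp [pbParams, rightParams, leftParams]

/-- The RSK combination supplies `l` at the cost of `r = -l`, so right-pushing has to supply `r +
l`. -/
theorem Admissible.exists_mixing_rsk_right (hqt : Admissible q t) {nub : Sig k}
    {lam : Sig (k + 1)} (hi : Interlaces nub lam) (r l : Fin k → ℝ) :
    ∃ θ : Unit ⊕ Fin (k + 1) ⊕ Fin k → ℝ, ∑ c, θ c = 1 ∧ ∀ j : Fin k, Free nub lam j.succ →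
      ∑ c, θ c * ((Sum.elim (fun _ => pbParams q t) (Sum.elim (fun h => rskParams q t h)
        (fun h => rightParams q t h)) :
          Unit ⊕ Fin (k + 1) ⊕ Fin k → Sig k → Sig (k + 1) → NNParams k) c nub lam).r j = r j ∧
      ∑ c, θ c * ((Sum.elim (fun _ => pbParams q t) (Sum.elim (fun h => rskParams q t h)
        (fun h => rightParams q t h)) :
          Unit ⊕ Fin (k + 1) ⊕ Fin k → Sig k → Sig (k + 1) → NNParams k) c nub lam).l j = l j := by
  obtain ⟨u, h1, h2⟩ := hqt.exists_rsk_combination hi l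
  refine ⟨Sum.elim (fun _ => 1 - ∑ j, (r j + l j)) (Sum.elim u fun j => r j + l j), ?_,
    fun j hj => ?_⟩
  · simp [h1]
  · simp [pbParams, rightParams, h2 j hj]

/-- Here the RSK combination supplies `r` together with `l = -r`, and left-pulling supplies `r + l`.
-/
theorem Admissible.exists_mixing_rsk_left (hqt : Admissible q t) {nub : Sig k}
    {lam : Sig (k + 1)} (hi : Interlaces nub lam) (r l : Fin k → ℝ) :
    ∃ θ : Unit ⊕ Fin (k + 1) ⊕ Fin k → ℝ, ∑ c, θ c = 1 ∧ ∀ j : Fin k, Free nub lam j.succ →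
      ∑ c, θ c * ((Sum.elim (fun _ => pbParams q t) (Sum.elim (fun h => rskParams q t h)
        (fun h => leftParams q t h)) :
          Unit ⊕ Fin (k + 1) ⊕ Fin k → Sig k → Sig (k + 1) → NNParams k) c nub lam).r j = r j ∧
      ∑ c, θ c * ((Sum.elim (fun _ => pbParams q t) (Sum.elim (fun h => rskParams q t h)
        (fun h => leftParams q t h)) :
          Unit ⊕ Fin (k + 1) ⊕ Fin k → Sig k → Sig (k + 1) → NNParams k) c nub lam).l j = l j := by
  obtain ⟨u, h1, h2⟩ := hqt.exists_rsk_combination hi fun j => -r j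
  refine ⟨Sum.elim (fun _ => 1 - ∑ j, (r j + l j)) (Sum.elim u fun j => r j + l j), ?_,
    fun j hj => ?_⟩
  · simp [h1]
  · simp [pbParams, leftParams, h2 j hj]

/-! ### Fundamental `dynamics'` with a prescribed slice -/

/-- An index of an RSK-type `dynamics'` with the value `c` on the slice `k`. -/
def rskIndexWith (k : Fin N) (c : Fin (k + 1)) : RSKIndex N := Function.update (fun _ => 0) k c

/-- An index of a right-pushing or left-pulling `dynamics'` with the value `c` on the slice `k`. -/
def rlIndexWith (k : Fin N) (c : Fin k) : RLIndex N :=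
  Function.update (fun _ hk => ⟨0, hk⟩) k fun _ => c

theorem rskDyn_rskIndexWith (a : ℕ → ℝ) (k : Fin N) (c : Fin (k + 1)) :
    rskDyn q t a (rskIndexWith k c) k = sliceOfParams (a k) (rskParams q t c) := by
  simp [rskDyn, rskIndexWith]

theorem rightDyn_rlIndexWith (a : ℕ → ℝ) (k : Fin N) (c : Fin k) :
    rightDyn q t a (rlIndexWith k c) k = sliceOfParams (a k) (rightParams q t c) := by
  simp [rightDyn, rlIndexWith, Fin.pos c]

theorem leftDyn_rlIndexWith (a : ℕ → ℝ) (k : Fin N) (c : Fin k) :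
    leftDyn q t a (rlIndexWith k c) k = sliceOfParams (a k) (leftParams q t c) := by
  simp [leftDyn, rlIndexWith, Fin.pos c]

end MacdonaldArrays

end

/-! ### Assembly of the four decompositions -/

theorem mainTheorem1 (N : ℕ) (q t : ℝ) (hq : 0 ≤ q) (hq1 : q < 1) (ht : 0 ≤ t) (ht1 : t < 1)
    (a : ℕ → ℝ) (ha : ∀ k < N, 0 < a k) :
    -- the fundamental objects are nearest neighbour multivariate `dynamics'
    (IsNNDynamics q t a (pushBlock q t a N) ∧
      (∀ h : RSKIndex N, IsNNDynamics q t a (rskDyn q t a h)) ∧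
      (∀ h : RLIndex N, IsNNDynamics q t a (rightDyn q t a h)) ∧
      (∀ h : RLIndex N, IsNNDynamics q t a (leftDyn q t a h))) ∧
    ∀ D : DynData N, IsNNDynamics q t a D →
      -- all four families
      IsMixing D (Sum.elim (fun _ : Unit => pushBlock q t a N)
        (Sum.elim (fun h : RSKIndex N => rskDyn q t a h)
          (Sum.elim (fun h : RLIndex N => rightDyn q t a h)
            (fun h : RLIndex N => leftDyn q t a h)))) ∧
      -- RSK-type, right-pushing, push-block
      IsMixing D (Sum.elim (fun _ : Unit => pushBlock q t a N)
        (Sum.elim (fun h : RSKIndex N => rskDyn q t a h)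
          (fun h : RLIndex N => rightDyn q t a h))) ∧
      -- RSK-type, left-pulling, push-block
      IsMixing D (Sum.elim (fun _ : Unit => pushBlock q t a N)
        (Sum.elim (fun h : RSKIndex N => rskDyn q t a h)
          (fun h : RLIndex N => leftDyn q t a h))) ∧
      -- right-pushing, left-pulling, push-block
      IsMixing D (Sum.elim (fun _ : Unit => pushBlock q t a N)
        (Sum.elim (fun h : RLIndex N => rightDyn q t a h)
          (fun h : RLIndex N => leftDyn q t a h))) := by
  have hqt : Admissible q t := ⟨hq, hq1, ht, ht1⟩
  have hpb := hqt.isNNDynamics_pushBlock ha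
  have hrsk := hqt.isNNDynamics_rskDyn ha
  have hright := hqt.isNNDynamics_rightDyn ha
  have hleft := hqt.isNNDynamics_leftDyn ha
  refine ⟨⟨hpb, hrsk, hright, hleft⟩, fun D hD => ⟨?_, ?_, ?_, ?_⟩⟩
  -- For the full family the RSK-type members receive weight zero.
  · refine hqt.isMixing_of_params ha hD (κ := fun k => Unit ⊕ Fin k ⊕ Fin k)
      (by rintro (_ | h | h | h); exacts [hpb, hrsk h, hright h, hleft h])
      (fun k => Sum.elim Sum.inl (Sum.elim (fun c => Sum.inr (Sum.inr (Sum.inl (rlIndexWith k c))))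
        fun c => Sum.inr (Sum.inr (Sum.inr (rlIndexWith k c)))))
      (fun k => Sum.elim (fun _ => pbParams q t) (Sum.elim (fun h => rightParams q t h)
        fun h => leftParams q t h)) ?_ fun k nub lam _ => exists_mixing_right_left nub lam
    rintro k (c | c | c)
    exacts [rfl, rightDyn_rlIndexWith a k c, leftDyn_rlIndexWith a k c]
  · refine hqt.isMixing_of_params ha hD (κ := fun k => Unit ⊕ Fin (k + 1) ⊕ Fin k)
      (by rintro (_ | h | h); exacts [hpb, hrsk h, hright h])
      (fun k => Sum.map id (Sum.map (rskIndexWith k) (rlIndexWith k)))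
      (fun k => Sum.elim (fun _ => pbParams q t) (Sum.elim (fun h => rskParams q t h)
        fun h => rightParams q t h)) ?_ fun k nub lam hi => hqt.exists_mixing_rsk_right hi
    rintro k (c | c | c)
    exacts [rfl, rskDyn_rskIndexWith a k c, rightDyn_rlIndexWith a k c]
  · refine hqt.isMixing_of_params ha hD (κ := fun k => Unit ⊕ Fin (k + 1) ⊕ Fin k)
      (by rintro (_ | h | h); exacts [hpb, hrsk h, hleft h])
      (fun k => Sum.map id (Sum.map (rskIndexWith k) (rlIndexWith k)))
      (fun k => Sum.elim (fun _ => pbParams q t) (Sum.elim (fun h => rskParams q t h)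
        fun h => leftParams q t h)) ?_ fun k nub lam hi => hqt.exists_mixing_rsk_left hi
    rintro k (c | c | c)
    exacts [rfl, rskDyn_rskIndexWith a k c, leftDyn_rlIndexWith a k c]
  · refine hqt.isMixing_of_params ha hD (κ := fun k => Unit ⊕ Fin k ⊕ Fin k)
      (by rintro (_ | h | h); exacts [hpb, hright h, hleft h])
      (fun k => Sum.map id (Sum.map (rlIndexWith k) (rlIndexWith k)))
      (fun k => Sum.elim (fun _ => pbParams q t) (Sum.elim (fun h => rightParams q t h)
        fun h => leftParams q t h)) ?_ fun k nub lam _ => exists_mixing_right_left nub lam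
    rintro k (c | c | c)
    exacts [rfl, rightDyn_rlIndexWith a k c, leftDyn_rlIndexWith a k c]
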